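/- Let $\mathcal X$ be the set of locally finite sets $\eta\subset\mathbb R$ ("configurations"), unbounded to the left, with $\lim_{s\to\infty}|\eta\cap[0,s]|^2/s=\infty$. For locally finite sets $A,S\subset\mathbb R$ let $Z$ be the walk with $Z_0=0$ and $Z_r-Z_s=|A\cap(s,r]|-|S\cap(s,r]|$ for $s\le r$, and put $U(A,S)=\{r\in S: Z_r<\inf_{r'<r}Z_{r'}\}$, $D(A,S)=S\setminus U(A,S)$. Put $D^{(1)}(\alpha^1)=\alpha^1$ and $D^{(m)}(\alpha^1,\dots,\alpha^m)=D(D^{(m-1)}(\alpha^1,\dots,\alpha^{m-1}),\alpha^m)$. For $\alpha=(\alpha^1,\dots,\alpha^n)\in\mathcal X^n$ let $(C\alpha)^k=D^{(n-k+1)}(\alpha^k,\dots,\alpha^n)$, let $(R\eta)^k=\eta^k\setminus\eta^{k-1}$ (with $\eta^0=\emptyset$), $(R^{-1}\xi)^k=\xi^1\cup\dots\cup\xi^k$, and $M=RC$. Say that $C\alpha$ (equivalently $M\alpha$) is well defined if $\alpha\in\mathcal X^n$, $C\alpha\in\mathcal X^n$, and, for all $k<j$, the walk with arrivals $D^{(j-k)}(\alpha^k,\dots,\alpha^{j-1})$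 and services $\alpha^j$ tends to $+\infty$ at $-\infty$. For $x\in\mathbb R$ let $H(\eta,x)$ be obtained from $\eta=(\eta^1,\dots,\eta^n)$ by moving to $x$, in every line $\eta^k$, the closest particle to the left of $x$. Let $x^{n+1}=x$, let $x^k$ be the closest particle of $\alpha^k$ to the left of $x^{k+1}$ ($k=n,\dots,1$), and let $J(\alpha,x)$ have $k$-th line $(\alpha^k\setminus\{x^k\})\cup\{x^{k+1}\}$. (Here "to the left of $y$" means in $(-\infty,y]$.) Let $\omega$ be a homogeneous rate-1 Poisson process on $\mathbb R\times[0,\infty)$ (space $\times$ time). The coupled Hammersley–Aldous–Diaconis process $\Phi(t,\eta,\omega)$ and the multi-line process $\Psi(t,\alpha,\omega)$ governed by $\omega$ are the local limits, as $N\to\infty$, of the configurations obtained from $\eta$, respectively $\alpha$, by applying in order of time the jumps $H(\cdot,x)$, respectively $J(\cdot,x)$, for the points $(x,s)$ of $\omega$ in $[-N,N]\times(0,t]$. The multiclass process is $\Upsilon(t,\xi,\omega)=R\,\Phi(t,R^{-1}\xi,\omega)$. Let $\alpha$ be a multi-line configuration such that $C\alpha$ is well defined. Then $H(C\alpha,x)=C\,J(\alpha,x)$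 for every $x\in\mathbb R$. Moreover, almost surely, for all $t\ge 0$: the limits defining $\Psi(t,\alpha,\omega)$ and $\Phi(t,C\alpha,\omega)$ exist, $C\Psi(t,\alpha,\omega)$ is again well defined, $$C\,\Psi(t,\alpha,\omega)=\Phi(t,C\alpha,\omega)\qquad\text{and}\qquad M\,\Psi(t,\alpha,\omega)=\Upsilon(t,M\alpha,\omega).$$ That is, with $\alpha_t=\Psi(t,\alpha,\omega)$, $(C\alpha_t)_{t\ge0}$ is the coupled process started from $C\alpha$ and $(M\alpha_t)_{t\ge0}$ is the multiclass process started from $M\alpha$, both governed by the same $\omega$. -/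

import Mathlib

open Set Filter Topology MeasureTheory ProbabilityTheory

noncomputable section

namespace HAD

/-! ### Configurations -/

/-- The state space `𝒳` of particle configurations on the line: locally finite sets `η` with
`|η ∩ [0, s]|² / s → ∞` as `s → ∞`, having particles arbitrarily far to the left (so that "the
closest particle of `η` to the left of `x`" exists for every `x`). -/
structure IsConfig (η : Set ℝ) : Prop where
  locallyFinite : ∀ a b : ℝ, (η ∩ Icc a b).Finite
  left_unbounded : ∀ x : ℝ, ∃ y ∈ η, y < x
  growth : Tendsto (fun s : ℝ => ((η ∩ Icc 0 s).ncard : ℝ) ^ 2 / s) atTop atTop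

/-- The position of the closest particle of `η` to the left of `x`, i.e. the largest element of
`η ∩ (-∞, x]` (a maximum when `η` is a configuration).  A particle sitting exactly at `x` counts;
this matters only for configurations with coinciding positions. -/
def leftNearest (η : Set ℝ) (x : ℝ) : ℝ := sSup (η ∩ Iic x)

/-! ### Queues -/

/-- The walk `Z`, with `Z 0 = 0`, going one unit up at the points of `A` (arrivals) and one unit
down at the points of `S` (services): `Z r - Z s = |A ∩ (s, r]| - |S ∩ (s, r]|` for `s ≤ r`. -/
def walk (A S : Set ℝ) (r : ℝ) : ℤ :=
  (((A ∩ Ioc 0 r).ncard : ℤ) - (S ∩ Ioc 0 r).ncard) -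
    (((A ∩ Ioc r 0).ncard : ℤ) - (S ∩ Ioc r 0).ncard)

/-- Unused services: the times `r ∈ S` at which the walk attains a new record down,
`Z r < inf_{r' < r} Z r'`.  (As `Z` is integer valued, being below the infimum is the same as being
below every earlier value.) -/
def unused (A S : Set ℝ) : Set ℝ := {r ∈ S | ∀ r' < r, walk A S r < walk A S r'}

/-- The departures `D(A, S) = S \ U(A, S)`. -/
def departures (A S : Set ℝ) : Set ℝ := S \ unused A S

/-- `D^{(m)}(α¹, …, αᵐ)`: `D^{(1)}(α¹) = α¹` and
`D^{(m)}(α¹, …, αᵐ) = D(D^{(m-1)}(α¹, …, α^{m-1}), αᵐ)`. -/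
def tandem : List (Set ℝ) → Set ℝ
  | [] => ∅
  | a :: l => l.foldl departures a

variable {n : ℕ}

/-- The map `C` from multi-line to coupled configurations, `(Cα)ᵏ = D^{(n-k+1)}(αᵏ, …, αⁿ)`
(the lines being indexed here from `0` to `n - 1`). -/
def C (α : Fin n → Set ℝ) (k : Fin n) : Set ℝ := tandem ((List.ofFn α).drop k)

/-- The map `R` from coupled to multiclass configurations, `(Rη)ᵏ = ηᵏ \ ηᵏ⁻¹` (with `η⁰ = ∅`). -/
def R (η : Fin n → Set ℝ) (k : Fin n) : Set ℝ :=
  η k \ ⋃ (j : Fin n) (_ : (j : ℕ) + 1 = k), η j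

/-- The inverse of `R` on ordered configurations, `(R⁻¹ξ)ᵏ = ξ¹ ∪ ⋯ ∪ ξᵏ`. -/
def Rinv (ξ : Fin n → Set ℝ) (k : Fin n) : Set ℝ := ⋃ (j : Fin n) (_ : j ≤ k), ξ j

/-- The map `M = R C` from multi-line to multiclass configurations. -/
def M (α : Fin n → Set ℝ) : Fin n → Set ℝ := R (C α)

/-- `α ∈ 𝒳ⁿ` and `Cα` (equivalently `Mα`) is well defined.  In every queue entering the definition
of `Cα`, with arrivals `D^{(j-k)}(αᵏ, …, α^{j-1})` and services `αʲ`, the walk tends to `+∞` at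
`-∞`, so that its past infima are finite (the behaviour of the walk at `+∞` plays no role and is
not restricted), and the lines of `Cα` belong to `𝒳`. -/
structure CWellDefined (α : Fin n → Set ℝ) : Prop where
  config : ∀ k, IsConfig (α k)
  stable : ∀ k j : Fin n, k < j →
    Tendsto (walk (tandem (((List.ofFn α).take j).drop k)) (α j)) atBot atTop
  image_config : ∀ k, IsConfig (C α k)

/-! ### Jumps -/

/-- The coupled jump `H(η, x)`: in each line the closest particle to the left of `x` jumps to
`x`. -/
def H (η : Fin n → Set ℝ) (x : ℝ) (k : Fin n) : Set ℝ := (η k \ {leftNearest (η k) x}) ∪ {x}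

/-- The positions `xᵏ` of the particles jumping in the multi-line process because of a point at
`x`: `x^{n+1} = x`, and `xᵏ` is the closest particle of `αᵏ` to the left of `x^{k+1}`.  (With lines
indexed from `0`, the starting value `x` is `linePos α x n`.) -/
def linePos (α : Fin n → Set ℝ) (x : ℝ) (k : ℕ) : ℝ :=
  ((List.ofFn α).drop k).foldr leftNearest x

/-- The multi-line jump `J(α, x)`: in line `k` the particle at `xᵏ` jumps to `x^{k+1}`. -/
def J (α : Fin n → Set ℝ) (x : ℝ) (k : Fin n) : Set ℝ :=
  (α k \ {linePos α x k}) ∪ {linePos α x (k + 1)}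

/-! ### The graphical construction -/

/-- The points of `ω` in the finite region `[-N, N] × (0, t]`. -/
def regionPoints (ω : Set (ℝ × ℝ)) (N : ℕ) (t : ℝ) : Set (ℝ × ℝ) :=
  {p ∈ ω | |p.1| ≤ N ∧ 0 < p.2 ∧ p.2 ≤ t}

open Classical in
/-- The space coordinates of the points of `ω` in `[-N, N] × (0, t]`, listed in the order of their
time coordinates. -/
def orderedPoints (ω : Set (ℝ × ℝ)) (N : ℕ) (t : ℝ) : List ℝ :=
  if h : (regionPoints ω N t).Finite then
    ((h.toFinset.image fun p => toLex (p.2, p.1)).sort (· ≤ ·)).map fun q => (ofLex q).2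
  else []

/-- Apply the jumps `jump` produced by the points of `ω` in `[-N, N] × (0, t]`, in the order of
time, to the initial configuration `η`. -/
def regionProcess (jump : (Fin n → Set ℝ) → ℝ → Fin n → Set ℝ) (N : ℕ) (t : ℝ)
    (η : Fin n → Set ℝ) (ω : Set (ℝ × ℝ)) : Fin n → Set ℝ :=
  (orderedPoints ω N t).foldl jump η

/-- The process governed by the points `ω` on the whole line, with initial configuration `η`, at
time `t`: the limit of the finite-region constructions as the region grows to the whole line. -/
def process (jump : (Fin n → Set ℝ) → ℝ → Fin n → Set ℝ) (t : ℝ)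
    (η : Fin n → Set ℝ) (ω : Set (ℝ × ℝ)) (k : Fin n) : Set ℝ :=
  {y | ∀ᶠ N : ℕ in atTop, y ∈ regionProcess jump N t η ω k}

/-- The limit defining `process` exists: in each bounded interval the finite-region constructions
are eventually equal to it. -/
def ProcessExists (jump : (Fin n → Set ℝ) → ℝ → Fin n → Set ℝ) (t : ℝ)
    (η : Fin n → Set ℝ) (ω : Set (ℝ × ℝ)) : Prop :=
  ∀ (k : Fin n) (L : ℝ), ∀ᶠ N : ℕ in atTop,
    regionProcess jump N t η ω k ∩ Icc (-L) L = process jump t η ω k ∩ Icc (-L) L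

/-- The coupled Hammersley-Aldous-Diaconis process `Φ(t, η, ω)`. -/
def Φ (t : ℝ) (η : Fin n → Set ℝ) (ω : Set (ℝ × ℝ)) : Fin n → Set ℝ := process H t η ω

/-- The multi-line process `Ψ(t, α, ω)`. -/
def Ψ (t : ℝ) (α : Fin n → Set ℝ) (ω : Set (ℝ × ℝ)) : Fin n → Set ℝ := process J t α ω

/-- The multiclass process `Υ(t, ξ, ω) = R Φ(t, R⁻¹ξ, ω)`. -/
def Υ (t : ℝ) (ξ : Fin n → Set ℝ) (ω : Set (ℝ × ℝ)) : Fin n → Set ℝ := R (Φ t (Rinv ξ) ω)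

/-! ### The driving points -/

/-- `ω` is a homogeneous rate-1 Poisson process on the space-time half plane `ℝ × [0, ∞)` (first
coordinate space, second coordinate time): a random locally finite set whose numbers of points in
bounded Borel sets are Poisson with mean the area, independently over disjoint sets. -/
structure IsPoissonPoints {Ω : Type*} [MeasurableSpace Ω] (P : Measure Ω)
    (ω : Ω → Set (ℝ × ℝ)) : Prop where
  subset : ∀ w, ω w ⊆ {p | 0 ≤ p.2}
  locallyFinite : ∀ w (B : Set (ℝ × ℝ)), Bornology.IsBounded B → (ω w ∩ B).Finite
  measurable_count : ∀ B : Set (ℝ × ℝ), MeasurableSet B → Bornology.IsBounded B →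
    Measurable fun w => (ω w ∩ B).ncard
  law_count : ∀ B : Set (ℝ × ℝ), MeasurableSet B → Bornology.IsBounded B → B ⊆ {p | 0 ≤ p.2} →
    P.map (fun w => (ω w ∩ B).ncard) = poissonMeasure (volume B).toNNReal
  indep_count : ∀ (m : ℕ) (B : Fin m → Set (ℝ × ℝ)), (∀ i, MeasurableSet (B i)) →
    (∀ i, Bornology.IsBounded (B i)) → Pairwise (fun i j => Disjoint (B i) (B j)) →
    iIndepFun (fun i w => (ω w ∩ B i).ncard) P

end HAD

end

/-! A configuration is encoded by an integer height that drops by one at each particle. A jump to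
`x` replaces `h` by `hop h x`, whose value left of `x` is `max (h y) (h x + 1)`. If a queue has
arrival height `a` and service height `s`, its departures have height `s + M`, where `M` is the
running maximum of `a - s` over the past. When a service particle jumps from `σ` to `x` while an
arrival jumps to `σ`, the departures jump to `x`: this is an identity between running maxima
(`RunMax.hop`). Iterated along the tandem, it shows that `C` intertwines `J` and `H` for every
finite list of jumps (`C_foldl_J`), in particular for a single one.

For infinitely many jumps, the height at `y` is the maximum of `h z + |c|` over `z ≥ y` and chains
`c` of driving points in `(y, z]`, going up in time and to the left in space. So influence comes
from the right only, and it is cut off because chains in `(0, z]` have length of order `√z` while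
the lines of `C α` have more than any multiple of `√z` points there. The upper lines of `α` are
driven by the points that the next line's particles leave; chains of such points are dominated by
chains of the original ones (`StableTandem.exists_chain`), so all the limits exist.

A queue looks at its whole past, so departures do not pass to local limits in general. They do if
the limit leaves services unused arbitrarily far to the left, since at such a record everything
earlier becomes irrelevant (`departures_limSet`). This is reduced to two lines at the bottom of the
tandem, both driven by the original points: the infinite excess on the left of one over the other is
not lost in finite time (`GoodPoints.keepsExcess`), because for chains starting far to the left
nothing is gained by moving the right end further right.

Two almost sure facts are used (`GoodPoints`). Chains in `(0, j ^ 2]` have length `O(j)`, by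
counting lattice paths, Poisson exponential moments and Borel–Cantelli. And if extending the right
end by one always gained with positive probability, stationarity would make the mean longest chain
grow linearly, against the first bound; the quadrangle inequality makes the absence of gain persist
for all starting points further left. -/

noncomputable section

namespace HAD

/-! ### Height functions of locally finite sets -/

/-- `S` is locally finite and `h` decreases by one at every point of `S`. -/
structure IsHeight (S : Set ℝ) (h : ℝ → ℤ) : Prop where
  finite : ∀ a b : ℝ, (S ∩ Icc a b).Finite
  sub_eq : ∀ s r : ℝ, s ≤ r → h s - h r = ((S ∩ Ioc s r).ncard : ℤ)

/-- `S` has points arbitrarily far to the left. -/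
def LeftUnbounded (S : Set ℝ) : Prop := ∀ x : ℝ, ∃ y ∈ S, y < x

/-- The height function of `S` vanishing at the origin. -/
def height (S : Set ℝ) (r : ℝ) : ℤ := ((S ∩ Ioc r 0).ncard : ℤ) - (S ∩ Ioc 0 r).ncard

theorem finite_inter_Ioc {S : Set ℝ} (hS : ∀ a b : ℝ, (S ∩ Icc a b).Finite) (a b : ℝ) :
    (S ∩ Ioc a b).Finite :=
  (hS a b).subset (inter_subset_inter_right _ Ioc_subset_Icc_self)

theorem ncard_inter_Ioc_add {S : Set ℝ} (hS : ∀ a b : ℝ, (S ∩ Icc a b).Finite) {a b c : ℝ}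
    (hab : a ≤ b) (hbc : b ≤ c) :
    (S ∩ Ioc a c).ncard = (S ∩ Ioc a b).ncard + (S ∩ Ioc b c).ncard := by
  rw [← Ioc_union_Ioc_eq_Ioc hab hbc, inter_union_distrib_left]
  refine ncard_union_eq ?_ (finite_inter_Ioc hS _ _) (finite_inter_Ioc hS _ _)
  rw [Set.disjoint_left]
  rintro x ⟨_, h1⟩ ⟨_, h2⟩
  exact absurd h1.2 (not_le.2 h2.1)

theorem isHeight_height {S : Set ℝ} (hS : ∀ a b : ℝ, (S ∩ Icc a b).Finite) :
    IsHeight S (height S) := by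
  refine ⟨hS, fun s r hsr => ?_⟩
  unfold height
  have e : ∀ a b : ℝ, b ≤ a → S ∩ Ioc a b = ∅ := fun a b h => by
    rw [Ioc_eq_empty (not_lt.2 h), inter_empty]
  rcases le_total r 0 with hr | hr
  · rw [e 0 s (hsr.trans hr), e 0 r hr, ncard_inter_Ioc_add hS hsr hr]
    simp
  rcases le_total s 0 with hs | hs
  · rw [e 0 s hs, e r 0 hr, ncard_inter_Ioc_add hS hs hr]
    simp
  · rw [e s 0 hs, e r 0 hr, ncard_inter_Ioc_add hS hs hsr]
    push_cast
    simp

theorem walk_eq (A S : Set ℝ) (r : ℝ) : walk A S r = height S r - height A r := by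
  unfold walk height
  ring

namespace IsHeight

variable {S S' A : Set ℝ} {h h' g : ℝ → ℤ}

theorem antitone (hS : IsHeight S h) : Antitone h := fun s r hsr => by
  have := hS.sub_eq s r hsr
  omega

theorem lt_iff (hS : IsHeight S h) {s r : ℝ} (hsr : s ≤ r) :
    h r < h s ↔ (S ∩ Ioc s r).Nonempty := by
  have h1 := hS.sub_eq s r hsr
  rw [← ncard_pos (finite_inter_Ioc hS.finite _ _)]
  omega

theorem exists_gap (hS : ∀ a b : ℝ, (S ∩ Icc a b).Finite) {a y : ℝ} (hay : a < y) :
    ∃ w, a ≤ w ∧ w < y ∧ S ∩ Ioo w y = ∅ := by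
  have hfin : (S ∩ Ico a y).Finite :=
    (hS a y).subset (inter_subset_inter_right _ Ico_subset_Icc_self)
  rcases (S ∩ Ico a y).eq_empty_or_nonempty with he | hne
  · refine ⟨a, le_rfl, hay, ?_⟩
    rw [eq_empty_iff_forall_notMem] at he ⊢
    exact fun x hx => he x ⟨hx.1, hx.2.1.le, hx.2.2⟩
  · obtain ⟨w, hw, hmax⟩ := hfin.exists_maximal hne
    refine ⟨w, hw.2.1, hw.2.2, ?_⟩
    rw [eq_empty_iff_forall_notMem]
    intro x hx
    have := hmax ⟨hx.1, hw.2.1.trans hx.2.1.le, hx.2.2⟩ hx.2.1.le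
    exact absurd hx.2.1 (not_lt.2 this)

/-- Only heights on `[a, y]` enter, so local convergence of heights will give local convergence of
the sets. -/
theorem mem_iff_of_lt (hS : IsHeight S h) {a y : ℝ} (hay : a < y) :
    y ∈ S ↔ ∀ w, a ≤ w → w < y → h y < h w := by
  constructor
  · exact fun hy w _ hw => (hS.lt_iff hw.le).2 ⟨y, hy, hw, le_rfl⟩
  · intro H
    obtain ⟨w, haw, hwy, he⟩ := exists_gap hS.finite hay
    obtain ⟨x, hx, hx1, hx2⟩ := (hS.lt_iff hwy.le).1 (H w haw hwy)
    rcases hx2.eq_or_lt with rfl | hlt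
    · exact hx
    · exact absurd (show x ∈ S ∩ Ioo w y from ⟨hx, hx1, hlt⟩) (by simp [he])

theorem mem_iff (hS : IsHeight S h) {y : ℝ} : y ∈ S ↔ ∀ w, w < y → h y < h w := by
  constructor
  · exact fun hy w hw => (hS.lt_iff hw.le).2 ⟨y, hy, hw, le_rfl⟩
  · exact fun H => (hS.mem_iff_of_lt (sub_one_lt y)).2 fun w _ hw => H w hw

theorem ext (hS : IsHeight S h) (hS' : IsHeight S' h) : S = S' := by
  ext y
  rw [hS.mem_iff, hS'.mem_iff]

theorem sub_eq_height (hS : IsHeight S h) (r s : ℝ) :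
    h r - h s = height S r - height S s := by
  have hh := isHeight_height hS.finite
  rcases le_total r s with hrs | hrs
  · have := hS.sub_eq r s hrs
    have := hh.sub_eq r s hrs
    omega
  · have := hS.sub_eq s r hrs
    have := hh.sub_eq s r hrs
    omega

theorem sub_le_sub_of_subset (hS : IsHeight S h) (hA : IsHeight A g) (hAS : A ⊆ S) {s r : ℝ}
    (hsr : s ≤ r) : g s - g r ≤ h s - h r := by
  rw [hS.sub_eq s r hsr, hA.sub_eq s r hsr]
  exact_mod_cast ncard_le_ncard (inter_subset_inter_left _ hAS) (finite_inter_Ioc hS.finite _ _)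

theorem subset_of_sub_le_sub (hS : IsHeight S h) (hA : IsHeight A g)
    (H : ∀ s r, s ≤ r → g s - g r ≤ h s - h r) : A ⊆ S := by
  intro y hy
  rw [hS.mem_iff]
  intro w hw
  have := hA.mem_iff.1 hy w hw
  have := H w y hw.le
  omega

theorem leftUnbounded_iff (hS : IsHeight S h) : LeftUnbounded S ↔ ∀ K, ∃ y, ∀ r ≤ y, K ≤ h r := by
  constructor
  · intro H K
    have key : ∀ m : ℕ, ∃ y, h 0 + m ≤ h y := by
      intro m
      induction m with
      | zero => exact ⟨0, by simp⟩
      | succ m ih =>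
        obtain ⟨y, hy⟩ := ih
        obtain ⟨z, hz, hzy⟩ := H y
        have h1 := hS.antitone hzy.le
        have h2 := hS.mem_iff.1 hz (z - 1) (by linarith)
        exact ⟨z - 1, by push_cast; omega⟩
    obtain ⟨y, hy⟩ := key (K - h 0).toNat
    exact ⟨y, fun r hr => by have := hS.antitone hr; omega⟩
  · intro H x
    obtain ⟨y, hy⟩ := H (h (x - 1) + 1)
    have hlt : min y (x - 1) ≤ x - 1 := min_le_right _ _
    have := hy (min y (x - 1)) (min_le_left _ _)
    obtain ⟨z, hz, hz1⟩ := (hS.lt_iff hlt).1 (by omega)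
    exact ⟨z, hz, by linarith [hz1.2]⟩

end IsHeight

/-! ### The closest particle to the left, and the one-line jump -/

theorem isGreatest_leftNearest {S : Set ℝ} (hS : ∀ a b : ℝ, (S ∩ Icc a b).Finite)
    (hl : LeftUnbounded S) (x : ℝ) : IsGreatest (S ∩ Iic x) (leftNearest S x) := by
  obtain ⟨y, hy, hyx⟩ := hl x
  obtain ⟨m, hm, hmax⟩ := (hS y x).exists_maximal ⟨y, hy, le_rfl, hyx.le⟩
  have hg : IsGreatest (S ∩ Iic x) m := by
    refine ⟨⟨hm.1, hm.2.2⟩, fun z hz => ?_⟩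
    rcases le_total z m with hzm | hzm
    · exact hzm
    · exact hmax ⟨hz.1, hm.2.1.trans hzm, hz.2⟩ hzm
  rw [leftNearest, hg.csSup_eq]
  exact hg

/-- In one line, the closest particle to the left of `x` jumps to `x`. -/
def shift (S : Set ℝ) (x : ℝ) : Set ℝ := (S \ {leftNearest S x}) ∪ {x}

/-- The effect of the jump to `x` on height functions. -/
def hop (h : ℝ → ℤ) (x : ℝ) (y : ℝ) : ℤ := if y < x then max (h y) (h x + 1) else h y

theorem le_hop (h : ℝ → ℤ) (x y : ℝ) : h y ≤ hop h x y := by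
  unfold hop
  split_ifs
  · exact le_max_left _ _
  · exact le_rfl

theorem antitone_hop {h : ℝ → ℤ} (hh : Antitone h) (x : ℝ) : Antitone (hop h x) := by
  intro s r hsr
  have h1 := hh hsr
  unfold hop
  split_ifs with h2 h3 h3
  · exact max_le_max h1 le_rfl
  · exact absurd (hsr.trans_lt h2) h3
  · exact le_max_of_le_left h1
  · exact h1

namespace IsHeight

variable {S : Set ℝ} {h : ℝ → ℤ}

theorem leftNearest_le (hS : IsHeight S h) (hl : LeftUnbounded S) (x : ℝ) : leftNearest S x ≤ x :=
  (isGreatest_leftNearest hS.finite hl x).1.2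

theorem lt_leftNearest_iff (hS : IsHeight S h) (hl : LeftUnbounded S) {w x : ℝ} (hwx : w ≤ x) :
    w < leftNearest S x ↔ h x + 1 ≤ h w := by
  have hg := isGreatest_leftNearest hS.finite hl x
  rw [Int.add_one_le_iff, hS.lt_iff hwx]
  constructor
  · exact fun H => ⟨_, hg.1.1, H, hg.1.2⟩
  · rintro ⟨z, hz, hz1, hz2⟩
    exact hz1.trans_le (hg.2 ⟨hz, hz2⟩)

theorem apply_leftNearest (hS : IsHeight S h) (hl : LeftUnbounded S) (x : ℝ) :
    h (leftNearest S x) = h x := by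
  have hle := hS.leftNearest_le hl x
  have h1 := (hS.lt_leftNearest_iff hl hle).not.1 (lt_irrefl _)
  have h2 := hS.antitone hle
  omega

/-- Between the jumping particle and `x` the height is `h x`, while left of that particle it is
already at least `h x + 1`. -/
theorem hop_eq (hS : IsHeight S h) (hl : LeftUnbounded S) (x y : ℝ) :
    hop h x y = h y + if leftNearest S x ≤ y ∧ y < x then 1 else 0 := by
  unfold hop
  by_cases hyx : y < x
  · have h1 := hS.lt_leftNearest_iff hl hyx.le
    have h2 := hS.antitone hyx.le
    by_cases hy : leftNearest S x ≤ y
    · have := h1.not.1 (not_lt.2 hy)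
      simp only [hyx, hy, and_self, if_true]
      omega
    · have := h1.1 (not_le.1 hy)
      simp only [hyx, hy, and_true, if_true, if_false]
      omega
  · simp [hyx]

theorem ncard_singleton_inter_Ioc (p s r : ℝ) :
    (({p} ∩ Ioc s r : Set ℝ)).ncard = if s < p ∧ p ≤ r then 1 else 0 := by
  split_ifs with hp
  · rw [inter_eq_left.2 (singleton_subset_iff.2 (show p ∈ Ioc s r from hp)), ncard_singleton]
  · rw [singleton_inter_eq_empty.2 (show p ∉ Ioc s r from hp), ncard_empty]

protected theorem shift (hS : IsHeight S h) (hl : LeftUnbounded S) (x : ℝ) :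
    IsHeight (shift S x) (hop h x) := by
  have hg := isGreatest_leftNearest hS.finite hl x
  set σ := leftNearest S x with hσ
  have hfin : ∀ a b : ℝ, (shift S x ∩ Icc a b).Finite := fun a b => by
    refine ((hS.finite a b).union (finite_singleton x)).subset ?_
    rintro y ⟨hy | hy, hy2⟩
    · exact Or.inl ⟨hy.1, hy2⟩
    · exact Or.inr hy
  refine ⟨hfin, fun s r hsr => ?_⟩
  rw [hS.hop_eq hl, hS.hop_eq hl, ← hσ]
  have h0 := hS.sub_eq s r hsr
  have hσx : σ ≤ x := hg.1.2
  -- A particle sitting at `x` is its own closest particle: then nothing moves.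
  rcases hσx.eq_or_lt with he | hlt
  · have : shift S x = S := by
      unfold shift
      rw [← hσ, he, sdiff_union_self, union_eq_left, singleton_subset_iff, ← he]
      exact hg.1.1
    rw [this, he, ← h0]
    have : ∀ y : ℝ, ¬(x ≤ y ∧ y < x) := fun y hy => absurd hy.2 (not_lt.2 hy.1)
    simp [this]
  · have hx : x ∉ S := fun hx => absurd (hg.2 ⟨hx, self_mem_Iic⟩) (not_le.2 hlt)
    have f1 : ((S \ {σ}) ∩ Ioc s r).Finite :=
      (finite_inter_Ioc hS.finite s r).subset (inter_subset_inter_left _ sdiff_subset)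
    have e1 : (S ∩ Ioc s r).ncard = ((S \ {σ}) ∩ Ioc s r).ncard + ({σ} ∩ Ioc s r : Set ℝ).ncard := by
      rw [← ncard_union_eq _ f1 ((finite_singleton σ).inter_of_left _), ← union_inter_distrib_right,
        sdiff_union_of_subset (singleton_subset_iff.2 hg.1.1)]
      exact (disjoint_sdiff_left.mono inter_subset_left inter_subset_left)
    have e2 : (shift S x ∩ Ioc s r).ncard
        = ((S \ {σ}) ∩ Ioc s r).ncard + ({x} ∩ Ioc s r : Set ℝ).ncard := by
      rw [← ncard_union_eq _ f1 ((finite_singleton x).inter_of_left _), ← union_inter_distrib_right]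
      · rfl
      · rw [Set.disjoint_left]
        rintro y ⟨hy, _⟩ ⟨hy2, _⟩
        rw [mem_singleton_iff] at hy2
        exact hx (hy2 ▸ hy.1)
    rw [ncard_singleton_inter_Ioc] at e1 e2
    by_cases c1 : σ ≤ s <;> by_cases c2 : s < x <;> by_cases c3 : σ ≤ r <;> by_cases c4 : r < x <;>
      simp only [c1, c2, c3, c4, and_true, if_true, if_false, and_false, not_lt.1, not_le.1,
        not_lt.2, not_le.2, not_false_eq_true] at e1 e2 ⊢ <;>
      first
        | (push_cast [e1, e2] at h0 ⊢; omega)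
        | (exfalso; linarith)

theorem leftUnbounded_shift (hS : IsHeight S h) (hl : LeftUnbounded S) (x : ℝ) :
    LeftUnbounded (shift S x) := by
  rw [(hS.shift hl x).leftUnbounded_iff]
  intro K
  obtain ⟨y, hy⟩ := hS.leftUnbounded_iff.1 hl K
  exact ⟨y, fun r hr => (hy r hr).trans (le_hop h x r)⟩

end IsHeight

/-! ### Queues in terms of heights -/

/-- `M` is the running maximum of `f` over the past. -/
def RunMax (f M : ℝ → ℤ) : Prop :=
  ∀ r, (∀ r' ≤ r, f r' ≤ M r) ∧ ∃ r' ≤ r, f r' = M r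

theorem RunMax.monotone {f M : ℝ → ℤ} (hM : RunMax f M) : Monotone M := fun s r hsr => by
  obtain ⟨r', hr', he⟩ := (hM s).2
  exact he ▸ (hM r).1 r' (hr'.trans hsr)

/-- The walk with arrivals `A` and services `S` tends to `+∞` at `-∞`. -/
def Stable (A S : Set ℝ) : Prop := Tendsto (walk A S) atBot atTop

section Queue

variable {A S : Set ℝ} {a s M : ℝ → ℤ}

theorem walk_sub_walk (hA : IsHeight A a) (hS : IsHeight S s) (r r' : ℝ) :
    walk A S r - walk A S r' = (a r' - s r') - (a r - s r) := by
  rw [walk_eq, walk_eq]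
  have := hA.sub_eq_height r r'
  have := hS.sub_eq_height r r'
  omega

theorem mem_unused_iff (hA : IsHeight A a) (hS : IsHeight S s) {r : ℝ} :
    r ∈ unused A S ↔ r ∈ S ∧ ∀ r' < r, a r' - s r' < a r - s r := by
  refine and_congr_right fun _ => forall_congr' fun r' => forall_congr' fun _ => ?_
  have := walk_sub_walk hA hS r r'
  omega

theorem Stable.eventually_le (hst : Stable A S) (hA : IsHeight A a) (hS : IsHeight S s) (K : ℤ) :
    ∃ y, ∀ r ≤ y, a r - s r ≤ K := by
  obtain ⟨y, hy⟩ := eventually_atBot.1 (tendsto_atTop.1 hst (a 0 - s 0 - K))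
  refine ⟨y, fun r hr => ?_⟩
  have h1 := hy r hr
  have h2 := walk_sub_walk hA hS r 0
  have h3 : walk A S 0 = 0 := by simp [walk]
  omega

theorem stable_of_eventually_le (hA : IsHeight A a) (hS : IsHeight S s)
    (H : ∀ K, ∃ y, ∀ r ≤ y, a r - s r ≤ K) : Stable A S := by
  refine tendsto_atTop.2 fun K => ?_
  obtain ⟨y, hy⟩ := H (a 0 - s 0 - K)
  filter_upwards [eventually_le_atBot y] with r hr
  have h1 := hy r hr
  have h2 := walk_sub_walk hA hS r 0
  have h3 : walk A S 0 = 0 := by simp [walk]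
  omega

theorem Stable.exists_runMax (hst : Stable A S) (hA : IsHeight A a) (hS : IsHeight S s) :
    ∃ M, RunMax (fun r => a r - s r) M := by
  have key : ∀ r : ℝ, ∃ m : ℤ, (∀ r' ≤ r, a r' - s r' ≤ m) ∧ ∃ r' ≤ r, a r' - s r' = m := by
    intro r
    obtain ⟨y, hy⟩ := hst.eventually_le hA hS (a r - s r)
    have hb : ∀ m, (∃ r' ≤ r, a r' - s r' = m) → m ≤ max (a r - s r) (a y - s r) := by
      rintro m ⟨r', hr', rfl⟩
      rcases le_total r' y with h1 | h1
      · exact le_max_of_le_left (hy r' h1)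
      · have := hA.antitone h1
        have := hS.antitone hr'
        exact le_max_of_le_right (by omega)
    obtain ⟨m, hm, hmax⟩ := Int.exists_greatest_of_bdd ⟨_, hb⟩ ⟨_, r, le_rfl, rfl⟩
    exact ⟨m, fun r' hr' => hmax _ ⟨r', hr', rfl⟩, hm⟩
  choose M hM using key
  exact ⟨M, hM⟩

/-- The function `a - s` rises only at services, and by at most one. Each level in `(M p, M q]` is
therefore reached for the first time at a service, which is a record, so `a - s` maps the unused
services in `(p, q]` bijectively onto these levels. -/
theorem ncard_unused (hA : IsHeight A a) (hS : IsHeight S s)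
    (hM : RunMax (fun r => a r - s r) M) {p q : ℝ} (hpq : p ≤ q) :
    ((unused A S ∩ Ioc p q).ncard : ℤ) = M q - M p := by
  set f : ℝ → ℤ := fun r => a r - s r with hf
  have hMf : ∀ u ∈ unused A S, M u = f u := by
    intro u hu
    rw [mem_unused_iff hA hS] at hu
    obtain ⟨r', hr', he⟩ := (hM u).2
    rcases hr'.eq_or_lt with rfl | hlt
    · exact he.symm
    · have h1 := hu.2 r' hlt
      have h2 := (hM u).1 u le_rfl
      simp only [hf] at he h2 ⊢
      omega
  have hf_le : ∀ r' t, r' ≤ t → S ∩ Ioc r' t = ∅ → f t ≤ f r' := by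
    intro r' t h1 h2
    have h3 := hS.sub_eq r' t h1
    have h4 := hA.antitone h1
    rw [h2, ncard_empty] at h3
    simp only [hf]
    omega
  have himg : f '' (unused A S ∩ Ioc p q) = Ioc (M p) (M q) := by
    ext v
    constructor
    · rintro ⟨u, ⟨hu, hu1, hu2⟩, rfl⟩
      refine ⟨?_, (hM q).1 u hu2⟩
      obtain ⟨r', hr', he⟩ := (hM p).2
      rw [← he]
      exact ((mem_unused_iff hA hS).1 hu).2 r' (hr'.trans_lt hu1)
    · rintro ⟨hv1, hv2⟩
      have hpast : ∀ r' ≤ p, f r' < v := fun r' hr' => ((hM p).1 r' hr').trans_lt hv1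
      -- below any time at level at least `v` there is a service time at level at least `v`
      have hdown : ∀ t, t ≤ q → v ≤ f t → ∃ u ∈ S ∩ Ioc p t, v ≤ f u := by
        intro t ht hvt
        have hpt : p < t := lt_of_not_ge fun hle => absurd (hpast t hle) (not_lt.2 hvt)
        have hne : (S ∩ Ioc p t).Nonempty := by
          rw [nonempty_iff_ne_empty]
          exact fun he => absurd (hpast p le_rfl) (not_lt.2 (hvt.trans (hf_le p t hpt.le he)))
        obtain ⟨u, hu, hmax⟩ := (finite_inter_Ioc hS.finite p t).exists_maximal hne
        refine ⟨u, hu, hvt.trans (hf_le u t hu.2.2 ?_)⟩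
        rw [eq_empty_iff_forall_notMem]
        rintro x ⟨hx, hx1, hx2⟩
        exact absurd hx1 (not_lt.2 (hmax ⟨hx, hu.2.1.trans hx1, hx2⟩ hx1.le))
      have hfin : (S ∩ Ioc p q ∩ {u | v ≤ f u}).Finite :=
        (finite_inter_Ioc hS.finite p q).subset inter_subset_left
      have hne : (S ∩ Ioc p q ∩ {u | v ≤ f u}).Nonempty := by
        obtain ⟨r', hr', he⟩ := (hM q).2
        obtain ⟨u, hu, hvu⟩ := hdown r' hr' (by rw [← he] at hv2; exact hv2)
        exact ⟨u, ⟨hu.1, hu.2.1, hu.2.2.trans hr'⟩, hvu⟩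
      obtain ⟨u, ⟨⟨huS, hup, huq⟩, huv⟩, hmin⟩ := hfin.exists_minimal hne
      have hlt : ∀ r' < u, f r' < v := by
        intro r' hr'
        by_contra hcon
        rw [not_lt] at hcon
        obtain ⟨u', hu', hvu'⟩ := hdown r' (hr'.le.trans huq) hcon
        have := hmin ⟨⟨hu'.1, hu'.2.1, hu'.2.2.trans (hr'.le.trans huq)⟩, hvu'⟩
          (hu'.2.2.trans hr'.le)
        linarith [hu'.2.2]
      have hle : f u ≤ v := by
        obtain ⟨w, _, hwu, he⟩ := IsHeight.exists_gap hS.finite (sub_one_lt u)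
        have h1 := hlt w hwu
        have h2 := hS.sub_eq w u hwu.le
        have h3 := hA.antitone hwu.le
        have h4 : (S ∩ Ioc w u).ncard ≤ 1 := by
          rw [ncard_le_one (finite_inter_Ioc hS.finite w u)]
          have : ∀ x ∈ S ∩ Ioc w u, x = u := by
            rintro x ⟨hx, hx1, hx2⟩
            by_contra hne
            exact absurd (show x ∈ S ∩ Ioo w u from ⟨hx, hx1, lt_of_le_of_ne hx2 hne⟩)
              (by simp [he])
          exact fun x hx y hy => (this x hx).trans (this y hy).symm
        simp only [hf] at h1 ⊢
        omega
      have hfu : f u = v := le_antisymm hle huv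
      exact ⟨u, ⟨(mem_unused_iff hA hS).2 ⟨huS, fun r' hr' => (hlt r' hr').trans_eq hfu.symm⟩, hup, huq⟩, hfu⟩
  have hinj : InjOn f (unused A S ∩ Ioc p q) := by
    intro u hu v hv huv
    rcases lt_trichotomy u v with h1 | h1 | h1
    · exact absurd huv (((mem_unused_iff hA hS).1 hv.1).2 u h1).ne
    · exact h1
    · exact absurd huv (((mem_unused_iff hA hS).1 hu.1).2 v h1).ne'
  rw [← hinj.ncard_image, himg, ncard_eq_toFinset_card', toFinset_Ioc, Int.card_Ioc]
  have := hM.monotone hpq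
  omega

/-- Discarding the unused services removes `M q - M p` of the services in `(p, q]`; the height of
the departures at `r` is thus the maximum of `a r' + s r - s r'` over `r' ≤ r`. -/
theorem isHeight_departures (hA : IsHeight A a) (hS : IsHeight S s)
    (hM : RunMax (fun r => a r - s r) M) : IsHeight (departures A S) (fun r => s r + M r) := by
  refine ⟨fun p q => (hS.finite p q).subset (inter_subset_inter_left _ sdiff_subset),
    fun p q hpq => ?_⟩
  have h1 := ncard_unused hA hS hM hpq
  have h2 := hS.sub_eq p q hpq
  have h3 : (S ∩ Ioc p q).ncard
      = (departures A S ∩ Ioc p q).ncard + (unused A S ∩ Ioc p q).ncard := by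
    have hsub : unused A S ⊆ S := sep_subset _ _
    have hd : Disjoint (departures A S ∩ Ioc p q) (unused A S ∩ Ioc p q) :=
      disjoint_sdiff_left.mono inter_subset_left inter_subset_left
    rw [← ncard_union_eq hd
      ((finite_inter_Ioc hS.finite p q).subset (inter_subset_inter_left _ sdiff_subset))
      ((finite_inter_Ioc hS.finite p q).subset (inter_subset_inter_left _ hsub)),
      ← union_inter_distrib_right, departures, sdiff_union_of_subset hsub]
  push_cast [h3] at h2
  omega

/-- A jump of the services at `x`, and of the arrivals at the service time moved by it, makes the
departures jump at `x`. -/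
theorem RunMax.hop (hS : IsHeight S s) (hl : LeftUnbounded S) (ha : Antitone a)
    (hM : RunMax (fun r => a r - s r) M) (x : ℝ) :
    RunMax (fun r => hop a (leftNearest S x) r - hop s x r)
      (fun r => hop (fun r => s r + M r) x r - hop s x r) := by
  set σ := leftNearest S x with hσ
  have hσx : σ ≤ x := hS.leftNearest_le hl x
  have hsσ : s σ = s x := hS.apply_leftNearest hl x
  have hs_lt : ∀ r, r < σ → s x + 1 ≤ s r := fun r hr =>
    (hS.lt_leftNearest_iff hl (hr.le.trans hσx)).1 hr
  have hs_eq : ∀ r, σ ≤ r → r ≤ x → s r = s x := fun r h1 h2 =>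
    le_antisymm (hsσ ▸ hS.antitone h1) (hS.antitone h2)
  have hs' : ∀ r, HAD.hop s x r = s r + if σ ≤ r ∧ r < x then 1 else 0 := hS.hop_eq hl x
  have hM_mono := hM.monotone
  have hMge : ∀ r' r, r' ≤ r → a r' - s r' ≤ M r := fun r' r h => (hM r).1 r' h
  -- a time just before `σ`
  obtain ⟨w, _, hwσ, hw⟩ := IsHeight.exists_gap hS.finite (sub_one_lt σ)
  have hsw : s w = s x + 1 := by
    have h1 := hs_lt w hwσ
    have h2 := hS.sub_eq w σ hwσ.le
    have h4 : (S ∩ Ioc w σ).ncard ≤ 1 := by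
      rw [ncard_le_one (finite_inter_Ioc hS.finite w σ)]
      have : ∀ x ∈ S ∩ Ioc w σ, x = σ := by
        rintro x ⟨hx, hx1, hx2⟩
        by_contra hne
        exact absurd (show x ∈ S ∩ Ioo w σ from ⟨hx, hx1, lt_of_le_of_ne hx2 hne⟩) (by simp [hw])
      exact fun x hx y hy => (this x hx).trans (this y hy).symm
    omega
  have haw : HAD.hop a σ w = max (a w) (a σ + 1) := by simp [HAD.hop, hwσ]
  have hs'w : HAD.hop s x w = s x + 1 := by
    rw [hs', if_neg (fun h => absurd h.1 (not_le.2 hwσ)), hsw, add_zero]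
  intro r
  have hold : ∀ r' < σ, r' ≤ r → HAD.hop a σ r' - HAD.hop s x r' ≤ max (M r) (a σ + 1 - s r) := by
    intro r' h1 h2
    rw [hs', if_neg (fun h => absurd h.1 (not_le.2 h1))]
    have h3 := hMge r' r h2
    have h4 := hS.antitone h2
    simp only [HAD.hop, h1, if_true]
    rcases max_cases (a r') (a σ + 1) with ⟨he, _⟩ | ⟨he, _⟩ <;> rw [he]
    · exact le_max_of_le_left (by omega)
    · exact le_max_of_le_right (by omega)
  rcases lt_or_ge r σ with hr | hr
  · -- before `σ`
    have hrx : r < x := hr.trans_le hσx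
    have hsr := hs_lt r hr
    have hMσ : a σ - s x ≤ M x := hMge σ x hσx |>.trans' (by omega)
    have hval : HAD.hop (fun r => s r + M r) x r - HAD.hop s x r = max (M r) (a σ + 1 - s r) := by
      rw [hs', if_neg (fun h => absurd h.1 (not_le.2 hr))]
      simp only [HAD.hop, hrx, if_true]
      -- On `[σ, x]` the services are constant in height and the arrivals nonincreasing. So the
      -- maximum up to `x` is either reached at `σ`, or reached before `σ`, and then the term `h x +
      -- 1` of the hop does not exceed the old height at `r`.
      have h1 : M x = a σ - s x ∨ s x + M x + 1 ≤ s r + M r := by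
        obtain ⟨r', hr', he⟩ := (hM x).2
        dsimp only at he
        rcases lt_or_ge r' σ with h2 | h2
        · right
          rcases le_or_gt r' r with h3 | h3
          · have := hMge r' r h3
            omega
          · have := hs_lt r' h2
            have := ha h3.le
            have := hMge r r le_rfl
            omega
        · left
          have := ha h2
          have := hs_eq r' h2 hr'
          omega
      omega
    simp only [hval]
    refine ⟨fun r' hr' => hold r' (hr'.trans_lt hr) hr', ?_⟩
    rcases le_total (a σ + 1 - s r) (M r) with hle | hle
    · rw [max_eq_left hle]
      obtain ⟨r', hr', he⟩ := (hM r).2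
      refine ⟨r', hr', le_antisymm ?_ ?_⟩
      · have := hold r' (hr'.trans_lt hr) hr'
        rwa [max_eq_left hle] at this
      · rw [hs', if_neg (fun h => absurd h.1 (not_le.2 (hr'.trans_lt hr)))]
        have := le_hop a σ r'
        dsimp only at he
        omega
    · rw [max_eq_right hle]
      refine ⟨r, le_rfl, le_antisymm ?_ ?_⟩
      · have := hold r hr le_rfl
        rwa [max_eq_right hle] at this
      · rw [hs', if_neg (fun h => absurd h.1 (not_le.2 hr))]
        have : a σ + 1 ≤ HAD.hop a σ r := by
          simp only [HAD.hop, hr, if_true]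
          exact le_max_right _ _
        omega
  · -- after `σ`
    have hval : HAD.hop (fun r => s r + M r) x r - HAD.hop s x r
        = if r < x then M σ else M r := by
      rw [hs']
      split_ifs with h1 h2 h2
      · simp only [HAD.hop, h2, if_true]
        have h3 := hs_eq r hr h2.le
        have hMc : ∀ t, σ ≤ t → t ≤ x → M t = M σ := by
          intro t ht htx
          refine le_antisymm ?_ (hM_mono ht)
          obtain ⟨r', hr', he⟩ := (hM t).2
          dsimp only at he
          rcases le_total r' σ with h5 | h5
          · rw [← he]; exact hMge r' σ h5
          · have := hs_eq r' h5 (hr'.trans htx)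
            have := ha h5
            have := hMge σ σ le_rfl
            omega
        have h4 := hMc r hr h2.le
        have h5 := hMc x hσx le_rfl
        omega
      · exact absurd h1.2 h2
      · exact absurd ⟨hr, h2⟩ h1
      · simp only [HAD.hop, h2, if_false]
        omega
    have hwr : w ≤ r := hwσ.le.trans hr
    have hMσ := hMge σ σ le_rfl
    -- the values before `σ`
    have hpast : ∀ r' < σ, HAD.hop a σ r' - HAD.hop s x r' ≤ M σ := by
      intro r' h1
      rw [hs', if_neg (fun h => absurd h.1 (not_le.2 h1))]
      have h3 := hMge r' σ h1.le
      have h4 := hs_lt r' h1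
      simp only [HAD.hop, h1, if_true]
      rcases max_cases (a r') (a σ + 1) with ⟨he, _⟩ | ⟨he, _⟩ <;> rw [he] <;> omega
    have hatt : ∃ r' < σ, HAD.hop a σ r' - HAD.hop s x r' = M σ := by
      obtain ⟨r', hr', he⟩ := (hM σ).2
      dsimp only at he
      rcases hr'.eq_or_lt with rfl | hlt
      -- A maximum reached at `σ` moves to `w` just before it: there the arrivals are now raised to
      -- at least `a σ + 1`, which compensates the extra unit of service height.
      · refine ⟨w, hwσ, le_antisymm (hpast w hwσ) ?_⟩
        rw [haw, hs'w]
        omega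
      · refine ⟨r', hlt, le_antisymm (hpast r' hlt) ?_⟩
        rw [hs', if_neg (fun h => absurd h.1 (not_le.2 hlt))]
        have := le_hop a σ r'
        omega
    simp only [hval]
    constructor
    · intro r' hr'
      rcases lt_or_ge r' σ with h1 | h1
      · refine (hpast r' h1).trans ?_
        split_ifs
        · exact le_rfl
        · exact hM_mono hr
      · have h2 : HAD.hop a σ r' = a r' := by simp [HAD.hop, not_lt.2 h1]
        rw [h2, hs']
        split_ifs with h3 h4 h4
        · have := hs_eq r' h1 h3.2.le
          have := ha h1
          omega
        · have := hMge r' r hr'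
          omega
        · exact absurd ⟨h1, hr'.trans_lt h4⟩ h3
        · have := hMge r' r hr'
          omega
    · obtain ⟨r₁, hr₁, he₁⟩ := hatt
      split_ifs with h1
      · exact ⟨r₁, hr₁.le.trans hr, he₁⟩
      · obtain ⟨r', hr', he⟩ := (hM r).2
        dsimp only at he
        rcases lt_or_ge r' x with h2 | h2
        · refine ⟨r₁, hr₁.le.trans hr, he₁.trans (le_antisymm (hM_mono hr) ?_)⟩
          rw [← he]
          rcases le_total r' σ with h3 | h3
          · exact hMge r' σ h3
          · have := hs_eq r' h3 h2.le
            have := ha h3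
            omega
        · refine ⟨r', hr', ?_⟩
          rw [hs', if_neg (fun h => absurd h.2 (not_lt.2 h2))]
          simp only [HAD.hop, not_lt.2 (hσx.trans h2), if_false]
          omega

end Queue

/-! ### Finite sequences of jumps -/

/-- The result of successive jumps, on heights. -/
def hops (h : ℝ → ℤ) (l : List ℝ) : ℝ → ℤ := l.foldl hop h

/-- The result of successive jumps, on one line. -/
def shifts (S : Set ℝ) (l : List ℝ) : Set ℝ := l.foldl shift S

/-- The positions from which the particles of a line jump. -/
def out : Set ℝ → List ℝ → List ℝ
  | _, [] => []
  | S, x :: l => leftNearest S x :: out (shift S x) l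

/-- A decreasing list in `(y, z]`. -/
def IsChain (y z : ℝ) (c : List ℝ) : Prop := c.Pairwise (· > ·) ∧ ∀ x ∈ c, y < x ∧ x ≤ z

@[simp] theorem hops_nil (h : ℝ → ℤ) : hops h [] = h := rfl
@[simp] theorem shifts_nil (S : Set ℝ) : shifts S [] = S := rfl
@[simp] theorem out_nil (S : Set ℝ) : out S [] = [] := rfl

theorem hops_concat (h : ℝ → ℤ) (l : List ℝ) (x : ℝ) : hops h (l ++ [x]) = hop (hops h l) x := by
  simp [hops]

theorem shifts_concat (S : Set ℝ) (l : List ℝ) (x : ℝ) :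
    shifts S (l ++ [x]) = shift (shifts S l) x := by
  simp [shifts]

theorem out_concat (S : Set ℝ) (l : List ℝ) (x : ℝ) :
    out S (l ++ [x]) = out S l ++ [leftNearest (shifts S l) x] := by
  induction l generalizing S with
  | nil => simp [out]
  | cons a l ih => simp [out, ih, shifts]

theorem sublist_concat {c l : List ℝ} {x : ℝ} (h : c.Sublist (l ++ [x])) :
    c.Sublist l ∨ ∃ c₀, c = c₀ ++ [x] ∧ c₀.Sublist l := by
  obtain ⟨c₁, c₂, rfl, h1, h2⟩ := List.sublist_append_iff.1 h
  rcases List.sublist_singleton.1 h2 with rfl | rfl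
  · exact Or.inl (by simpa using h1)
  · exact Or.inr ⟨c₁, rfl, h1⟩

theorem IsChain.concat {y x z : ℝ} {c : List ℝ} (hc : IsChain x z c) (hyx : y < x) (hxz : x ≤ z) :
    IsChain y z (c ++ [x]) := by
  refine ⟨List.pairwise_append.2 ⟨hc.1, by simp, fun a ha b hb => ?_⟩, fun a ha => ?_⟩
  · rw [List.mem_singleton] at hb
    exact hb ▸ (hc.2 a ha).1
  · rcases List.mem_append.1 ha with h | h
    · exact ⟨hyx.trans (hc.2 a h).1, (hc.2 a h).2⟩
    · rw [List.mem_singleton] at h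
      exact h ▸ ⟨hyx, hxz⟩

theorem IsChain.of_concat {y x z : ℝ} {c : List ℝ} (hc : IsChain y z (c ++ [x])) :
    IsChain x z c ∧ y < x ∧ x ≤ z := by
  have h1 := List.pairwise_append.1 hc.1
  refine ⟨⟨h1.1, fun a ha => ⟨h1.2.2 a ha x (by simp), (hc.2 a (by simp [ha])).2⟩⟩, ?_⟩
  exact hc.2 x (by simp)

theorem IsChain.mono {y y' z z' : ℝ} {c : List ℝ} (hc : IsChain y z c) (hy : y' ≤ y)
    (hz : z ≤ z') : IsChain y' z' c :=
  ⟨hc.1, fun x hx => ⟨hy.trans_lt (hc.2 x hx).1, (hc.2 x hx).2.trans hz⟩⟩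

theorem antitone_hops {h : ℝ → ℤ} (hh : Antitone h) (l : List ℝ) : Antitone (hops h l) := by
  induction l using List.reverseRecOn with
  | nil => exact hh
  | append_singleton l x ih => rw [hops_concat]; exact antitone_hop ih x

theorem le_hops (h : ℝ → ℤ) (l : List ℝ) (y : ℝ) : h y ≤ hops h l y := by
  induction l using List.reverseRecOn with
  | nil => exact le_rfl
  | append_singleton l x ih => rw [hops_concat]; exact ih.trans (le_hop _ x y)

/-- The variational formula for heights: the value is attained along a chain. -/
theorem exists_chain_hops (h : ℝ → ℤ) (l : List ℝ) (y : ℝ) :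
    ∃ z, y ≤ z ∧ ∃ c : List ℝ, c.Sublist l ∧ IsChain y z c ∧ hops h l y = h z + c.length := by
  induction l using List.reverseRecOn generalizing y with
  | nil => exact ⟨y, le_rfl, [], List.Sublist.refl _, ⟨by simp, by simp⟩, by simp⟩
  | append_singleton l x ih =>
    rw [hops_concat]
    -- The last point joins the chain when the term `h x + 1` attains the maximum in the hop. Being
    -- the latest, it must be the leftmost point of the chain.
    by_cases hcase : y < x ∧ hops h l y ≤ hops h l x + 1
    · obtain ⟨z, hz, c, hcl, hc, he⟩ := ih x
      refine ⟨z, hcase.1.le.trans hz, c ++ [x], hcl.append (List.Sublist.refl _),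
        hc.concat hcase.1 hz, ?_⟩
      have h1 := hcase.2
      simp only [hop, hcase.1, if_true, List.length_append, List.length_singleton]
      push_cast
      omega
    · obtain ⟨z, hz, c, hcl, hc, he⟩ := ih y
      refine ⟨z, hz, c, hcl.trans (List.sublist_append_left _ _), hc, ?_⟩
      rw [← he, hop]
      split_ifs with h1
      · rw [not_and, not_le] at hcase
        exact max_eq_left (hcase h1).le
      · rfl

/-- The variational formula for heights: every chain gives a lower bound. -/
theorem add_length_le_hops {h : ℝ → ℤ} (hh : Antitone h) {l c : List ℝ} {y z : ℝ}
    (hcl : c.Sublist l) (hc : IsChain y z c) (hyz : y ≤ z) : h z + c.length ≤ hops h l y := by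
  induction l using List.reverseRecOn generalizing y c with
  | nil =>
    rw [List.sublist_nil.1 hcl]
    simpa using hh hyz
  | append_singleton l x ih =>
    rw [hops_concat]
    rcases sublist_concat hcl with h1 | ⟨c₀, rfl, h1⟩
    · exact (ih h1 hc hyz).trans (le_hop _ x y)
    · obtain ⟨hc₀, hyx, hxz⟩ := hc.of_concat
      have := ih h1 hc₀ hxz
      simp only [hop, hyx, if_true, List.length_append, List.length_singleton]
      refine le_max_of_le_right ?_
      push_cast
      linarith

section Line

variable {S : Set ℝ} {h : ℝ → ℤ}

theorem IsHeight.shifts_aux (hS : IsHeight S h) (hl : LeftUnbounded S) (l : List ℝ) :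
    IsHeight (shifts S l) (hops h l) ∧ LeftUnbounded (shifts S l) := by
  induction l using List.reverseRecOn with
  | nil => exact ⟨hS, hl⟩
  | append_singleton l x ih =>
    rw [hops_concat, shifts_concat]
    exact ⟨ih.1.shift ih.2 x, ih.1.leftUnbounded_shift ih.2 x⟩

protected theorem IsHeight.shifts (hS : IsHeight S h) (hl : LeftUnbounded S) (l : List ℝ) :
    IsHeight (shifts S l) (hops h l) := (hS.shifts_aux hl l).1

theorem IsHeight.leftUnbounded_shifts (hS : IsHeight S h) (hl : LeftUnbounded S) (l : List ℝ) :
    LeftUnbounded (shifts S l) := (hS.shifts_aux hl l).2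

/-- The height `min (h w) (h z)` keeps only the particles beyond `z`; its evolution is shown to gain
one unit for each jump in the chain. The level `k` is the height just reached by the last jump of
the chain. When a further jump, from `q` to `x`, joins the chain, `q` lies left of the earlier
origins, so the height at `x`, equal to that at `q`, is at least `k`. The truncated height at `x`
has then already gained `c₀.length`, and the hop adds one. -/
theorem exists_level_of_chain_out (hS : IsHeight S h) (hl : LeftUnbounded S) (z : ℝ)
    (l c : List ℝ) (hcl : c.Sublist (out S l)) (hc : c.Pairwise (· > ·)) (hcz : ∀ e ∈ c, e ≤ z) :
    ∃ k : ℤ, (∀ w ≤ z, (∀ e ∈ c, w < e) → k ≤ hops h l w) ∧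
      ∀ w, min (hops h l w - k) 0 + (h z + c.length) ≤ hops (fun w => min (h w) (h z)) l w := by
  induction l using List.reverseRecOn generalizing c with
  | nil =>
    rw [out_nil, List.sublist_nil] at hcl
    subst hcl
    refine ⟨h z, fun w hw _ => hS.antitone hw, fun w => ?_⟩
    simp only [hops_nil, List.length_nil]
    omega
  | append_singleton l x ih =>
    rw [out_concat] at hcl
    simp only [hops_concat]
    set g := hops h l with hg
    set gz := hops (fun w => min (h w) (h z)) l with hgz
    rcases sublist_concat hcl with h1 | ⟨c₀, rfl, h1⟩
    · obtain ⟨k, hk1, hk2⟩ := ih c h1 hc hcz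
      refine ⟨k, fun w hw hwe => (hk1 w hw hwe).trans (le_hop _ x w), fun w => ?_⟩
      have h2 := hk2 w
      have h3 := hk2 x
      simp only [hop]
      split_ifs <;> omega
    · set q := leftNearest (shifts S l) x with hq
      have hSl := hS.shifts hl l
      have hll := hS.leftUnbounded_shifts hl l
      have hqx : q ≤ x := hSl.leftNearest_le hll x
      have hgq : g q = g x := hSl.apply_leftNearest hll x
      have hp := List.pairwise_append.1 hc
      obtain ⟨k, hk1, hk2⟩ := ih c₀ h1 hp.1 fun e he => hcz e (by simp [he])
      have hkx : k ≤ g x := hgq ▸ hk1 q (hcz q (by simp)) fun e he => hp.2.2 e he q (by simp)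
      refine ⟨g x + 1, fun w _ hwe => ?_, fun w => ?_⟩
      · have hwx : w < x := (hwe q (by simp)).trans_le hqx
        simp only [hop, hwx, if_true]
        exact le_max_right _ _
      · have h3 := hk2 x
        have h4 := hk2 w
        simp only [List.length_append, List.length_singleton, hop]
        split_ifs with hwx
        · push_cast
          omega
        · have h5 : g w ≤ g x := hSl.antitone (not_lt.1 hwx)
          push_cast
          omega

/-- A chain of points from which particles jump is dominated by a chain of the driving points. -/
theorem exists_chain_of_chain_out (hS : IsHeight S h) (hl : LeftUnbounded S) {l c : List ℝ}
    {y z : ℝ} (hyz : y ≤ z) (hcl : c.Sublist (out S l)) (hc : IsChain y z c) :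
    ∃ z', z ≤ z' ∧ ∃ c' : List ℝ, c'.Sublist l ∧ IsChain y z' c' ∧
      h z + c.length ≤ h z' + c'.length := by
  obtain ⟨k, hk1, hk2⟩ := exists_level_of_chain_out hS hl z l c hcl hc.1 fun e he => (hc.2 e he).2
  obtain ⟨z₁, hz₁, c', hc'l, hc', he⟩ := exists_chain_hops (fun w => min (h w) (h z)) l y
  have h1 := hk1 y hyz fun e he => (hc.2 e he).1
  have h2 := hk2 y
  -- The truncated height at `z₁` is the height at `max z z₁`.
  refine ⟨max z z₁, le_max_left _ _, c', hc'l, hc'.mono le_rfl (le_max_right _ _), ?_⟩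
  rcases le_total z z₁ with h3 | h3
  · rw [max_eq_right h3]
    omega
  · rw [max_eq_left h3]
    omega

end Line

/-! ### Several lines -/

/-- The points driving the line above the lines `Ls`, when the last of these is driven by `l`. -/
def dual : List (Set ℝ) → List ℝ → List ℝ
  | [], l => l
  | S :: Ls, l => out S (dual Ls l)

/-- The evolution of the lines `Ls`, the last of which is driven by `l`. -/
def evolve : List (Set ℝ) → List ℝ → List (Set ℝ)
  | [], _ => []
  | S :: Ls, l => shifts S (dual Ls l) :: evolve Ls l

/-- The queues in tandem with arrivals `A` and services `Ls` are stable, with departures from the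
last queue that are unbounded to the left. -/
def StableTandem : Set ℝ → List (Set ℝ) → Prop
  | A, [] => (∀ a b : ℝ, (A ∩ Icc a b).Finite) ∧ LeftUnbounded A
  | A, S :: Ls => (∀ a b : ℝ, (A ∩ Icc a b).Finite) ∧ (∀ a b : ℝ, (S ∩ Icc a b).Finite) ∧
      LeftUnbounded S ∧ Stable A S ∧ StableTandem (departures A S) Ls

theorem StableTandem.finite {A : Set ℝ} {Ls : List (Set ℝ)} (hT : StableTandem A Ls) :
    ∀ a b : ℝ, (A ∩ Icc a b).Finite := by
  cases Ls <;> exact hT.1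

/-- The departure height at `y` is `a r' - s r' + s y` for some `r' ≤ y`, hence at most `a r'`.
Unboundedness thus goes back from the last departures to the first arrivals. -/
theorem StableTandem.leftUnbounded {A : Set ℝ} {Ls : List (Set ℝ)} (hT : StableTandem A Ls) :
    LeftUnbounded A := by
  induction Ls generalizing A with
  | nil => exact hT.2
  | cons S Ls ih =>
    obtain ⟨hA, hS, hl, hst, hT'⟩ := hT
    have hA' := isHeight_height hA
    have hS' := isHeight_height hS
    obtain ⟨M, hM⟩ := hst.exists_runMax hA' hS'
    have hB := (isHeight_departures hA' hS' hM).leftUnbounded_iff.1 (ih hT')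
    rw [hA'.leftUnbounded_iff]
    intro K
    obtain ⟨y, hy⟩ := hB K
    obtain ⟨r', hr', he⟩ := (hM y).2
    refine ⟨r', fun r hr => ?_⟩
    have h1 := hy y le_rfl
    have h2 := hS'.antitone hr'
    have h3 := hA'.antitone hr
    dsimp only at he h1
    omega

theorem RunMax.hops {S : Set ℝ} {a s M : ℝ → ℤ} (hS : IsHeight S s) (hl : LeftUnbounded S)
    (ha : Antitone a) (hM : RunMax (fun r => a r - s r) M) (l : List ℝ) :
    RunMax (fun r => hops a (out S l) r - hops s l r)
      (fun r => hops (fun r => s r + M r) l r - hops s l r) := by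
  induction l using List.reverseRecOn with
  | nil => simpa using hM
  | append_singleton l x ih =>
    have := ih.hop (hS.shifts hl l) (hS.leftUnbounded_shifts hl l) (antitone_hops ha _) x
    simp only [add_sub_cancel] at this
    rw [out_concat, hops_concat, hops_concat, hops_concat]
    exact this

/-- Both sides have the height given by `RunMax.hops`, and a height determines its set. -/
theorem departures_shifts {A S : Set ℝ} {a s M : ℝ → ℤ} (hA : IsHeight A a) (hAl : LeftUnbounded A)
    (hS : IsHeight S s) (hl : LeftUnbounded S) (hM : RunMax (fun r => a r - s r) M)
    (hBl : LeftUnbounded (departures A S)) (l : List ℝ) :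
    departures (shifts A (out S l)) (shifts S l) = shifts (departures A S) l := by
  have h1 := isHeight_departures (hA.shifts hAl (out S l)) (hS.shifts hl l)
    (hM.hops hS hl hA.antitone l)
  simp only [add_sub_cancel] at h1
  exact h1.ext ((isHeight_departures hA hS hM).shifts hBl l)

/-- The tandem of queues intertwines the multi-line dynamics with the one-line dynamics. -/
theorem StableTandem.foldl_departures {A : Set ℝ} {Ls : List (Set ℝ)} (hT : StableTandem A Ls)
    (l : List ℝ) : (evolve Ls l).foldl departures (shifts A (dual Ls l)) =
      shifts (Ls.foldl departures A) l := by
  induction Ls generalizing A with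
  | nil => rfl
  | cons S Ls ih =>
    have hAl := hT.leftUnbounded
    obtain ⟨hA, hS, hl, hst, hT'⟩ := hT
    obtain ⟨M, hM⟩ := hst.exists_runMax (isHeight_height hA) (isHeight_height hS)
    simp only [evolve, dual, List.foldl_cons]
    rw [departures_shifts (isHeight_height hA) hAl (isHeight_height hS) hl hM hT'.leftUnbounded,
      ih hT']

theorem StableTandem.finite_foldl {A : Set ℝ} {Ls : List (Set ℝ)} (hT : StableTandem A Ls) :
    (∀ a b : ℝ, (Ls.foldl departures A ∩ Icc a b).Finite) ∧
      LeftUnbounded (Ls.foldl departures A) := by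
  induction Ls generalizing A with
  | nil => exact hT
  | cons S Ls ih => exact ih hT.2.2.2.2

/-- A chain of the points driving the line above `Ls` is dominated by a chain of the points driving
the tandem of queues. -/
theorem StableTandem.exists_chain {A : Set ℝ} {Ls : List (Set ℝ)} {a : ℝ → ℤ}
    (hT : StableTandem A Ls) (hA : IsHeight A a) :
    ∃ b, IsHeight (Ls.foldl departures A) b ∧ ∀ (l c : List ℝ) (y z : ℝ), y ≤ z →
      c.Sublist (dual Ls l) → IsChain y z c → ∃ z', z ≤ z' ∧ ∃ c' : List ℝ, c'.Sublist l ∧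
        IsChain y z' c' ∧ a z + c.length ≤ b z' + c'.length := by
  induction Ls generalizing A a with
  | nil => exact ⟨a, hA, fun l c y z _ hcl hc => ⟨z, le_rfl, c, hcl, hc, le_rfl⟩⟩
  | cons S Ls ih =>
    obtain ⟨_, hS, hl, hst, hT'⟩ := hT
    have hS' := isHeight_height hS
    obtain ⟨M, hM⟩ := hst.exists_runMax hA hS'
    obtain ⟨b, hb, H⟩ := ih hT' (isHeight_departures hA hS' hM)
    refine ⟨b, hb, fun l c y z hyz hcl hc => ?_⟩
    obtain ⟨z₁, hz₁, c₁, hc₁l, hc₁, h1⟩ := exists_chain_of_chain_out hS' hl hyz hcl hc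
    obtain ⟨z₂, hz₂, c₂, hc₂l, hc₂, h2⟩ := H l c₁ y z₁ (hyz.trans hz₁) hc₁l hc₁
    refine ⟨z₂, hz₁.trans hz₂, c₂, hc₂l, hc₂, ?_⟩
    -- The running maximum at `z₁` sees the earlier time `z`, so `a z - s z + s z₁` is at most the
    -- departure height at `z₁`. This trades arrivals for departures in the bound.
    have h3 := (hM z₁).1 z hz₁
    dsimp only at h2 h3
    omega

/-! ### Locality -/

open Classical in
/-- If no optimal chain reaches beyond `Z`, the line in `[a, b]` and the jumps out of `(a, b]`
depend only on the driving points in `(a, Z]`. -/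
theorem IsHeight.hops_eq_hops_filter {S : Set ℝ} {h : ℝ → ℤ} (hS : IsHeight S h) {a b Z : ℝ} {m : List ℝ}
    (hZ : ∀ y z : ℝ, a ≤ y → Z < z → ∀ c : List ℝ, c.Sublist m → IsChain y z c →
      h z + c.length ≤ h b) {y : ℝ} (hay : a ≤ y) (hyb : y ≤ b) :
    hops h m y = hops h (m.filter fun x => a < x ∧ x ≤ Z) y := by
  apply le_antisymm
  · obtain ⟨z, hz, c, hcm, hc, he⟩ := exists_chain_hops h m y
    rcases le_or_gt z Z with h1 | h1
    · rw [he]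
      refine add_length_le_hops hS.antitone ?_ hc hz
      have : c = c.filter fun x => a < x ∧ x ≤ Z := by
        symm
        rw [List.filter_eq_self]
        exact fun x hx => decide_eq_true ⟨hay.trans_lt (hc.2 x hx).1, (hc.2 x hx).2.trans h1⟩
      rw [this]
      exact hcm.filter _
    -- An end point beyond `Z` gives at most `h b ≤ h y`, a value already attained without any jump.
    · rw [he]
      exact (hZ y z hay h1 c hcm hc).trans ((hS.antitone hyb).trans (le_hops _ _ _))
  · obtain ⟨z, hz, c, hcm, hc, he⟩ := exists_chain_hops h (m.filter fun x => a < x ∧ x ≤ Z) y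
    rw [he]
    exact add_length_le_hops hS.antitone (hcm.trans List.filter_sublist) hc hz

-- The origin of a jump to `x` is the threshold, among positions left of `x`, before which heights
-- do not change (`key`). Equal heights on `[a, b]` thus give equal origins there. A jump to a point
-- beyond `Z` changes no height on `[a, b]`, and a jump to a point at or left of `a` starts at or
-- left of `a`; neither can start in `(a, b]`.
open Classical in
theorem IsHeight.filter_out_eq {S : Set ℝ} {h : ℝ → ℤ} (hS : IsHeight S h) (hl : LeftUnbounded S)
    {a b Z : ℝ} (hbZ : b ≤ Z) {m : List ℝ}
    (hZ : ∀ y z : ℝ, a ≤ y → Z < z → ∀ c : List ℝ, c.Sublist m → IsChain y z c →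
      h z + c.length ≤ h b) :
    (out S m).filter (fun x => a < x ∧ x ≤ b) =
      (out S (m.filter fun x => a < x ∧ x ≤ Z)).filter (fun x => a < x ∧ x ≤ b) := by
  induction m using List.reverseRecOn with
  | nil => rfl
  | append_singleton m x ih =>
    have hZm : ∀ y z : ℝ, a ≤ y → Z < z → ∀ c : List ℝ, c.Sublist m → IsChain y z c →
        h z + c.length ≤ h b :=
      fun y z h1 h2 c h3 => hZ y z h1 h2 c (h3.trans (List.sublist_append_left _ _))
    have e1 : ∀ y, a ≤ y → y ≤ b → _ := fun y h1 h2 => hS.hops_eq_hops_filter hZm h1 h2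
    have e2 : ∀ y, a ≤ y → y ≤ b → _ := fun y h1 h2 => hS.hops_eq_hops_filter hZ h1 h2
    have hm := hS.shifts hl m
    have hml := hS.leftUnbounded_shifts hl m
    -- which particles are left of the jump, in terms of heights
    have key : ∀ (m : List ℝ) (w : ℝ), w < x →
        (w < leftNearest (shifts S m) x ↔ hops h (m ++ [x]) w = hops h m w) := by
      intro m w hw
      rw [(hS.shifts hl m).lt_leftNearest_iff (hS.leftUnbounded_shifts hl m) hw.le, hops_concat]
      simp only [hop, hw, if_true]
      omega
    rw [out_concat, List.filter_append, List.filter_append, ih hZm]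
    by_cases hx : a < x ∧ x ≤ Z
    · have hf : [x].filter (fun x => decide (a < x ∧ x ≤ Z)) = [x] := by simp [hx]
      rw [List.filter_append, hf] at e2
      rw [hf, out_concat, List.filter_append]
      congr 1
      set m' := m.filter fun x => a < x ∧ x ≤ Z with hm'def
      have hm' := hS.shifts hl m'
      have hml' := hS.leftUnbounded_shifts hl m'
      set q := leftNearest (shifts S m) x with hq
      set q' := leftNearest (shifts S m') x with hq'
      have hqx : q ≤ x := hm.leftNearest_le hml x
      have hqx' : q' ≤ x := hm'.leftNearest_le hml' x
      have hiff : ∀ w, a ≤ w → w ≤ b → w < x → (w < q ↔ w < q') := by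
        intro w h1 h2 h3
        rw [key m w h3, key m' w h3, e1 w h1 h2, e2 w h1 h2]
      have huniq : ∀ p p' : ℝ, p ≤ x → p' ≤ x → (∀ w, a ≤ w → w ≤ b → w < x → (w < p ↔ w < p')) →
          a < p → p ≤ b → p = p' := by
        intro p p' hp hp' H h1 h2
        apply le_antisymm
        · by_contra hcon
          rw [not_le] at hcon
          have h3 : max a p' < p := max_lt h1 hcon
          have := (H (max a p') (le_max_left _ _) (h3.le.trans h2) (h3.trans_le hp)).1 h3
          exact absurd this (not_lt.2 (le_max_right _ _))
        · rcases hp.eq_or_lt with rfl | hlt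
          · exact hp'
          · exact not_lt.1 ((H p h1.le h2 hlt).not.1 (lt_irrefl p))
      by_cases h1 : a < q ∧ q ≤ b
      · rw [huniq q q' hqx hqx' hiff h1.1 h1.2]
      · by_cases h2 : a < q' ∧ q' ≤ b
        · exact absurd (huniq q' q hqx' hqx (fun w x1 x2 x3 => (hiff w x1 x2 x3).symm) h2.1 h2.2)
            (fun he => h1 (he ▸ h2))
        · rw [List.filter_singleton, List.filter_singleton, decide_eq_false h1, decide_eq_false h2]
          rfl
    · have hf : [x].filter (fun x => decide (a < x ∧ x ≤ Z)) = [] := by simp [hx]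
      rw [List.filter_append, hf, List.append_nil] at e2
      rw [hf, List.append_nil]
      set q := leftNearest (shifts S m) x with hq
      have hqx : q ≤ x := hm.leftNearest_le hml x
      have h1 : ¬(a < q ∧ q ≤ b) := by
        rintro ⟨h1, h2⟩
        have h3 : Z < x := lt_of_not_ge fun h => hx ⟨h1.trans_le hqx, h⟩
        have h4 := (key m q (h2.trans_lt (hbZ.trans_lt h3))).not.1 (lt_irrefl q)
        exact h4 ((e2 q h1.le h2).trans (e1 q h1.le h2).symm)
      rw [List.filter_singleton, decide_eq_false h1]
      simp

/-! ### Multi-line configurations as lists of lines -/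

theorem length_evolve (Ls : List (Set ℝ)) (l : List ℝ) : (evolve Ls l).length = Ls.length := by
  induction Ls with
  | nil => rfl
  | cons S Ls ih => simp [evolve, ih]

theorem evolve_drop (Ls : List (Set ℝ)) (l : List ℝ) (k : ℕ) :
    evolve (Ls.drop k) l = (evolve Ls l).drop k := by
  induction Ls generalizing k with
  | nil => simp [evolve]
  | cons S Ls ih =>
    cases k with
    | zero => rfl
    | succ k => simpa [evolve] using ih k

theorem getElem_evolve (Ls : List (Set ℝ)) (l : List ℝ) (k : ℕ) (hk : k < Ls.length) :
    (evolve Ls l)[k]'(by rwa [length_evolve]) = shifts Ls[k] (dual (Ls.drop (k + 1)) l) := by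
  induction Ls generalizing k with
  | nil => simp at hk
  | cons S Ls ih =>
    cases k with
    | zero => rfl
    | succ k => simpa [evolve] using ih k (by simpa using hk)

theorem dual_nil (Ls : List (Set ℝ)) : dual Ls [] = [] := by
  induction Ls with
  | nil => rfl
  | cons S Ls ih => simp [dual, ih]

theorem dual_concat (Ls : List (Set ℝ)) (l : List ℝ) (x : ℝ) :
    dual Ls (l ++ [x]) = dual Ls l ++ [(evolve Ls l).foldr leftNearest x] := by
  induction Ls with
  | nil => rfl
  | cons S Ls ih => simp [dual, evolve, ih, out_concat]

variable {n : ℕ}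

theorem drop_ofFn (α : Fin n → Set ℝ) (k : Fin n) :
    (List.ofFn α).drop k = α k :: (List.ofFn α).drop (k + 1) := by
  rw [List.drop_eq_getElem_cons (by simp)]
  simp

theorem C_eq (α : Fin n → Set ℝ) (k : Fin n) :
    C α k = ((List.ofFn α).drop (k + 1)).foldl departures (α k) := by
  rw [C, drop_ofFn]
  rfl

theorem J_eq (α : Fin n → Set ℝ) (x : ℝ) (k : Fin n) :
    J α x k = shift (α k) (((List.ofFn α).drop (k + 1)).foldr leftNearest x) := by
  have : linePos α x k = leftNearest (α k) (linePos α x (k + 1)) := by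
    rw [linePos, drop_ofFn]
    rfl
  rw [J, this]
  rfl

theorem foldl_H (η : Fin n → Set ℝ) (l : List ℝ) (k : Fin n) :
    l.foldl H η k = shifts (η k) l := by
  induction l using List.reverseRecOn with
  | nil => rfl
  | append_singleton l x ih =>
    rw [shifts_concat, ← ih, List.foldl_append]
    rfl

theorem foldl_J (α : Fin n → Set ℝ) (l : List ℝ) (k : Fin n) :
    l.foldl J α k = shifts (α k) (dual ((List.ofFn α).drop (k + 1)) l) := by
  induction l using List.reverseRecOn generalizing k with
  | nil => rw [dual_nil]; rfl
  | append_singleton l x ih =>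
    have hof : List.ofFn (l.foldl J α) = evolve (List.ofFn α) l := by
      refine List.ext_getElem (by simp [length_evolve]) fun i h1 h2 => ?_
      rw [length_evolve] at h2
      rw [getElem_evolve _ _ _ h2, List.getElem_ofFn, ih]
      simp
    rw [dual_concat, shifts_concat, ← ih, List.foldl_append, List.foldl_cons, List.foldl_nil, J_eq,
      hof, evolve_drop]

theorem ofFn_foldl_J (α : Fin n → Set ℝ) (l : List ℝ) :
    List.ofFn (l.foldl J α) = evolve (List.ofFn α) l := by
  refine List.ext_getElem (by simp [length_evolve]) fun i h1 h2 => ?_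
  rw [length_evolve] at h2
  rw [getElem_evolve _ _ _ h2, List.getElem_ofFn, foldl_J]
  simp

theorem stableTandem_iff {A : Set ℝ} {Ls : List (Set ℝ)} : StableTandem A Ls ↔
    (∀ a b : ℝ, (A ∩ Icc a b).Finite) ∧
    (∀ S ∈ Ls, (∀ a b : ℝ, (S ∩ Icc a b).Finite) ∧ LeftUnbounded S) ∧
    LeftUnbounded (Ls.foldl departures A) ∧
    ∀ (i : ℕ) (hi : i < Ls.length), Stable ((Ls.take i).foldl departures A) Ls[i] := by
  induction Ls generalizing A with
  | nil => simp [StableTandem]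
  | cons S Ls ih =>
    rw [StableTandem, ih]
    constructor
    · rintro ⟨h1, h2, h3, h4, _, h6, h7, h8⟩
      refine ⟨h1, ?_, h7, ?_⟩
      · rintro T hT
        rcases List.mem_cons.1 hT with rfl | hT
        · exact ⟨h2, h3⟩
        · exact h6 T hT
      · rintro (_ | i) hi
        · exact h4
        · exact h8 i (by simpa using hi)
    · rintro ⟨h1, h2, h3, h4⟩
      refine ⟨h1, (h2 S (by simp)).1, (h2 S (by simp)).2, h4 0 (by simp), ?_, ?_, h3, ?_⟩
      · exact fun a b => ((h2 S (by simp)).1 a b).subset (inter_subset_inter_left _ sdiff_subset)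
      · exact fun T hT => h2 T (by simp [hT])
      · exact fun i hi => h4 (i + 1) (by simpa using hi)

theorem tandem_take_drop (α : Fin n → Set ℝ) {k j : Fin n} (hkj : k < j) :
    tandem (((List.ofFn α).take j).drop k) =
      (((List.ofFn α).drop (k + 1)).take (j - k - 1)).foldl departures (α k) := by
  have hkj' : (k : ℕ) < j := hkj
  have : ((List.ofFn α).take j).drop k
      = α k :: ((List.ofFn α).drop (k + 1)).take (j - k - 1) := by
    rw [List.drop_take, drop_ofFn, show (j : ℕ) - k = (j - k - 1) + 1 by omega, List.take_succ_cons]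
    simp
  rw [this]
  rfl

theorem CWellDefined.stableTandem {α : Fin n → Set ℝ} (hα : CWellDefined α) (k : Fin n) :
    StableTandem (α k) ((List.ofFn α).drop (k + 1)) := by
  rw [stableTandem_iff]
  refine ⟨(hα.config k).locallyFinite, fun S hS => ?_, ?_, fun i hi => ?_⟩
  · obtain ⟨j, rfl⟩ := List.mem_ofFn.1 (List.mem_of_mem_drop hS)
    exact ⟨(hα.config j).locallyFinite, (hα.config j).left_unbounded⟩
  · rw [← C_eq]
    exact (hα.image_config k).left_unbounded
  · have hi' : k + 1 + i < n := by
      rw [List.length_drop, List.length_ofFn] at hi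
      omega
    have h := hα.stable k ⟨k + 1 + i, hi'⟩ (Fin.lt_def.2 (by simp; omega))
    rw [tandem_take_drop α (Fin.lt_def.2 (by simp; omega))] at h
    simpa [Stable, show (k : ℕ) + 1 + i - k - 1 = i by omega] using h

theorem cWellDefined_of_stableTandem {α : Fin n → Set ℝ} (h1 : ∀ k, IsConfig (α k))
    (h2 : ∀ k, IsConfig (C α k))
    (h3 : ∀ k : Fin n, StableTandem (α k) ((List.ofFn α).drop (k + 1))) : CWellDefined α := by
  refine ⟨h1, fun k j hkj => ?_, h2⟩
  have hkj' : (k : ℕ) < j := hkj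
  rw [tandem_take_drop α hkj]
  have h := (stableTandem_iff.1 (h3 k)).2.2.2 (j - k - 1) (by simp; omega)
  simpa [Stable, show (k : ℕ) + 1 + (j - k - 1) = j by omega] using h

/-- The map `C` intertwines the multi-line jumps with the coupled jumps. -/
theorem C_foldl_J {α : Fin n → Set ℝ} (hα : CWellDefined α) (l : List ℝ) :
    C (l.foldl J α) = l.foldl H (C α) := by
  funext k
  rw [foldl_H, C_eq, C_eq, ofFn_foldl_J, ← evolve_drop, foldl_J,
    (hα.stableTandem k).foldl_departures]

/-! ### Comparison of tandems -/

/-- Fewer arrivals make every increment of `a - s` larger, so its records remain records and unused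
services stay unused. -/
theorem departures_mono {A B S : Set ℝ} (hA : ∀ a b : ℝ, (A ∩ Icc a b).Finite)
    (hS : ∀ a b : ℝ, (S ∩ Icc a b).Finite) (hBA : B ⊆ A) : departures B S ⊆ departures A S := by
  have hB : ∀ a b : ℝ, (B ∩ Icc a b).Finite := fun a b =>
    (hA a b).subset (inter_subset_inter_left _ hBA)
  rintro r ⟨hr, hru⟩
  refine ⟨hr, fun hr' => hru ?_⟩
  rw [mem_unused_iff (isHeight_height hA) (isHeight_height hS)] at hr'
  rw [mem_unused_iff (isHeight_height hB) (isHeight_height hS)]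
  refine ⟨hr, fun r' h => ?_⟩
  have h1 := hr'.2 r' h
  have h2 := (isHeight_height hA).sub_le_sub_of_subset (isHeight_height hB) hBA h.le
  omega

/-- `A` has infinitely many more points than `B` on the left. -/
def LeftExcess (A B : Set ℝ) : Prop := ∀ K, ∃ y, ∀ r ≤ y, K ≤ height A r - height B r

theorem LeftExcess.of_isHeight {A B : Set ℝ} {a b : ℝ → ℤ} (hA : IsHeight A a) (hB : IsHeight B b)
    (h : ∀ K, ∃ y, ∀ r ≤ y, K ≤ a r - b r) : LeftExcess A B := by
  intro K
  obtain ⟨y, hy⟩ := h (K + (a 0 - b 0) - (height A 0 - height B 0))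
  refine ⟨y, fun r hr => ?_⟩
  have h1 := hA.sub_eq_height r 0
  have h2 := hB.sub_eq_height r 0
  have h3 := hy r hr
  omega

/-- The height of the services minus that of the departures is `-M`, and stability sends `M` to `-∞`
on the left. -/
theorem Stable.leftExcess {A S : Set ℝ} (hst : Stable A S)
    (hA : ∀ a b : ℝ, (A ∩ Icc a b).Finite) (hS : ∀ a b : ℝ, (S ∩ Icc a b).Finite) :
    LeftExcess S (departures A S) := by
  have hA' := isHeight_height hA
  have hS' := isHeight_height hS
  obtain ⟨M, hM⟩ := hst.exists_runMax hA' hS'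
  refine LeftExcess.of_isHeight hS' (isHeight_departures hA' hS' hM) fun K => ?_
  obtain ⟨y, hy⟩ := hst.eventually_le hA' hS' (-K)
  refine ⟨y, fun r hr => ?_⟩
  obtain ⟨r', hr', he⟩ := (hM r).2
  have := hy r' (hr'.trans hr)
  dsimp only at he ⊢
  omega

/-- At a time `r'` realizing the running maximum for `B`, the walk for `A` is better by the excess
at `r'`, which lies further left still. -/
theorem LeftExcess.departures {A B S : Set ℝ} (h : LeftExcess A B) (hBA : B ⊆ A)
    (hA : ∀ a b : ℝ, (A ∩ Icc a b).Finite) (hS : ∀ a b : ℝ, (S ∩ Icc a b).Finite)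
    (hAS : Stable A S) (hBS : Stable B S) : LeftExcess (departures A S) (departures B S) := by
  have hB : ∀ a b : ℝ, (B ∩ Icc a b).Finite := fun a b =>
    (hA a b).subset (inter_subset_inter_left _ hBA)
  have hA' := isHeight_height hA
  have hB' := isHeight_height hB
  have hS' := isHeight_height hS
  obtain ⟨M, hM⟩ := hAS.exists_runMax hA' hS'
  obtain ⟨M', hM'⟩ := hBS.exists_runMax hB' hS'
  refine LeftExcess.of_isHeight (isHeight_departures hA' hS' hM)
    (isHeight_departures hB' hS' hM') fun K => ?_
  obtain ⟨y, hy⟩ := h K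
  refine ⟨y, fun r hr => ?_⟩
  obtain ⟨r', hr', he⟩ := (hM' r).2
  have h1 := (hM r).1 r' hr'
  have h2 := hy r' (hr'.trans hr)
  dsimp only at he h1 ⊢
  omega

theorem StableTandem.leftExcess_foldl {A B : Set ℝ} {Ls : List (Set ℝ)} (hA : StableTandem A Ls)
    (hB : StableTandem B Ls) (hBA : B ⊆ A) (h : LeftExcess A B) :
    LeftExcess (Ls.foldl HAD.departures A) (Ls.foldl HAD.departures B) ∧
      Ls.foldl HAD.departures B ⊆ Ls.foldl HAD.departures A := by
  induction Ls generalizing A B with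
  | nil => exact ⟨h, hBA⟩
  | cons S Ls ih =>
    exact ih hA.2.2.2.2 hB.2.2.2.2 (departures_mono hA.1 hA.2.1 hBA)
      (h.departures hBA hA.1 hA.2.1 hA.2.2.2.1 hB.2.2.2.1)

/-! ### The list of driving points -/

/-- A list of points of `W` going up in time and to the left in space. -/
def IsPointChain (W : Set (ℝ × ℝ)) (p : List (ℝ × ℝ)) : Prop :=
  p.Pairwise (fun p q => p.2 < q.2 ∧ q.1 < p.1) ∧ ∀ q ∈ p, q ∈ W

section Points

variable {ω : Set (ℝ × ℝ)}

theorem exists_sorted (hω : ∀ N t, (regionPoints ω N t).Finite) (N : ℕ) (t : ℝ) :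
    ∃ L : List (ℝ ×ₗ ℝ), L.SortedLT ∧
      (∀ q, q ∈ L ↔ ((ofLex q).2, (ofLex q).1) ∈ regionPoints ω N t) ∧
      orderedPoints ω N t = L.map fun q => (ofLex q).2 := by
  classical
  refine ⟨((hω N t).toFinset.image fun p => toLex (p.2, p.1)).sort (· ≤ ·),
    Finset.sortedLT_sort _, fun q => ?_, ?_⟩
  · simp only [Finset.mem_sort, Finset.mem_image, Set.Finite.mem_toFinset]
    constructor
    · rintro ⟨p, hp, rfl⟩
      exact hp
    · exact fun h => ⟨_, h, rfl⟩
  · rw [orderedPoints, dif_pos (hω N t)]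

open Classical in
theorem orderedPoints_filter (hω : ∀ N t, (regionPoints ω N t).Finite) {N N' : ℕ} (hN : N ≤ N')
    (t : ℝ) : (orderedPoints ω N' t).filter (fun x : ℝ => |x| ≤ (N : ℝ)) = orderedPoints ω N t := by
  obtain ⟨L, hL, hmem, he⟩ := exists_sorted hω N t
  obtain ⟨L', hL', hmem', he'⟩ := exists_sorted hω N' t
  rw [he, he', List.filter_map]
  congr 1
  refine (hL'.pairwise.sublist List.filter_sublist).sortedLT.eq_of_mem_iff hL fun q => ?_
  rw [List.mem_filter, hmem, hmem']
  have : (N : ℝ) ≤ N' := by exact_mod_cast hN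
  simp only [regionPoints, mem_ofPred_eq, Function.comp, decide_eq_true_eq]
  constructor
  · rintro ⟨⟨h1, _, h2⟩, h3⟩
    exact ⟨h1, h3, h2⟩
  · rintro ⟨h1, h2, h3⟩
    exact ⟨⟨h1, h2.trans this, h3⟩, h2⟩

theorem orderedPoints_prefix (hω : ∀ N t, (regionPoints ω N t).Finite) (N : ℕ) {t T : ℝ}
    (htT : t ≤ T) : ∃ l, orderedPoints ω N T = orderedPoints ω N t ++ l := by
  classical
  obtain ⟨L, hL, hmem, he⟩ := exists_sorted hω N t
  obtain ⟨L', hL', hmem', he'⟩ := exists_sorted hω N T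
  have key : L' = L ++ L'.filter (fun q => ¬ (ofLex q).1 ≤ t) := by
    refine hL'.eq_of_mem_iff (List.pairwise_append.2 ⟨hL.pairwise,
      hL'.pairwise.sublist List.filter_sublist, ?_⟩).sortedLT fun q => ?_
    · intro p hp q hq
      rw [hmem] at hp
      rw [List.mem_filter, decide_eq_true_eq, not_le] at hq
      exact Prod.Lex.lt_iff.2 (Or.inl (hp.2.2.2.trans_lt hq.2))
    · rw [List.mem_append, List.mem_filter, hmem, hmem', decide_eq_true_eq]
      simp only [regionPoints, mem_ofPred_eq]
      constructor
      · rintro ⟨h1, h2, h3, h4⟩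
        by_cases h5 : (ofLex q).1 ≤ t
        · exact Or.inl ⟨h1, h2, h3, h5⟩
        · exact Or.inr ⟨⟨h1, h2, h3, h4⟩, h5⟩
      · rintro (⟨h1, h2, h3, h4⟩ | ⟨h, _⟩)
        · exact ⟨h1, h2, h3, h4.trans htT⟩
        · exact h
  rw [he, he', key, List.map_append]
  exact ⟨_, rfl⟩

theorem exists_chain_iff (hω : ∀ N t, (regionPoints ω N t).Finite) {N : ℕ} {t a b : ℝ}
    (ha : -N ≤ a) (hb : b ≤ N) (k : ℕ) :
    (∃ c : List ℝ, c.Sublist (orderedPoints ω N t) ∧ IsChain a b c ∧ c.length = k) ↔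
      ∃ p, IsPointChain (ω ∩ Ioc a b ×ˢ Ioc 0 t) p ∧ p.length = k := by
  obtain ⟨L, hL, hmem, he⟩ := exists_sorted hω N t
  have hreg : ∀ p : ℝ × ℝ, a < p.1 → p.1 ≤ b →
      (p ∈ regionPoints ω N t ↔ p ∈ ω ∩ Ioc a b ×ˢ Ioc 0 t) := by
    intro p h1 h2
    simp only [regionPoints, mem_ofPred_eq, mem_inter_iff, mem_prod, mem_Ioc, h1, h2, true_and]
    rw [and_iff_right (abs_le.2 ⟨ha.trans h1.le, h2.trans hb⟩)]
  constructor
  · rintro ⟨c, hcl, hc, rfl⟩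
    rw [he] at hcl
    obtain ⟨c', hc', rfl⟩ := List.sublist_map_iff.1 hcl
    refine ⟨c'.map fun q => ((ofLex q).2, (ofLex q).1), ⟨?_, ?_⟩, by simp⟩
    · have h1 := hc.1
      rw [List.pairwise_map] at h1 ⊢
      refine (h1.and (hL.pairwise.sublist hc')).imp fun {p q} h => ⟨?_, h.1⟩
      -- Points with equal times are listed from left to right, whereas a chain goes to the left; so
      -- the times along a chain are strictly increasing.
      rcases Prod.Lex.lt_iff.1 h.2 with h2 | h2
      · exact h2
      · exact absurd h2.2 (not_lt.2 (le_of_lt h.1))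
    · intro q hq
      obtain ⟨r, hr, rfl⟩ := List.mem_map.1 hq
      have h2 := hc.2 _ (List.mem_map_of_mem hr)
      exact (hreg _ h2.1 h2.2).1 ((hmem r).1 (hc'.subset hr))
  · rintro ⟨p, hp, rfl⟩
    refine ⟨p.map Prod.fst, ?_, ⟨?_, ?_⟩, by simp⟩
    · rw [he, show p.map Prod.fst
        = (p.map fun q => toLex (q.2, q.1)).map (fun q => (ofLex q).2) by simp]
      refine List.Sublist.map _ ?_
      have hs : (p.map fun q => toLex (q.2, q.1)).SortedLT := by
        refine List.Pairwise.sortedLT ?_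
        rw [List.pairwise_map]
        exact hp.1.imp fun {p q} h => Prod.Lex.lt_iff.2 (Or.inl h.1)
      refine List.sublist_of_subperm_of_sortedLE (List.subperm_of_subset hs.nodup ?_) hs.sortedLE
        hL.sortedLE
      intro q hq
      obtain ⟨r, hr, rfl⟩ := List.mem_map.1 hq
      have h1 := hp.2 r hr
      exact (hmem _).2 ((hreg _ h1.2.1.1 h1.2.1.2).2 h1)
    · rw [List.pairwise_map]
      exact hp.1.imp fun {p q} h => h.2
    · intro x hx
      obtain ⟨r, hr, rfl⟩ := List.mem_map.1 hx
      exact (hp.2 r hr).2.1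

end Points

/-! ### Local limits -/

/-- The set of points that eventually belong to `X N`. -/
def limSet (X : ℕ → Set ℝ) : Set ℝ := {y | ∀ᶠ N in atTop, y ∈ X N}

/-- On bounded intervals, `f N` is eventually equal to `g`. -/
def LocLim (f : ℕ → ℝ → ℤ) (g : ℝ → ℤ) : Prop :=
  ∀ a b : ℝ, ∀ᶠ N in atTop, ∀ y ∈ Icc a b, f N y = g y

section LocLim

variable {X : ℕ → Set ℝ} {f : ℕ → ℝ → ℤ} {g : ℝ → ℤ}

theorem LocLim.eventually_inter (hX : ∀ N, IsHeight (X N) (f N)) (hf : LocLim f g) (a b : ℝ) :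
    ∀ᶠ N in atTop, X N ∩ Icc a b = limSet X ∩ Icc a b := by
  have key : ∀ᶠ N in atTop, ∀ y ∈ Icc a b, y ∈ X N ↔ ∀ w, a - 1 ≤ w → w < y → g y < g w := by
    filter_upwards [hf (a - 1) b] with N hN y hy
    rw [(hX N).mem_iff_of_lt ((sub_one_lt a).trans_le hy.1)]
    refine forall_congr' fun w => forall_congr' fun h1 => forall_congr' fun h2 => ?_
    rw [hN y ⟨(sub_one_lt a).le.trans hy.1, hy.2⟩, hN w ⟨h1, h2.le.trans hy.2⟩]
  filter_upwards [key] with N hN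
  ext y
  simp only [mem_inter_iff]
  refine and_congr_left fun hy => ?_
  constructor
  · intro hyN
    rw [hN y hy] at hyN
    change ∀ᶠ N in atTop, y ∈ X N
    filter_upwards [key] with N' hN'
    exact (hN' y hy).2 hyN
  · intro hyN
    obtain ⟨N', h1, h2⟩ := ((show ∀ᶠ N in atTop, y ∈ X N from hyN).and key).exists
    exact (hN y hy).2 ((h2 y hy).1 h1)

theorem LocLim.isHeight (hX : ∀ N, IsHeight (X N) (f N)) (hf : LocLim f g) :
    IsHeight (limSet X) g := by
  constructor
  · intro a b
    obtain ⟨N, hN⟩ := (hf.eventually_inter hX a b).exists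
    rw [← hN]
    exact (hX N).finite a b
  · intro s r hsr
    obtain ⟨N, h1, h2⟩ := ((hf.eventually_inter hX s r).and (hf s r)).exists
    rw [← h2 s ⟨le_rfl, hsr⟩, ← h2 r ⟨hsr, le_rfl⟩, (hX N).sub_eq s r hsr]
    have : ∀ Y : Set ℝ, Y ∩ Ioc s r = Y ∩ Icc s r ∩ Ioc s r := fun Y => by
      rw [inter_assoc, inter_eq_right.2 Ioc_subset_Icc_self]
    rw [this, h1, ← this]

end LocLim

/-- Limits of queues: if infinitely many service times on the left remain unused in the limit, then
the limit of the departures is the departure process of the limits. -/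
theorem departures_limSet {A S : ℕ → Set ℝ} {a s b : ℕ → ℝ → ℤ} {a' s' b' : ℝ → ℤ}
    (hA : ∀ N, IsHeight (A N) (a N)) (hS : ∀ N, IsHeight (S N) (s N))
    (hB : ∀ N, IsHeight (departures (A N) (S N)) (b N))
    (ha : LocLim a a') (hs : LocLim s s') (hb : LocLim b b')
    (hU : LeftUnbounded (limSet S \ limSet fun N => departures (A N) (S N))) :
    Stable (limSet A) (limSet S) ∧
      departures (limSet A) (limSet S) = limSet fun N => departures (A N) (S N) := by
  set Y := limSet fun N => departures (A N) (S N) with hY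
  have hA' := ha.isHeight hA
  have hS' := hs.isHeight hS
  have hdiff : ∀ p q, p ≤ q → ∀ᶠ N in atTop, ∀ r ∈ Icc p q, a N r - s N r = a' r - s' r := by
    intro p q _
    filter_upwards [ha p q, hs p q] with N h1 h2 r hr
    rw [h1 r hr, h2 r hr]
  have hunN : ∀ u ∈ limSet S \ Y, ∀ᶠ N in atTop, u ∈ unused (A N) (S N) := by
    rintro u ⟨huS, huY⟩
    filter_upwards [hs.eventually_inter hS u u, hb.eventually_inter hB u u] with N h1 h2
    have h3 : u ∈ S N ∩ Icc u u := by rw [h1]; exact ⟨huS, le_rfl, le_rfl⟩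
    by_contra h4
    have h5 : u ∈ departures (A N) (S N) ∩ Icc u u := ⟨⟨h3.1, h4⟩, le_rfl, le_rfl⟩
    rw [h2] at h5
    exact huY h5.1
  have hun : ∀ u ∈ limSet S \ Y, u ∈ unused (limSet A) (limSet S) := by
    intro u hu
    rw [mem_unused_iff hA' hS']
    refine ⟨hu.1, fun r' hr' => ?_⟩
    obtain ⟨N, h1, h2⟩ := ((hunN u hu).and (hdiff r' u hr'.le)).exists
    rw [mem_unused_iff (hA N) (hS N)] at h1
    have := h1.2 r' hr'
    rwa [h2 r' ⟨le_rfl, hr'.le⟩, h2 u ⟨hr'.le, le_rfl⟩] at this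
  constructor
  · refine stable_of_eventually_le hA' hS' fun K => ?_
    obtain ⟨u₀, hu₀, _⟩ := hU 0
    -- Unused services are strict records of an integer function, so going from one to an earlier
    -- one lowers it by at least one.
    have hdec : ∀ m : ℕ, ∃ w ∈ limSet S \ Y, a' w - s' w ≤ a' u₀ - s' u₀ - m := by
      intro m
      induction m with
      | zero => exact ⟨u₀, hu₀, by simp⟩
      | succ m ih =>
        obtain ⟨w, hw, hwm⟩ := ih
        obtain ⟨w', hw', hlt⟩ := hU w
        have := ((mem_unused_iff hA' hS').1 (hun w hw)).2 w' hlt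
        exact ⟨w', hw', by push_cast; omega⟩
    obtain ⟨u, hu, h1⟩ := hdec (a' u₀ - s' u₀ - K).toNat
    refine ⟨u, fun r hr => ?_⟩
    rcases hr.eq_or_lt with rfl | hlt
    · omega
    · have := ((mem_unused_iff hA' hS').1 (hun u hu)).2 r hlt
      omega
  · apply Subset.antisymm
    · rintro y ⟨hyS, hyu⟩
      by_contra hyY
      exact hyu (hun y ⟨hyS, hyY⟩)
    · intro y hy
      have hy' : ∀ᶠ N in atTop, y ∈ departures (A N) (S N) := hy
      refine ⟨hy'.mono fun N h => h.1, fun hyu => ?_⟩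
      -- A record at `u < y` dominates everything before `u`, so whether `y` is a record is decided
      -- on `[u, y]`, where local convergence applies.
      obtain ⟨u, hu, huy⟩ := hU y
      obtain ⟨N, h1, h2, h3⟩ := (hy'.and ((hunN u hu).and (hdiff u y huy.le))).exists
      refine h1.2 ?_
      rw [mem_unused_iff (hA N) (hS N)] at h2 ⊢
      rw [mem_unused_iff hA' hS'] at hyu
      have hge : ∀ r', u ≤ r' → r' < y → a N r' - s N r' < a N y - s N y := by
        intro r' h4 h5
        rw [h3 r' ⟨h4, h5.le⟩, h3 y ⟨huy.le, le_rfl⟩]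
        exact hyu.2 r' h5
      refine ⟨h1.1, fun r' hr' => ?_⟩
      rcases lt_or_ge r' u with h4 | h4
      · exact (h2.2 r' h4).trans (hge u le_rfl huy)
      · exact hge r' h4 hr'

/-! ### Local limits of the multi-line dynamics -/

open Classical in
/-- The points of `l N` in a bounded interval eventually do not depend on `N`. -/
def LocConst (l : ℕ → List ℝ) : Prop :=
  ∀ a b : ℝ, ∃ N₀, ∀ N ≥ N₀,
    (l N).filter (fun x => a < x ∧ x ≤ b) = (l N₀).filter fun x => a < x ∧ x ≤ b

/-- The points of `B` far to the right outnumber, uniformly in `N`, the chains of `l N`. -/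
def Dominates (B : Set ℝ) (l : ℕ → List ℝ) : Prop :=
  ∀ (a : ℝ) (K : ℤ), ∃ Z : ℝ, ∀ N, ∀ z ≥ Z, ∀ c : List ℝ, c.Sublist (l N) → IsChain a z c →
    height B z + c.length ≤ K

/-- All the tandems formed by the lines `Ls` are stable, with departures dominating `l`. -/
def Admissible (l : ℕ → List ℝ) : List (Set ℝ) → Prop
  | [] => True
  | S :: Ls => StableTandem S Ls ∧ Dominates (Ls.foldl departures S) l ∧ Admissible l Ls

/-- The local limits of the lines `Ls`. -/
def evolveLim (l : ℕ → List ℝ) : List (Set ℝ) → List (Set ℝ)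
  | [] => []
  | S :: Ls => limSet (fun N => shifts S (dual Ls (l N))) :: evolveLim l Ls

section Limits

variable {l : ℕ → List ℝ}

/-- Chains of the points driving `S` are traded by `StableTandem.exists_chain` for chains of `l`
under the last departures, which dominate them. The constant subtracted in the proof is the offset
between the two heights `g` and `height` of these departures. -/
theorem exists_bound_of_dominates {S : Set ℝ} {Ls : List (Set ℝ)} (hT : StableTandem S Ls)
    (hD : Dominates (Ls.foldl departures S) l) (a b : ℝ) :
    ∃ Z, b ≤ Z ∧ ∀ N, ∀ y z : ℝ, a ≤ y → Z < z → ∀ c : List ℝ, c.Sublist (dual Ls (l N)) →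
      IsChain y z c → height S z + c.length ≤ height S b := by
  have hS := isHeight_height hT.finite
  obtain ⟨g, hg, H⟩ := hT.exists_chain hS
  have hg' := isHeight_height hT.finite_foldl.1
  obtain ⟨Z, hZ⟩ := hD a (height S b - (g 0 - height (Ls.foldl departures S) 0))
  refine ⟨max b Z, le_max_left _ _, fun N y z hay hz c hcl hc => ?_⟩
  -- Only a nonempty chain guarantees `y ≤ z`; for the empty one monotonicity of the height
  -- suffices.
  rcases c.eq_nil_or_concat with rfl | ⟨c₀, x, rfl⟩
  · simpa using hS.antitone ((le_max_left b Z).trans hz.le)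
  · have hyz : y ≤ z := by
      have := hc.2 x (by simp)
      linarith
    obtain ⟨z', hz', c', hc'l, hc', h1⟩ := H (l N) _ y z hyz hcl hc
    have h2 := hZ N z' ((le_max_right b Z).trans (hz.le.trans hz')) c' hc'l (hc'.mono hay le_rfl)
    have h3 := hg.sub_eq_height z' 0
    omega

theorem locConst_out {S : Set ℝ} {Ls : List (Set ℝ)} (hT : StableTandem S Ls)
    (hD : Dominates (Ls.foldl departures S) l) (hl : LocConst fun N => dual Ls (l N)) :
    LocConst fun N => out S (dual Ls (l N)) := by
  intro a b
  obtain ⟨Z, hbZ, hZ⟩ := exists_bound_of_dominates hT hD a b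
  obtain ⟨N₀, hN₀⟩ := hl a Z
  have hS := isHeight_height hT.finite
  refine ⟨N₀, fun N hN => ?_⟩
  dsimp only at hN₀ ⊢
  rw [hS.filter_out_eq hT.leftUnbounded hbZ (hZ N), hS.filter_out_eq hT.leftUnbounded hbZ (hZ N₀),
    hN₀ N hN]

theorem Admissible.locConst_dual {Ls : List (Set ℝ)} (hL : Admissible l Ls) (hl : LocConst l) :
    LocConst fun N => dual Ls (l N) := by
  induction Ls with
  | nil => exact hl
  | cons S Ls ih => exact locConst_out hL.1 hL.2.1 (ih hL.2.2)

theorem exists_locLim {S : Set ℝ} {Ls : List (Set ℝ)} (hT : StableTandem S Ls)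
    (hD : Dominates (Ls.foldl departures S) l) (hl : LocConst fun N => dual Ls (l N)) :
    ∃ g, LocLim (fun N => hops (height S) (dual Ls (l N))) g := by
  have hS := isHeight_height hT.finite
  have key : ∀ a b : ℝ, ∃ N₀, ∀ N ≥ N₀, ∀ y ∈ Icc a b,
      hops (height S) (dual Ls (l N)) y = hops (height S) (dual Ls (l N₀)) y := by
    intro a b
    obtain ⟨Z, hbZ, hZ⟩ := exists_bound_of_dominates hT hD a b
    obtain ⟨N₀, hN₀⟩ := hl a Z
    refine ⟨N₀, fun N hN y hy => ?_⟩
    dsimp only at hN₀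
    rw [hS.hops_eq_hops_filter (hZ N) hy.1 hy.2, hS.hops_eq_hops_filter (hZ N₀) hy.1 hy.2,
      hN₀ N hN]
  choose N₀ hN₀ using key
  refine ⟨fun y => hops (height S) (dual Ls (l (N₀ y y))) y, fun a b => ?_⟩
  filter_upwards [eventually_ge_atTop (N₀ a b)] with N hN y hy
  rw [hN₀ a b N hN y hy,
    ← hN₀ a b (max (N₀ a b) (N₀ y y)) (le_max_left _ _) y hy,
    hN₀ y y (max (N₀ a b) (N₀ y y)) (le_max_right _ _) y ⟨le_rfl, le_rfl⟩]

theorem leftUnbounded_limSet {S : Set ℝ} {h : ℝ → ℤ} {m : ℕ → List ℝ} {g : ℝ → ℤ}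
    (hS : IsHeight S h) (hl : LeftUnbounded S) (hg : LocLim (fun N => hops h (m N)) g) :
    LeftUnbounded (limSet fun N => shifts S (m N)) := by
  rw [(hg.isHeight fun N => hS.shifts hl (m N)).leftUnbounded_iff]
  intro K
  obtain ⟨y, hy⟩ := hS.leftUnbounded_iff.1 hl K
  refine ⟨y, fun r hr => ?_⟩
  obtain ⟨N, hN⟩ := (hg r r).exists
  rw [← hN r ⟨le_rfl, le_rfl⟩]
  exact (hy r hr).trans (le_hops _ _ _)

theorem departures_inter_Iic {A A' S : Set ℝ} (hA : ∀ a b : ℝ, (A ∩ Icc a b).Finite)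
    (hA' : ∀ a b : ℝ, (A' ∩ Icc a b).Finite) (hS : ∀ a b : ℝ, (S ∩ Icc a b).Finite) {x : ℝ}
    (h : A ∩ Iic x = A' ∩ Iic x) : departures A S ∩ Iic x = departures A' S ∩ Iic x := by
  ext y
  simp only [mem_inter_iff]
  refine and_congr_left fun hy => ?_
  refine and_congr_right fun _ => not_congr ?_
  rw [mem_unused_iff (isHeight_height hA) (isHeight_height hS),
    mem_unused_iff (isHeight_height hA') (isHeight_height hS)]
  refine and_congr_right fun _ => forall_congr' fun r => forall_congr' fun hr => ?_
  have h1 := (isHeight_height hA).sub_eq r y hr.le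
  have h2 := (isHeight_height hA').sub_eq r y hr.le
  have h3 : A ∩ Ioc r y = A' ∩ Ioc r y := by
    have : ∀ B : Set ℝ, B ∩ Ioc r y = B ∩ Iic x ∩ Ioc r y := fun B => by
      rw [inter_assoc, inter_eq_right.2 (show Ioc r y ⊆ Iic x from fun z hz => hz.2.trans hy)]
    rw [this, h, ← this]
  rw [h3] at h1
  omega

theorem StableTandem.foldl_inter_Iic {A A' : Set ℝ} {Ls : List (Set ℝ)} (hA : StableTandem A Ls)
    (hA' : StableTandem A' Ls) {x : ℝ} (h : A ∩ Iic x = A' ∩ Iic x) :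
    Ls.foldl departures A ∩ Iic x = Ls.foldl departures A' ∩ Iic x := by
  induction Ls generalizing A A' with
  | nil => exact h
  | cons S Ls ih =>
    exact ih hA.2.2.2.2 hA'.2.2.2.2 (departures_inter_Iic hA.1 hA'.1 hA.2.1 h)

/-- An infinite excess on the left between two lines driven by `l` persists in the limit, when the
lines dominate `l` and `l'`. -/
def KeepsExcess (l l' : ℕ → List ℝ) : Prop :=
  ∀ F G : Set ℝ, (∀ a b : ℝ, (F ∩ Icc a b).Finite) → LeftUnbounded G → G ⊆ F → Dominates G l →
    Dominates G l' → LeftExcess F G →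
    LeftUnbounded (limSet (fun N => shifts F (l N)) \ limSet fun N => shifts G (l N))

/-- The queue of `A` and `S` passes to the limit once the limit leaves services unused arbitrarily
far to the left. Otherwise the limits of `S` and of `departures A S` would agree on a left
half-line, and by causality so would what the remaining queues make of them. By the induction
hypothesis, used for both, these outputs are limits of two lines driven by `l` itself, whose excess
`KeepsExcess` preserves. -/
theorem Admissible.stableTandem_limSet {l' : ℕ → List ℝ} {Ls : List (Set ℝ)}
    (hL : Admissible l Ls) (hLd : Admissible l' Ls) (hl : LocConst l) (hE : KeepsExcess l l')
    {A : Set ℝ} (hT : StableTandem A Ls) (hD : Dominates (Ls.foldl departures A) l)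
    (hDd : Dominates (Ls.foldl departures A) l') :
    StableTandem (limSet fun N => shifts A (dual Ls (l N))) (evolveLim l Ls) ∧
      (evolveLim l Ls).foldl departures (limSet fun N => shifts A (dual Ls (l N))) =
        limSet fun N => shifts (Ls.foldl departures A) (l N) := by
  induction Ls generalizing A with
  | nil =>
    obtain ⟨g, hg⟩ := exists_locLim hT hD (hL.locConst_dual hl)
    have hA := isHeight_height hT.finite
    have hAl := hT.leftUnbounded
    have hAN : ∀ N, _ := fun N => hA.shifts hAl (dual [] (l N))
    have hgA := hg.isHeight hAN
    exact ⟨⟨hgA.finite, leftUnbounded_limSet hA hAl hg⟩, rfl⟩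
  | cons S Ls ih =>
    obtain ⟨g, hg⟩ := exists_locLim hT hD (hL.locConst_dual hl)
    have hA := isHeight_height hT.finite
    have hAl := hT.leftUnbounded
    have hAN : ∀ N, _ := fun N => hA.shifts hAl (dual (S :: Ls) (l N))
    have hgA := hg.isHeight hAN
    obtain ⟨hTS, hDS, hL'⟩ := hL
    obtain ⟨_, hDSd, hLd'⟩ := hLd
    have hTB := hT.2.2.2.2
    have hl' := hL'.locConst_dual hl
    have hS := isHeight_height hTS.finite
    have hSl := hTS.leftUnbounded
    have hSN : ∀ N, _ := fun N => hS.shifts hSl (dual Ls (l N))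
    obtain ⟨M, hM⟩ := hT.2.2.2.1.exists_runMax hA hS
    have hBN : ∀ N, departures (shifts A (dual (S :: Ls) (l N))) (shifts S (dual Ls (l N)))
        = shifts (departures A S) (dual Ls (l N)) := fun N =>
      departures_shifts hA hAl hS hSl hM hTB.leftUnbounded (dual Ls (l N))
    obtain ⟨s', hs'⟩ := exists_locLim hTS hDS hl'
    have hB := isHeight_height hTB.finite
    obtain ⟨b', hb'⟩ := exists_locLim hTB hD hl'
    have hBh : ∀ N, _ := fun N => hB.shifts hTB.leftUnbounded (dual Ls (l N))
    obtain ⟨ihB1, ihB2⟩ := ih hL' hLd' hTB hD hDd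
    obtain ⟨ihS1, ihS2⟩ := ih hL' hLd' hTS hDS hDSd
    -- the excess of the last line is inherited from the excess at the top
    have hex := (hT.2.2.2.1.leftExcess hT.1 hT.2.1)
    have hsub : departures A S ⊆ S := sdiff_subset
    obtain ⟨hex1, hex2⟩ := StableTandem.leftExcess_foldl hTS hTB hsub hex
    have hlast := hE _ _ hTS.finite_foldl.1 hTB.finite_foldl.2 hex2 hD hDd hex1
    have hU : LeftUnbounded (limSet (fun N => shifts S (dual Ls (l N))) \
        limSet fun N => shifts (departures A S) (dual Ls (l N))) := by
      by_contra hcon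
      rw [LeftUnbounded] at hcon
      push Not at hcon
      obtain ⟨x, hx⟩ := hcon
      have hsubl : limSet (fun N => shifts (departures A S) (dual Ls (l N)))
          ⊆ limSet fun N => shifts S (dual Ls (l N)) := by
        intro y hy
        refine Eventually.mono (show ∀ᶠ N in atTop, _ from hy) fun N h => ?_
        have h' : y ∈ shifts (departures A S) (dual Ls (l N)) := h
        rw [← hBN N] at h'
        exact h'.1
      have heq : limSet (fun N => shifts S (dual Ls (l N))) ∩ Iic (x - 1)
          = limSet (fun N => shifts (departures A S) (dual Ls (l N))) ∩ Iic (x - 1) := by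
        apply Subset.antisymm
        · rintro y ⟨hy, hyx⟩
          refine ⟨?_, hyx⟩
          by_contra hyn
          have := hx y ⟨hy, hyn⟩
          have : y ≤ x - 1 := hyx
          linarith
        · exact inter_subset_inter_left _ hsubl
      have heq' := ihS1.foldl_inter_Iic ihB1 heq
      rw [ihS2, ihB2] at heq'
      obtain ⟨y, ⟨hy1, hy2⟩, hyx⟩ := hlast (x - 1)
      have : y ∈ limSet (fun N => shifts (Ls.foldl departures S) (l N)) ∩ Iic (x - 1) :=
        ⟨hy1, hyx.le⟩
      rw [heq'] at this
      exact hy2 this.1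
    have hq := departures_limSet (A := fun N => shifts A (dual (S :: Ls) (l N)))
      (S := fun N => shifts S (dual Ls (l N))) (b := fun N => hops (height (departures A S))
        (dual Ls (l N))) hAN hSN (fun N => by rw [hBN N]; exact hBh N) hg hs' hb'
      (by simp only [hBN]; exact hU)
    simp only [hBN] at hq
    obtain ⟨hq1, hq2⟩ := hq
    refine ⟨⟨hgA.finite, (hs'.isHeight hSN).finite, leftUnbounded_limSet hS hSl hs', hq1, ?_⟩, ?_⟩
    · rw [hq2]
      exact ihB1
    · change (evolveLim l Ls).foldl departures (departures _ _) = _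
      rw [hq2]
      exact ihB2

end Limits

/-! ### The growth condition -/

/-- In this form the growth is compared directly with chains, whose length is of order `√s`. -/
theorem growth_iff {S : Set ℝ} {h : ℝ → ℤ} (hS : IsHeight S h) :
    Tendsto (fun s : ℝ => ((S ∩ Icc 0 s).ncard : ℝ) ^ 2 / s) atTop atTop ↔
      ∀ R : ℝ, ∀ᶠ s : ℝ in atTop, R * √s ≤ -(h s : ℝ) := by
  have hcard : ∀ s : ℝ, 0 ≤ s → ((h 0 - h s : ℤ) : ℝ) ≤ (S ∩ Icc 0 s).ncard ∧
      ((S ∩ Icc 0 s).ncard : ℝ) ≤ ((h 0 - h s : ℤ) : ℝ) + 1 := by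
    intro s hs
    rw [hS.sub_eq 0 s hs]
    constructor
    · exact_mod_cast ncard_le_ncard (inter_subset_inter_right _ Ioc_subset_Icc_self)
        (hS.finite 0 s)
    · have h1 : S ∩ Icc 0 s ⊆ insert 0 (S ∩ Ioc 0 s) := by
        rintro x ⟨hx, hx0, hxs⟩
        rcases hx0.eq_or_lt with rfl | h
        · exact mem_insert _ _
        · exact mem_insert_of_mem _ ⟨hx, h, hxs⟩
      have h2 := (ncard_le_ncard h1 ((finite_inter_Ioc hS.finite 0 s).insert 0)).trans
        (ncard_insert_le _ _)
      exact_mod_cast h2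
  have hsqrt : ∀ c : ℝ, ∀ᶠ s : ℝ in atTop, c ≤ √s := fun c =>
    tendsto_atTop.1 Real.tendsto_sqrt_atTop c
  constructor
  · intro H R
    filter_upwards [tendsto_atTop.1 H ((|R| + 1) ^ 2), eventually_gt_atTop 0,
      hsqrt (1 + |(h 0 : ℝ)|)] with s h1 hs h2
    rw [le_div_iff₀ hs] at h1
    have h3 : (|R| + 1) * √s ≤ (S ∩ Icc 0 s).ncard := by
      refine le_of_sq_le_sq ?_ (by positivity)
      rw [mul_pow, Real.sq_sqrt hs.le]
      exact h1
    have h4 := (hcard s hs.le).2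
    push_cast at h4
    have h5 : R * √s ≤ |R| * √s := mul_le_mul_of_nonneg_right (le_abs_self R) (Real.sqrt_nonneg s)
    have h6 := le_abs_self (h 0 : ℝ)
    nlinarith
  · intro H
    refine tendsto_atTop.2 fun K => ?_
    filter_upwards [H (|K| + 2), eventually_gt_atTop 0, hsqrt (|(h 0 : ℝ)|)] with s h1 hs h2
    rw [le_div_iff₀ hs]
    have h3 := (hcard s hs.le).1
    push_cast at h3
    have h4 := neg_abs_le (h 0 : ℝ)
    have h5 : (|K| + 1) * √s ≤ (S ∩ Icc 0 s).ncard := by nlinarith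
    have h6 : ((|K| + 1) * √s) ^ 2 ≤ ((S ∩ Icc 0 s).ncard : ℝ) ^ 2 :=
      pow_le_pow_left₀ (by positivity) h5 2
    rw [mul_pow, Real.sq_sqrt hs.le] at h6
    refine le_trans ?_ h6
    have h7 := le_abs_self K
    have h8 := abs_nonneg K
    have h9 : K ≤ (|K| + 1) ^ 2 := by nlinarith
    exact mul_le_mul_of_nonneg_right h9 hs.le

/-- Taking `r' = s` in the running maximum, the departure height is at least the arrival height, so
growth goes back from departures to arrivals. -/
theorem StableTandem.growth {A : Set ℝ} {Ls : List (Set ℝ)} (hT : StableTandem A Ls)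
    (hg : Tendsto (fun s : ℝ => ((Ls.foldl departures A ∩ Icc 0 s).ncard : ℝ) ^ 2 / s)
      atTop atTop) :
    Tendsto (fun s : ℝ => ((A ∩ Icc 0 s).ncard : ℝ) ^ 2 / s) atTop atTop := by
  induction Ls generalizing A with
  | nil => exact hg
  | cons S Ls ih =>
    obtain ⟨hA, hS, hl, hst, hT'⟩ := hT
    have hA' := isHeight_height hA
    have hS' := isHeight_height hS
    obtain ⟨M, hM⟩ := hst.exists_runMax hA' hS'
    have h1 := (growth_iff (isHeight_departures hA' hS' hM)).1 (ih hT' hg)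
    rw [growth_iff hA']
    intro R
    filter_upwards [h1 R] with s hs
    refine hs.trans (neg_le_neg ?_)
    have h2 : height A s - height S s ≤ M s := (hM s).1 s le_rfl
    exact_mod_cast (by omega : height A s ≤ height S s + M s)

/-! ### Deterministic properties of the driving points -/

/-- The properties of the driving points, almost sure for a Poisson process, on which the
construction of the dynamics relies. -/
structure GoodPoints (ω : Set (ℝ × ℝ)) : Prop where
  finite : ∀ (N : ℕ) (t : ℝ), (regionPoints ω N t).Finite
  chain_growth : ∀ T : ℕ, ∃ K : ℕ, ∀ (j N : ℕ) (c : List ℝ), c.Sublist (orderedPoints ω N T) →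
    IsChain 0 ((j : ℝ) ^ 2) c → c.length ≤ K * (j + 1)
  chain_left : ∀ (T : ℕ) (z : ℤ), ∃ r₀ : ℝ, ∀ r ≤ r₀, ∃ N₀ : ℕ, ∀ N ≥ N₀, ∀ c : List ℝ,
    c.Sublist (orderedPoints ω N T) → IsChain r (z + 1) c →
      ∃ c' : List ℝ, c'.Sublist (orderedPoints ω N T) ∧ IsChain r z c' ∧ c.length ≤ c'.length

namespace GoodPoints

variable {ω : Set (ℝ × ℝ)}

theorem sublist_of_isChain (hω : GoodPoints ω) {N N₁ : ℕ} {t a b : ℝ} {c : List ℝ}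
    (hcl : c.Sublist (orderedPoints ω N t)) (hc : IsChain a b c) (ha : -(N₁ : ℝ) ≤ a)
    (hb : b ≤ N₁) : c.Sublist (orderedPoints ω N₁ t) := by
  classical
  rcases le_total N N₁ with h | h
  · rw [← orderedPoints_filter hω.finite h] at hcl
    exact hcl.trans List.filter_sublist
  · rw [← orderedPoints_filter hω.finite h]
    have : c = c.filter fun x : ℝ => |x| ≤ (N₁ : ℝ) := by
      symm
      rw [List.filter_eq_self]
      exact fun x hx => decide_eq_true
        (abs_le.2 ⟨ha.trans (hc.2 x hx).1.le, (hc.2 x hx).2.trans hb⟩)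
    rw [this]
    exact hcl.filter _

theorem exists_chain_bound (hω : GoodPoints ω) (t a b : ℝ) : ∃ K : ℕ, ∀ (N : ℕ) (c : List ℝ),
    c.Sublist (orderedPoints ω N t) → IsChain a b c → c.length ≤ K := by
  obtain ⟨N₁, hN₁⟩ := exists_nat_ge (max |a| |b|)
  refine ⟨(orderedPoints ω N₁ t).length, fun N c hcl hc => List.Sublist.length_le ?_⟩
  refine hω.sublist_of_isChain hcl hc ?_ ((le_abs_self b).trans ((le_max_right _ _).trans hN₁))
  linarith [neg_abs_le a, (le_max_left |a| |b|).trans hN₁]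

theorem sublist_ceil (hω : GoodPoints ω) (N : ℕ) (t : ℝ) :
    (orderedPoints ω N t).Sublist (orderedPoints ω N (⌈t⌉₊ : ℕ)) := by
  obtain ⟨l, hl⟩ := orderedPoints_prefix hω.finite N (Nat.le_ceil t)
  rw [hl]
  exact List.sublist_append_left _ _

theorem exists_sqrt_bound (hω : GoodPoints ω) (t : ℝ) : ∃ K : ℝ, 0 ≤ K ∧ ∀ (N : ℕ) (z : ℝ)
    (c : List ℝ), c.Sublist (orderedPoints ω N t) → IsChain 0 z c → c.length ≤ K * (√z + 2) := by
  obtain ⟨K, hK⟩ := hω.chain_growth ⌈t⌉₊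
  refine ⟨K, Nat.cast_nonneg _, fun N z c hcl hc => ?_⟩
  have h1 : z ≤ (⌈√z⌉₊ : ℝ) ^ 2 := by
    rcases le_or_gt z 0 with hz | hz
    · exact hz.trans (sq_nonneg _)
    · calc z = √z ^ 2 := (Real.sq_sqrt hz.le).symm
        _ ≤ _ := pow_le_pow_left₀ (Real.sqrt_nonneg _) (Nat.le_ceil _) 2
  have h2 := hK _ N c (hcl.trans (hω.sublist_ceil N t)) (hc.mono le_rfl h1)
  have h3 : (c.length : ℝ) ≤ K * (⌈√z⌉₊ + 1) := by exact_mod_cast h2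
  have h4 := (Nat.ceil_lt_add_one (Real.sqrt_nonneg z)).le
  refine h3.trans (mul_le_mul_of_nonneg_left ?_ (Nat.cast_nonneg _))
  linarith

theorem isChain_filter {a b d : ℝ} {c : List ℝ} (hc : IsChain a b c) :
    IsChain d b (c.filter fun x => d < x) ∧ IsChain a d (c.filter fun x => ¬ d < x) ∧
      c.length = (c.filter fun x => d < x).length + (c.filter fun x => ¬ d < x).length := by
  refine ⟨⟨hc.1.sublist List.filter_sublist, fun x hx => ?_⟩,
    ⟨hc.1.sublist List.filter_sublist, fun x hx => ?_⟩, ?_⟩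
  · rw [List.mem_filter, decide_eq_true_eq] at hx
    exact ⟨hx.2, (hc.2 x hx.1).2⟩
  · rw [List.mem_filter, decide_eq_true_eq, not_lt] at hx
    exact ⟨(hc.2 x hx.1).1, hx.2⟩
  · have := List.length_eq_length_filter_add (l := c) (fun x => decide (d < x))
    simpa only [decide_not] using this

/-- A chain is split at the origin: the left part has bounded length, the right part at most `K *
(√z + 2)`, and `B` has eventually more than `(K + 1) * √z` points. -/
theorem dominates (hω : GoodPoints ω) {B : Set ℝ} (hB : ∀ a b : ℝ, (B ∩ Icc a b).Finite)
    (hg : Tendsto (fun s : ℝ => ((B ∩ Icc 0 s).ncard : ℝ) ^ 2 / s) atTop atTop) (t : ℝ) :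
    Dominates B fun N => orderedPoints ω N t := by
  intro a L
  obtain ⟨K, _, hK⟩ := hω.exists_sqrt_bound t
  obtain ⟨K₀, hK₀⟩ := hω.exists_chain_bound t a 0
  have hsqrt := tendsto_atTop.1 Real.tendsto_sqrt_atTop (2 * K + K₀ - L)
  obtain ⟨Z, hZ⟩ := eventually_atTop.1 (((growth_iff (isHeight_height hB)).1 hg (K + 1)).and hsqrt)
  refine ⟨Z, fun N z hz c hcl hc => ?_⟩
  obtain ⟨h1, h2⟩ := hZ z hz
  obtain ⟨hc1, hc2, hlen⟩ := isChain_filter (d := 0) hc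
  have h3 := hK N z _ (List.filter_sublist.trans hcl) hc1
  have h4 := hK₀ N _ (List.filter_sublist.trans hcl) hc2
  have h5 : (c.length : ℝ) ≤ K * (√z + 2) + K₀ := by
    rw [hlen]
    push_cast
    have : ((c.filter fun x => ¬ (0 : ℝ) < x).length : ℝ) ≤ K₀ := by exact_mod_cast h4
    linarith
  have h6 : (height B z : ℝ) + c.length ≤ L := by nlinarith
  exact_mod_cast h6

theorem locConst (hω : GoodPoints ω) (t : ℝ) : LocConst fun N => orderedPoints ω N t := by
  classical
  intro a b
  obtain ⟨N₀, hN₀⟩ := exists_nat_ge (max |a| |b|)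
  refine ⟨N₀, fun N hN => ?_⟩
  dsimp only
  rw [← orderedPoints_filter hω.finite hN, List.filter_filter]
  refine List.filter_congr fun x _ => ?_
  by_cases hx : a < x ∧ x ≤ b
  · have : |x| ≤ (N₀ : ℝ) := by
      rw [abs_le]
      have h1 := (le_max_left |a| |b|).trans hN₀
      have h2 := (le_max_right |a| |b|).trans hN₀
      constructor
      · linarith [neg_abs_le a]
      · linarith [le_abs_self b]
    simp [hx, this]
  · simp [hx]

/-- The new height at `s` is `h z + |c|` for some `z ≥ s`, and the chain costs at most `K * (√z +
2)`; the growth of `B` at rate `|R| + K + 1` pays for this and leaves `R * √s`. -/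
theorem growth_limSet (hω : GoodPoints ω) {B : Set ℝ} {t : ℝ} {g : ℝ → ℤ}
    (hB : ∀ a b : ℝ, (B ∩ Icc a b).Finite) (hl : LeftUnbounded B)
    (hg : Tendsto (fun s : ℝ => ((B ∩ Icc 0 s).ncard : ℝ) ^ 2 / s) atTop atTop)
    (hlim : LocLim (fun N => hops (height B) (orderedPoints ω N t)) g) :
    Tendsto (fun s : ℝ =>
      (((limSet fun N => shifts B (orderedPoints ω N t)) ∩ Icc 0 s).ncard : ℝ) ^ 2 / s)
      atTop atTop := by
  have hBh := isHeight_height hB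
  rw [growth_iff (hlim.isHeight fun N => hBh.shifts hl _)]
  intro R
  obtain ⟨K, hK0, hK⟩ := hω.exists_sqrt_bound t
  have hsqrt := tendsto_atTop.1 Real.tendsto_sqrt_atTop (2 * K)
  obtain ⟨Z, hZ⟩ := eventually_atTop.1 (((growth_iff hBh).1 hg (|R| + K + 1)).and hsqrt)
  filter_upwards [eventually_ge_atTop Z, eventually_ge_atTop 0] with s hs hs0
  obtain ⟨N, hN⟩ := (hlim s s).exists
  obtain ⟨z, hz, c, hcl, hc, he⟩ := exists_chain_hops (height B) (orderedPoints ω N t) s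
  have hN' := hN s ⟨le_rfl, le_rfl⟩
  dsimp only at hN'
  rw [← hN', he]
  obtain ⟨h1, h2⟩ := hZ z (hs.trans hz)
  have h3 := hK N z c hcl (hc.mono hs0 le_rfl)
  have h4 : √s ≤ √z := Real.sqrt_le_sqrt hz
  have h5 : R * √s ≤ |R| * √z :=
    mul_le_mul (le_abs_self R) h4 (Real.sqrt_nonneg _) (abs_nonneg _)
  push_cast
  nlinarith

end GoodPoints

/-! ### Excess of one line over another -/

/-- Comparison of increments is inclusion of the particle sets, so the first part is attractiveness.
The second says that the sparser line gains more height, so that the excess `f - g` can only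
decrease in time. -/
theorem hop_sub_le {f g : ℝ → ℤ} (hf : Antitone f) (hg : Antitone g)
    (h : ∀ s r, s ≤ r → g s - g r ≤ f s - f r) (x : ℝ) :
    (∀ s r, s ≤ r → hop g x s - hop g x r ≤ hop f x s - hop f x r) ∧
      ∀ y, hop f x y - f y ≤ hop g x y - g y := by
  refine ⟨fun s r hsr => ?_, fun y => ?_⟩
  · have h1 := h s r hsr
    have h2 := hf hsr
    have h3 := hg hsr
    simp only [hop]
    split_ifs with h4 h5 h5
    · have h6 := h r x h5.le
      have h7 := h s x h4.le
      have h8 := hf h5.le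
      have h9 := hg h5.le
      omega
    · have h6 := h s x h4.le
      have h7 := h x r (not_lt.1 h5)
      have h8 := hf h4.le
      have h9 := hg h4.le
      omega
    · exact absurd (hsr.trans_lt h5) h4
    · exact h1
  · simp only [hop]
    split_ifs with h4
    · have := h y x h4.le
      omega
    · omega

theorem hops_sub_le {f g : ℝ → ℤ} (hf : Antitone f) (hg : Antitone g)
    (h : ∀ s r, s ≤ r → g s - g r ≤ f s - f r) (l : List ℝ) :
    (∀ s r, s ≤ r → hops g l s - hops g l r ≤ hops f l s - hops f l r) ∧
      ∀ y, hops f l y - f y ≤ hops g l y - g y := by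
  induction l using List.reverseRecOn with
  | nil => exact ⟨h, fun y => by simp⟩
  | append_singleton l x ih =>
    rw [hops_concat, hops_concat]
    obtain ⟨h1, h2⟩ := hop_sub_le (antitone_hops hf l) (antitone_hops hg l) ih.1 x
    refine ⟨h1, fun y => ?_⟩
    have := h2 y
    have := ih.2 y
    omega

namespace GoodPoints

variable {ω : Set (ℝ × ℝ)}

theorem exists_chain_left (hω : GoodPoints ω) (T m : ℕ) : ∃ r₀ : ℝ, ∀ r ≤ r₀, ∃ N₀ : ℕ, ∀ N ≥ N₀,
    ∀ c : List ℝ, c.Sublist (orderedPoints ω N T) → IsChain r 0 c →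
      ∃ c' : List ℝ, c'.Sublist (orderedPoints ω N T) ∧ IsChain r (-m) c' ∧
        c.length ≤ c'.length := by
  induction m with
  | zero => exact ⟨0, fun r _ => ⟨0, fun N _ c hcl hc => ⟨c, hcl, by simpa using hc, le_rfl⟩⟩⟩
  | succ m ih =>
    obtain ⟨r₀, hr₀⟩ := ih
    obtain ⟨r₁, hr₁⟩ := hω.chain_left T (-(m + 1 : ℕ))
    refine ⟨min r₀ r₁, fun r hr => ?_⟩
    obtain ⟨N₀, hN₀⟩ := hr₀ r (hr.trans (min_le_left _ _))
    obtain ⟨N₁, hN₁⟩ := hr₁ r (hr.trans (min_le_right _ _))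
    refine ⟨max N₀ N₁, fun N hN c hcl hc => ?_⟩
    obtain ⟨c', hcl', hc', h1⟩ := hN₀ N ((le_max_left _ _).trans hN) c hcl hc
    obtain ⟨c'', hcl'', hc'', h2⟩ := hN₁ N ((le_max_right _ _).trans hN) c' hcl' (by
      refine hc'.mono le_rfl ?_
      push_cast
      linarith)
    exact ⟨c'', hcl'', by simpa using hc'', h1.trans h2⟩

/-- The excess of a line `F` over a line `G` does not escape to `-∞`. -/
theorem excess_hops (hω : GoodPoints ω) {F G : Set ℝ} (hF : ∀ a b : ℝ, (F ∩ Icc a b).Finite)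
    (hl : LeftUnbounded G) (hGF : G ⊆ F) (T : ℕ)
    (hD : Dominates G fun N => orderedPoints ω N T) (hE : LeftExcess F G) (W : ℤ) :
    ∃ r₀ : ℝ, ∀ r ≤ r₀, ∃ N₀ : ℕ, ∀ N ≥ N₀,
      W ≤ hops (height F) (orderedPoints ω N T) r - hops (height G) (orderedPoints ω N T) r := by
  have hG : ∀ a b : ℝ, (G ∩ Icc a b).Finite := fun a b =>
    (hF a b).subset (inter_subset_inter_left _ hGF)
  have hF' := isHeight_height hF
  have hG' := isHeight_height hG
  -- chains to the right of the origin
  obtain ⟨K, hK⟩ : ∃ K : ℤ, ∀ (N : ℕ) (z : ℝ) (c : List ℝ), 0 ≤ z →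
      c.Sublist (orderedPoints ω N T) → IsChain 0 z c → height G z + c.length ≤ K := by
    obtain ⟨Z, hZ⟩ := hD 0 0
    obtain ⟨K, hK⟩ := hω.exists_chain_bound T 0 Z
    refine ⟨max 0 (height G 0 + K), fun N z c hz hcl hc => ?_⟩
    rcases le_total Z z with h | h
    · exact le_max_of_le_left (hZ N z h c hcl hc)
    · have h1 := hK N c hcl (hc.mono le_rfl h)
      have h2 := hG'.antitone hz
      refine le_max_of_le_right ?_
      omega
  obtain ⟨y₁, hy₁⟩ := hG'.leftUnbounded_iff.1 hl K
  obtain ⟨y₂, hy₂⟩ := hE W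
  obtain ⟨m, hm⟩ := exists_nat_ge (max (-y₁) (-y₂))
  have hm1 : -(m : ℝ) ≤ y₁ := by linarith [le_max_left (-y₁) (-y₂)]
  have hm2 : -(m : ℝ) ≤ y₂ := by linarith [le_max_right (-y₁) (-y₂)]
  obtain ⟨r₀, hr₀⟩ := hω.exists_chain_left T m
  refine ⟨min r₀ (-m), fun r hr => ?_⟩
  have hrm : r ≤ -m := hr.trans (min_le_right _ _)
  obtain ⟨N₀, hN₀⟩ := hr₀ r (hr.trans (min_le_left _ _))
  refine ⟨N₀, fun N hN => ?_⟩
  obtain ⟨z, hz, c, hcl, hc, he⟩ := exists_chain_hops (height G) (orderedPoints ω N T) r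
  rw [he]
  -- If the optimal chain for `G` ends left of `-m`, the same chain serves `F`, which is higher by
  -- `W` at its end. Otherwise its part left of the origin is replaced by a chain ending at `-m`,
  -- where `G` is at least `K` and `F` at least `K + W`; this outweighs the part right of the
  -- origin.
  rcases le_or_gt z (-m) with hzm | hzm
  · have h1 := add_length_le_hops hF'.antitone hcl hc hz
    have h2 := hy₂ z (hzm.trans hm2)
    omega
  · have h2 := hy₂ _ hm2
    have h3 := hy₁ _ hm1
    obtain ⟨hc1, hc2, hlen⟩ := isChain_filter (d := 0) hc
    obtain ⟨c', hcl', hc', h4⟩ := hN₀ N hN _ (List.filter_sublist.trans hcl) hc2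
    have h5 := add_length_le_hops hF'.antitone hcl' hc' hrm
    rcases le_total 0 z with h0 | h0
    · have h6 := hK N z _ h0 (List.filter_sublist.trans hcl) hc1
      omega
    · have h6 : c.filter (fun x => decide ((0 : ℝ) < x)) = [] := by
        rw [List.filter_eq_nil_iff]
        intro x hx
        simpa using (hc.2 x hx).2.trans h0
      rw [h6] at hlen
      have h7 := hG'.antitone hzm.le
      simp only [List.length_nil] at hlen
      omega

/-- The excess decreases in time, so its value at `⌈t⌉₊` bounds it from below at time `t`. This is
why almost sure statements at integer times suffice for all `t` simultaneously. -/
theorem keepsExcess (hω : GoodPoints ω) (t : ℝ) :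
    KeepsExcess (fun N => orderedPoints ω N t) fun N => orderedPoints ω N (⌈t⌉₊ : ℕ) := by
  intro F G hF hl hGF hD hDT hE
  have hG : ∀ a b : ℝ, (G ∩ Icc a b).Finite := fun a b =>
    (hF a b).subset (inter_subset_inter_left _ hGF)
  have hF' := isHeight_height hF
  have hG' := isHeight_height hG
  have hlF : LeftUnbounded F := fun x => by
    obtain ⟨y, hy, hyx⟩ := hl x
    exact ⟨y, hGF hy, hyx⟩
  have hDF : Dominates F fun N => orderedPoints ω N t := by
    intro a K
    obtain ⟨Z, hZ⟩ := hD a (K + height G 0 - height F 0)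
    refine ⟨max Z 0, fun N z hz c hcl hc => ?_⟩
    have h1 := hZ N z ((le_max_left _ _).trans hz) c hcl hc
    have h2 := hF'.sub_le_sub_of_subset hG' hGF ((le_max_right _ _).trans hz)
    omega
  obtain ⟨f, hf⟩ := exists_locLim (Ls := []) ⟨hF, hlF⟩ hDF (hω.locConst t)
  obtain ⟨g, hg⟩ := exists_locLim (Ls := []) ⟨hG, hl⟩ hD (hω.locConst t)
  have hfX := hf.isHeight fun N => hF'.shifts hlF _
  have hgX := hg.isHeight fun N => hG'.shifts hl _
  simp only [dual] at hf hg hfX hgX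
  have hsub := fun s r h => hF'.sub_le_sub_of_subset hG' hGF (s := s) (r := r) h
  have hmono : ∀ s r, s ≤ r → g s - g r ≤ f s - f r := by
    intro s r hsr
    obtain ⟨N, h1, h2⟩ := ((hf s r).and (hg s r)).exists
    rw [← h1 s ⟨le_rfl, hsr⟩, ← h1 r ⟨hsr, le_rfl⟩, ← h2 s ⟨le_rfl, hsr⟩, ← h2 r ⟨hsr, le_rfl⟩]
    exact (hops_sub_le hF'.antitone hG'.antitone hsub _).1 s r hsr
  have hexc : ∀ W : ℤ, ∃ r₀ : ℝ, ∀ r ≤ r₀, W ≤ f r - g r := by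
    intro W
    obtain ⟨r₀, hr₀⟩ := hω.excess_hops hF hl hGF ⌈t⌉₊ hDT hE W
    refine ⟨r₀, fun r hr => ?_⟩
    obtain ⟨N₀, hN₀⟩ := hr₀ r hr
    obtain ⟨N, h1, h2, h3⟩ := ((hf r r).and ((hg r r).and (eventually_ge_atTop N₀))).exists
    rw [← h1 r ⟨le_rfl, le_rfl⟩, ← h2 r ⟨le_rfl, le_rfl⟩]
    have h4 := hN₀ N h3
    obtain ⟨l', hl'⟩ := orderedPoints_prefix hω.finite N (Nat.le_ceil t)
    have h5 : ∀ h : ℝ → ℤ, hops h (orderedPoints ω N (⌈t⌉₊ : ℕ))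
        = hops (hops h (orderedPoints ω N t)) l' := fun h => by
      rw [hl', hops, List.foldl_append]
      rfl
    rw [h5, h5] at h4
    have h6 := (hops_sub_le (antitone_hops hF'.antitone _) (antitone_hops hG'.antitone _)
      (hops_sub_le hF'.antitone hG'.antitone hsub (orderedPoints ω N t)).1 l').2 r
    dsimp only
    omega
  intro x
  by_contra hcon
  push Not at hcon
  have hGX := hfX.subset_of_sub_le_sub hgX hmono
  -- If the limits agreed left of `x`, their height difference would be constant there, against its
  -- divergence.
  obtain ⟨r₀, hr₀⟩ := hexc (f (x - 1) - g (x - 1) + 1)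
  have hle : min r₀ (x - 1) ≤ x - 1 := min_le_right _ _
  have h1 := hr₀ _ (min_le_left r₀ (x - 1))
  have h2 := hfX.sub_eq _ _ hle
  have h3 := hgX.sub_eq _ _ hle
  have h4 : (limSet fun N => shifts F (orderedPoints ω N t)) ∩ Ioc (min r₀ (x - 1)) (x - 1)
      = (limSet fun N => shifts G (orderedPoints ω N t)) ∩ Ioc (min r₀ (x - 1)) (x - 1) := by
    apply Subset.antisymm
    · rintro y ⟨hy, hy2⟩
      refine ⟨?_, hy2⟩
      by_contra hyn
      linarith [hcon y ⟨hy, hyn⟩, hy2.2]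
    · exact inter_subset_inter_left _ hGX
  rw [h4] at h2
  omega

end GoodPoints

variable {n : ℕ}

/-! ### The dynamics driven by good points -/

theorem drop_induction (α : Fin n → Set ℝ) {P : List (Set ℝ) → Prop} (h0 : P [])
    (hs : ∀ k : Fin n, P ((List.ofFn α).drop (k + 1)) → P (α k :: (List.ofFn α).drop (k + 1)))
    (m : ℕ) : P ((List.ofFn α).drop m) := by
  induction hd : n - m generalizing m with
  | zero =>
    rw [List.drop_eq_nil_of_le (by simp; omega)]
    exact h0
  | succ d ih =>
    have hm : m < n := by omega
    have := hs ⟨m, hm⟩ (ih (m + 1) (by omega))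
    rwa [← drop_ofFn α ⟨m, hm⟩] at this

theorem CWellDefined.admissible {α : Fin n → Set ℝ} (hα : CWellDefined α) {l : ℕ → List ℝ}
    (hD : ∀ k, Dominates (C α k) l) (m : ℕ) : Admissible l ((List.ofFn α).drop m) := by
  refine drop_induction α trivial (fun k h => ⟨hα.stableTandem k, ?_, h⟩) m
  rw [← C_eq]
  exact hD k

theorem drop_ofFn_evolveLim (α : Fin n → Set ℝ) (l : ℕ → List ℝ) (m : ℕ) :
    (List.ofFn fun k : Fin n => limSet fun N =>
      shifts (α k) (dual ((List.ofFn α).drop (k + 1)) (l N))).drop m =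
      evolveLim l ((List.ofFn α).drop m) := by
  induction hd : n - m generalizing m with
  | zero =>
    rw [List.drop_eq_nil_of_le (by simp; omega), List.drop_eq_nil_of_le (by simp; omega)]
    rfl
  | succ d ih =>
    have hm : m < n := by omega
    have h1 := drop_ofFn (fun k : Fin n => limSet fun N =>
      shifts (α k) (dual ((List.ofFn α).drop (k + 1)) (l N))) ⟨m, hm⟩
    have h2 := drop_ofFn α ⟨m, hm⟩
    dsimp only at h1 h2
    rw [h1, ih (m + 1) (by omega)]
    conv_rhs => rw [h2]
    rfl

theorem C_subset {α : Fin n → Set ℝ} (hα : CWellDefined α) {j k : Fin n} (hjk : j ≤ k) :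
    C α j ⊆ C α k := by
  have key : ∀ (Ls : List (Set ℝ)) (A B : Set ℝ), StableTandem A Ls → B ⊆ A →
      Ls.foldl departures B ⊆ Ls.foldl departures A := by
    intro Ls
    induction Ls with
    | nil => exact fun A B _ h => h
    | cons S Ls ih => exact fun A B hA h => ih _ _ hA.2.2.2.2 (departures_mono hA.1 hA.2.1 h)
  induction hd : (k : ℕ) - j generalizing j with
  | zero =>
    have : j = k := le_antisymm hjk (Fin.le_def.2 (by omega))
    rw [this]
  | succ d ih =>
    have hj : (j : ℕ) + 1 < n := by
      have := k.2
      omega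
    have h1 : C α j ⊆ C α ⟨j + 1, hj⟩ := by
      rw [C_eq, C_eq]
      have h2 := drop_ofFn α ⟨j + 1, hj⟩
      dsimp only at h2
      rw [h2]
      exact key _ _ _ (hα.stableTandem ⟨j + 1, hj⟩) sdiff_subset
    exact h1.trans (ih (Fin.le_def.2 (by dsimp only; omega)) (by dsimp only; omega))

theorem Rinv_R {η : Fin n → Set ℝ} (hη : ∀ j k, j ≤ k → η j ⊆ η k) : Rinv (R η) = η := by
  funext k
  ext y
  simp only [Rinv, R, mem_iUnion, exists_prop]
  constructor
  · rintro ⟨j, hjk, hy, _⟩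
    exact hη j k hjk hy
  · intro hy
    obtain ⟨j, hj, hmin⟩ := (Set.toFinite {j : Fin n | y ∈ η j}).exists_minimal ⟨k, hy⟩
    have hjk : j ≤ k := by
      rcases le_total j k with h | h
      · exact h
      · exact hmin hy h
    refine ⟨j, hjk, hj, ?_⟩
    simp only [mem_iUnion, exists_prop, not_exists, not_and]
    intro i hi hyi
    have hij : i ≤ j := Fin.le_def.2 (by omega)
    have h1 : (j : ℕ) ≤ i := Fin.le_def.1 (hmin hyi hij)
    omega

theorem H_C_eq {α : Fin n → Set ℝ} (hα : CWellDefined α) (x : ℝ) : H (C α) x = C (J α x) :=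
  (C_foldl_J hα [x]).symm

theorem GoodPoints.intertwining {ω : Set (ℝ × ℝ)} (hω : GoodPoints ω) {α : Fin n → Set ℝ}
    (hα : CWellDefined α) (t : ℝ) :
    ProcessExists J t α ω ∧ ProcessExists H t (C α) ω ∧ CWellDefined (Ψ t α ω) ∧
      C (Ψ t α ω) = Φ t (C α) ω ∧ M (Ψ t α ω) = Υ t (M α) ω := by
  set l : ℕ → List ℝ := fun N => orderedPoints ω N t with hl
  set l' : ℕ → List ℝ := fun N => orderedPoints ω N (⌈t⌉₊ : ℕ) with hl'
  have hloc : LocConst l := hω.locConst t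
  have hD : ∀ k, Dominates (C α k) l := fun k =>
    hω.dominates (hα.image_config k).locallyFinite (hα.image_config k).growth t
  have hD' : ∀ k, Dominates (C α k) l' := fun k =>
    hω.dominates (hα.image_config k).locallyFinite (hα.image_config k).growth _
  have hΨ : Ψ t α ω = fun k => limSet fun N =>
      shifts (α k) (dual ((List.ofFn α).drop (k + 1)) (l N)) := by
    funext k
    change limSet (fun N => (l N).foldl J α k) = _
    simp only [foldl_J]
  have hΦ : Φ t (C α) ω = fun k => limSet fun N => shifts (C α k) (l N) := by
    funext k
    change limSet (fun N => (l N).foldl H (C α) k) = _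
    simp only [foldl_H]
  have hlimJ : ∀ k : Fin n, ∃ g, LocLim
      (fun N => hops (height (α k)) (dual ((List.ofFn α).drop (k + 1)) (l N))) g := fun k =>
    exists_locLim (hα.stableTandem k) (by rw [← C_eq]; exact hD k)
      ((hα.admissible hD (k + 1)).locConst_dual hloc)
  have hlimH : ∀ k : Fin n, ∃ g, LocLim (fun N => hops (height (C α k)) (l N)) g := fun k =>
    exists_locLim (Ls := []) ⟨(hα.image_config k).locallyFinite, (hα.image_config k).left_unbounded⟩
      (hD k) hloc
  have htan : ∀ k : Fin n, _ := fun k =>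
    (hα.admissible hD (k + 1)).stableTandem_limSet (hα.admissible hD' (k + 1)) hloc
      (hω.keepsExcess t) (hα.stableTandem k) (by rw [← C_eq]; exact hD k)
      (by rw [← C_eq]; exact hD' k)
  have hC : C (Ψ t α ω) = Φ t (C α) ω := by
    funext k
    rw [C_eq, hΨ, drop_ofFn_evolveLim, (htan k).2, hΦ]
    dsimp only
    rw [C_eq]
  have hst : ∀ k : Fin n, StableTandem (Ψ t α ω k) ((List.ofFn (Ψ t α ω)).drop (k + 1)) := by
    intro k
    rw [hΨ, drop_ofFn_evolveLim]
    exact (htan k).1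
  have hconf : ∀ k, IsConfig (C (Ψ t α ω) k) := by
    intro k
    obtain ⟨g, hg⟩ := hlimH k
    have hc := hα.image_config k
    have hh := isHeight_height hc.locallyFinite
    rw [hC, hΦ]
    exact ⟨(hg.isHeight fun N => hh.shifts hc.left_unbounded _).finite,
      leftUnbounded_limSet hh hc.left_unbounded hg,
      hω.growth_limSet hc.locallyFinite hc.left_unbounded hc.growth hg⟩
  refine ⟨fun k L => ?_, fun k L => ?_, ?_, hC, ?_⟩
  · obtain ⟨g, hg⟩ := hlimJ k
    have := hg.eventually_inter (fun N => (isHeight_height (hα.config k).locallyFinite).shifts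
      (hα.config k).left_unbounded _) (-L) L
    change ∀ᶠ N in atTop, (l N).foldl J α k ∩ _ = Ψ t α ω k ∩ _
    rw [hΨ]
    simpa only [foldl_J] using this
  · obtain ⟨g, hg⟩ := hlimH k
    have := hg.eventually_inter (fun N => (isHeight_height
      (hα.image_config k).locallyFinite).shifts (hα.image_config k).left_unbounded _) (-L) L
    change ∀ᶠ N in atTop, (l N).foldl H (C α) k ∩ _ = Φ t (C α) ω k ∩ _
    rw [hΦ]
    simpa only [foldl_H] using this
  · refine cWellDefined_of_stableTandem (fun k => ?_) hconf hst
    -- The lines of the limit inherit all their properties from the last departures, that is, from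
    -- the lines of `C`.
    have hg := (hconf k).growth
    rw [C_eq] at hg
    exact ⟨(hst k).finite, (hst k).leftUnbounded, (hst k).growth hg⟩
  · rw [M, hC, Υ, M, Rinv_R fun j k hjk => C_subset hα hjk]

/-! ### The longest chain in a box -/

/-- The largest number of points in a chain of points of `W` in the box `(a, b] × (0, t]`. -/
def chainLen (W : Set (ℝ × ℝ)) (t a b : ℝ) : ℕ :=
  sSup {k | ∃ p, IsPointChain (W ∩ Ioc a b ×ˢ Ioc 0 t) p ∧ p.length = k}

theorem IsPointChain.nodup {W : Set (ℝ × ℝ)} {p : List (ℝ × ℝ)} (hp : IsPointChain W p) :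
    p.Nodup :=
  hp.1.imp fun {_ _} h he => absurd (he ▸ h.1) (lt_irrefl _)

theorem IsPointChain.length_le {W : Set (ℝ × ℝ)} {p : List (ℝ × ℝ)} (hp : IsPointChain W p)
    (hW : W.Finite) : p.length ≤ W.ncard := by
  classical
  rw [← List.toFinset_card_of_nodup hp.nodup, ← ncard_coe_finset]
  exact ncard_le_ncard (fun x hx => hp.2 x (by simpa using hx)) hW

theorem le_chainLen_iff {W : Set (ℝ × ℝ)} {t a b : ℝ} (hW : (W ∩ Ioc a b ×ˢ Ioc 0 t).Finite)
    {k : ℕ} : k ≤ chainLen W t a b ↔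
      ∃ p, IsPointChain (W ∩ Ioc a b ×ˢ Ioc 0 t) p ∧ p.length = k := by
  have hbdd : BddAbove {k | ∃ p, IsPointChain (W ∩ Ioc a b ×ˢ Ioc 0 t) p ∧ p.length = k} := by
    refine ⟨(W ∩ Ioc a b ×ˢ Ioc 0 t).ncard, ?_⟩
    rintro k ⟨p, hp, rfl⟩
    exact hp.length_le hW
  constructor
  · intro hk
    have hne : {k | ∃ p, IsPointChain (W ∩ Ioc a b ×ˢ Ioc 0 t) p ∧ p.length = k}.Nonempty :=
      ⟨0, [], ⟨List.Pairwise.nil, by simp⟩, rfl⟩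
    obtain ⟨p, hp, hl⟩ := Nat.sSup_mem hne hbdd
    refine ⟨p.take k, ⟨hp.1.sublist (List.take_sublist _ _),
      fun q hq => hp.2 q (List.mem_of_mem_take hq)⟩, ?_⟩
    rw [List.length_take, hl]
    exact min_eq_left hk
  · exact fun h => le_csSup hbdd h

theorem chainLen_mono {W : Set (ℝ × ℝ)} {t a b a' b' : ℝ} (hW : (W ∩ Ioc a b ×ˢ Ioc 0 t).Finite)
    (ha : a ≤ a') (hb : b' ≤ b) : chainLen W t a' b' ≤ chainLen W t a b := by
  have hsub : W ∩ Ioc a' b' ×ˢ Ioc 0 t ⊆ W ∩ Ioc a b ×ˢ Ioc 0 t :=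
    inter_subset_inter_right _ (prod_mono (Ioc_subset_Ioc ha hb) Subset.rfl)
  obtain ⟨p, hp, hl⟩ := (le_chainLen_iff (hW.subset hsub)).1 le_rfl
  exact (le_chainLen_iff hW).2 ⟨p, ⟨hp.1, fun q hq => hsub (hp.2 q hq)⟩, hl⟩

/-! ### Chains seen through counts in dyadic cells -/

/-- The points have chains separated by the dyadic grid of mesh `2⁻ᵐ`. -/
def GridChain (m : ℕ) (W : Set (ℝ × ℝ)) (k : ℕ) : Prop :=
  ∃ p : List (ℝ × ℝ), p.Pairwise (fun p q => ⌈p.2 * 2 ^ m⌉ < ⌈q.2 * 2 ^ m⌉ ∧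
    ⌈q.1 * 2 ^ m⌉ < ⌈p.1 * 2 ^ m⌉) ∧ (∀ q ∈ p, q ∈ W) ∧ p.length = k

theorem ceil_mul_two_lt {x y : ℝ} (h : ⌈x⌉ < ⌈y⌉) : ⌈x * 2⌉ < ⌈y * 2⌉ := by
  have h1 : ((⌈x⌉ : ℤ) : ℝ) < y := Int.lt_ceil.1 h
  have h2 : ⌈x * 2⌉ ≤ ⌈x⌉ * 2 := Int.ceil_le.2 (by push_cast; linarith [Int.le_ceil x])
  exact h2.trans_lt (Int.lt_ceil.2 (by push_cast; linarith))

theorem gridChain_monotone (W : Set (ℝ × ℝ)) (k : ℕ) : Monotone fun m => GridChain m W k := by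
  refine monotone_nat_of_le_succ fun m => ?_
  rintro ⟨p, h1, h2, h3⟩
  refine ⟨p, h1.imp fun {p q} h => ?_, h2, h3⟩
  simp only [pow_succ, ← mul_assoc]
  exact ⟨ceil_mul_two_lt h.1, ceil_mul_two_lt h.2⟩

theorem eventually_ceil_lt {x y : ℝ} (h : x < y) : ∀ᶠ m : ℕ in atTop, ⌈x * 2 ^ m⌉ < ⌈y * 2 ^ m⌉ := by
  have h1 : Tendsto (fun m : ℕ => (y - x) * (2 : ℝ) ^ m) atTop atTop :=
    (tendsto_pow_atTop_atTop_of_one_lt one_lt_two).const_mul_atTop (sub_pos.2 h)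
  filter_upwards [h1.eventually_ge_atTop 1] with m hm
  rw [Int.lt_ceil]
  linarith [Int.ceil_lt_add_one (x * 2 ^ m)]

/-- A fine enough grid separates the finitely many coordinates of a chain. Existence of a chain
becomes an increasing union of events, each of which, in a box, depends on finitely many cell
counts. -/
theorem exists_pointChain_iff (W : Set (ℝ × ℝ)) (k : ℕ) :
    (∃ p, IsPointChain W p ∧ p.length = k) ↔ ∃ m, GridChain m W k := by
  constructor
  · rintro ⟨p, hp, rfl⟩
    suffices h : ∀ᶠ m : ℕ in atTop, p.Pairwise (fun p q => ⌈p.2 * 2 ^ m⌉ < ⌈q.2 * 2 ^ m⌉ ∧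
        ⌈q.1 * 2 ^ m⌉ < ⌈p.1 * 2 ^ m⌉) by
      obtain ⟨m, hm⟩ := h.exists
      exact ⟨m, p, hm, hp.2, rfl⟩
    have h1 := hp.1
    clear hp
    induction p with
    | nil => simp
    | cons a p ih =>
      rw [List.pairwise_cons] at h1
      simp only [List.pairwise_cons]
      refine Filter.Eventually.and ?_ (ih h1.2)
      exact (List.finite_toSet p).eventually_all.2 fun q hq =>
        (eventually_ceil_lt (h1.1 q hq).1).and (eventually_ceil_lt (h1.1 q hq).2)
  · rintro ⟨m, p, h1, h2, h3⟩
    have key : ∀ {x y : ℝ}, ⌈x * 2 ^ m⌉ < ⌈y * 2 ^ m⌉ → x < y := by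
      intro x y h
      by_contra hxy
      exact absurd h (not_lt.2 (Int.ceil_mono
        (mul_le_mul_of_nonneg_right (not_lt.1 hxy) (by positivity))))
    exact ⟨p, ⟨h1.imp fun {_ _} h => ⟨key h.1, key h.2⟩, h2⟩, h3⟩

/-- The part of the box `(a, b] × (0, t]` in the dyadic cell of mesh `2⁻ᵐ` with index `c`. -/
def gridCell (m : ℕ) (t a b : ℝ) (c : ℤ × ℤ) : Set (ℝ × ℝ) :=
  {p ∈ Ioc a b ×ˢ Ioc 0 t | (⌈p.1 * 2 ^ m⌉, ⌈p.2 * 2 ^ m⌉) = c}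

/-- The indices of the dyadic cells meeting the box `(a, b] × (0, t]`. -/
def gridIndex (m : ℕ) (t a b : ℝ) : Finset (ℤ × ℤ) :=
  Finset.Icc ⌈a * 2 ^ m⌉ ⌈b * 2 ^ m⌉ ×ˢ Finset.Icc 0 ⌈t * 2 ^ m⌉

theorem measurableSet_gridCell (m : ℕ) (t a b : ℝ) (c : ℤ × ℤ) :
    MeasurableSet (gridCell m t a b c) := by
  have h : Measurable fun p : ℝ × ℝ => (⌈p.1 * 2 ^ m⌉, ⌈p.2 * 2 ^ m⌉) :=
    (Int.measurable_ceil.comp (measurable_fst.mul_const _)).prodMk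
      (Int.measurable_ceil.comp (measurable_snd.mul_const _))
  exact (measurableSet_Ioc.prod measurableSet_Ioc).inter (h (measurableSet_singleton c))

theorem isBounded_box (t a b : ℝ) : Bornology.IsBounded (Ioc a b ×ˢ Ioc 0 t) :=
  (Metric.isBounded_Ioc a b).prod (Metric.isBounded_Ioc 0 t)

theorem isBounded_gridCell (m : ℕ) (t a b : ℝ) (c : ℤ × ℤ) :
    Bornology.IsBounded (gridCell m t a b c) :=
  (isBounded_box t a b).subset (sep_subset _ _)

theorem mem_gridIndex {m : ℕ} {t a b : ℝ} {p : ℝ × ℝ} (hp : p ∈ Ioc a b ×ˢ Ioc 0 t) :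
    (⌈p.1 * 2 ^ m⌉, ⌈p.2 * 2 ^ m⌉) ∈ gridIndex m t a b := by
  have h2 : (0 : ℝ) ≤ 2 ^ m := by positivity
  simp only [gridIndex, Finset.mem_product, Finset.mem_Icc]
  exact ⟨⟨Int.ceil_mono (mul_le_mul_of_nonneg_right hp.1.1.le h2),
    Int.ceil_mono (mul_le_mul_of_nonneg_right hp.1.2 h2)⟩,
    Int.ceil_nonneg (mul_nonneg hp.2.1.le h2),
    Int.ceil_mono (mul_le_mul_of_nonneg_right hp.2.2 h2)⟩

theorem exists_map_eq {α β : Type*} (f : α → β) (W : Set α) (q : List β)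
    (h : ∀ c ∈ q, ∃ x ∈ W, f x = c) : ∃ p : List α, p.map f = q ∧ ∀ x ∈ p, x ∈ W := by
  induction q with
  | nil => exact ⟨[], rfl, by simp⟩
  | cons c q ih =>
    obtain ⟨p, h1, h2⟩ := ih fun d hd => h d (List.mem_cons_of_mem _ hd)
    obtain ⟨x, hx, hxc⟩ := h c List.mem_cons_self
    exact ⟨x :: p, by simp [h1, hxc], List.forall_mem_cons.2 ⟨hx, h2⟩⟩

/-- The occupation numbers of the dyadic cells for which there is a chain of `k` points separated
by the grid. -/
def gridEvent (m : ℕ) (t a b : ℝ) (k : ℕ) : Set (gridIndex m t a b → ℕ) :=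
  {N | ∃ q : List (ℤ × ℤ), q.Pairwise (fun c d => c.2 < d.2 ∧ d.1 < c.1) ∧
    (∀ c ∈ q, ∃ h : c ∈ gridIndex m t a b, N ⟨c, h⟩ ≠ 0) ∧ q.length = k}

theorem gridChain_iff {m : ℕ} {W : Set (ℝ × ℝ)} {t a b : ℝ}
    (hW : (W ∩ Ioc a b ×ˢ Ioc 0 t).Finite) (k : ℕ) :
    GridChain m (W ∩ Ioc a b ×ˢ Ioc 0 t) k ↔
      (fun c : gridIndex m t a b => (W ∩ gridCell m t a b c).ncard) ∈ gridEvent m t a b k := by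
  have hcell : ∀ c, W ∩ gridCell m t a b c ⊆ W ∩ Ioc a b ×ˢ Ioc 0 t := fun c =>
    inter_subset_inter_right _ (sep_subset _ _)
  constructor
  · rintro ⟨p, h1, h2, rfl⟩
    refine ⟨p.map fun p => (⌈p.1 * 2 ^ m⌉, ⌈p.2 * 2 ^ m⌉), ?_, ?_, by simp⟩
    · rw [List.pairwise_map]
      exact h1
    · intro c hc
      obtain ⟨x, hx, rfl⟩ := List.mem_map.1 hc
      refine ⟨mem_gridIndex (h2 x hx).2, ?_⟩
      exact ncard_ne_zero_of_mem (a := x) ⟨(h2 x hx).1, (h2 x hx).2, rfl⟩ (hW.subset (hcell _))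
  · rintro ⟨q, h1, h2, rfl⟩
    obtain ⟨p, rfl, hp⟩ := exists_map_eq (fun p : ℝ × ℝ => (⌈p.1 * 2 ^ m⌉, ⌈p.2 * 2 ^ m⌉))
      (W ∩ Ioc a b ×ˢ Ioc 0 t) q fun c hc => by
        obtain ⟨h, hN⟩ := h2 c hc
        obtain ⟨x, hx⟩ := nonempty_of_ncard_ne_zero hN
        exact ⟨x, hcell _ hx, hx.2.2⟩
    rw [List.pairwise_map] at h1
    exact ⟨p, h1, hp, by simp⟩

/-! ### Measurability, law and translation invariance of the longest chain -/

section Poisson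

variable {Ω : Type*} [MeasurableSpace Ω] {P : Measure Ω} {ω ω' : Ω → Set (ℝ × ℝ)}

theorem IsPoissonPoints.finite_box (hω : IsPoissonPoints P ω) (w : Ω) (t a b : ℝ) :
    (ω w ∩ Ioc a b ×ˢ Ioc 0 t).Finite :=
  hω.locallyFinite w _ (isBounded_box t a b)

theorem IsPoissonPoints.measurable_counts (hω : IsPoissonPoints P ω) {ι : Type*}
    {B : ι → Set (ℝ × ℝ)} (hm : ∀ i, MeasurableSet (B i))
    (hb : ∀ i, Bornology.IsBounded (B i)) : Measurable fun w i => (ω w ∩ B i).ncard :=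
  measurable_pi_lambda _ fun i => hω.measurable_count _ (hm i) (hb i)

theorem IsPoissonPoints.map_counts [IsProbabilityMeasure P] (hω : IsPoissonPoints P ω) {ι : Type*}
    [Fintype ι] {B : ι → Set (ℝ × ℝ)} (hm : ∀ i, MeasurableSet (B i))
    (hb : ∀ i, Bornology.IsBounded (B i)) (hd : Pairwise fun i j => Disjoint (B i) (B j))
    (hp : ∀ i, B i ⊆ {p | 0 ≤ p.2}) :
    P.map (fun w i => (ω w ∩ B i).ncard)
      = Measure.pi fun i => poissonMeasure (volume (B i)).toNNReal := by
  let e := Fintype.equivFin ι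
  have h1 := hω.indep_count _ (B ∘ e.symm) (fun i => hm _) (fun i => hb _)
    (hd.comp_of_injective e.symm.injective)
  have h2 : iIndepFun (fun i w => (ω w ∩ B i).ncard) P := by
    have := h1.precomp e.injective
    simpa [Function.comp_def] using this
  rw [(iIndepFun_iff_map_fun_eq_pi_map
    fun i => (hω.measurable_count _ (hm i) (hb i)).aemeasurable).1 h2]
  congr 1
  funext i
  exact hω.law_count _ (hm i) (hb i) (hp i)

theorem gridCell_subset (m : ℕ) (t a b : ℝ) (c : ℤ × ℤ) :
    gridCell m t a b c ⊆ {p | 0 ≤ p.2} := fun _ hp => hp.1.2.1.le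

theorem IsPoissonPoints.measurableSet_gridChain (hω : IsPoissonPoints P ω) (m : ℕ) (t a b : ℝ)
    (k : ℕ) : MeasurableSet {w | GridChain m (ω w ∩ Ioc a b ×ˢ Ioc 0 t) k} := by
  simp only [gridChain_iff (hω.finite_box _ t a b)]
  exact hω.measurable_counts (ι := gridIndex m t a b) (fun c => measurableSet_gridCell m t a b c)
    (fun c => isBounded_gridCell m t a b c) (to_countable (gridEvent m t a b k)).measurableSet

theorem IsPoissonPoints.measure_gridChain_eq [IsProbabilityMeasure P] (hω : IsPoissonPoints P ω)
    (hω' : IsPoissonPoints P ω') (m : ℕ) (t a b : ℝ) (k : ℕ) :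
    P {w | GridChain m (ω w ∩ Ioc a b ×ˢ Ioc 0 t) k}
      = P {w | GridChain m (ω' w ∩ Ioc a b ×ˢ Ioc 0 t) k} := by
  have key : ∀ {ω : Ω → Set (ℝ × ℝ)}, IsPoissonPoints P ω →
      P {w | GridChain m (ω w ∩ Ioc a b ×ˢ Ioc 0 t) k}
        = Measure.pi (fun c : gridIndex m t a b =>
          poissonMeasure (volume (gridCell m t a b c)).toNNReal) (gridEvent m t a b k) := by
    intro ω hω
    rw [← hω.map_counts (ι := gridIndex m t a b) (fun c => measurableSet_gridCell m t a b c)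
      (fun c => isBounded_gridCell m t a b c) ?_ fun c => gridCell_subset m t a b c,
      Measure.map_apply (hω.measurable_counts (ι := gridIndex m t a b)
      (fun c => measurableSet_gridCell m t a b c) fun c => isBounded_gridCell m t a b c) (to_countable _).measurableSet]
    · simp only [gridChain_iff (hω.finite_box _ t a b)]
      rfl
    · intro c d hcd
      refine Set.disjoint_left.2 fun p hp hp' => hcd (Subtype.ext ?_)
      exact hp.2.symm.trans hp'.2
  rw [key hω, key hω']

theorem IsPoissonPoints.setOf_le_chainLen (hω : IsPoissonPoints P ω) (t a b : ℝ) (k : ℕ) :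
    {w | k ≤ chainLen (ω w) t a b} = ⋃ m, {w | GridChain m (ω w ∩ Ioc a b ×ˢ Ioc 0 t) k} := by
  ext w
  simp only [mem_ofPred_eq, mem_iUnion]
  rw [le_chainLen_iff (hω.finite_box w t a b), exists_pointChain_iff]

theorem IsPoissonPoints.measurable_chainLen (hω : IsPoissonPoints P ω) (t a b : ℝ) :
    Measurable fun w => chainLen (ω w) t a b := by
  refine measurable_of_Ici fun k => ?_
  change MeasurableSet {w | k ≤ chainLen (ω w) t a b}
  rw [hω.setOf_le_chainLen]
  exact MeasurableSet.iUnion fun m => hω.measurableSet_gridChain m t a b k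

/-- Independent Poisson counts in the disjoint cells fix the probability of each grid event, and
refining the grid gives a monotone limit. This makes stationarity available, since translated points
satisfy the same axioms. -/
theorem IsPoissonPoints.map_chainLen_eq [IsProbabilityMeasure P] (hω : IsPoissonPoints P ω)
    (hω' : IsPoissonPoints P ω') (t a b : ℝ) :
    P.map (fun w => chainLen (ω w) t a b) = P.map (fun w => chainLen (ω' w) t a b) := by
  have := Measure.isProbabilityMeasure_map (μ := P) (hω.measurable_chainLen t a b).aemeasurable
  refine Measure.ext_of_Ici _ _ fun k => ?_
  rw [Measure.map_apply (hω.measurable_chainLen t a b) measurableSet_Ici,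
    Measure.map_apply (hω'.measurable_chainLen t a b) measurableSet_Ici]
  change P {w | k ≤ chainLen (ω w) t a b} = P {w | k ≤ chainLen (ω' w) t a b}
  have hmono : ∀ ω : Ω → Set (ℝ × ℝ),
      Monotone fun m => {w | GridChain m (ω w ∩ Ioc a b ×ˢ Ioc 0 t) k} :=
    fun ω m m' hm w hw => gridChain_monotone _ k hm hw
  rw [hω.setOf_le_chainLen, hω'.setOf_le_chainLen, (hmono ω).measure_iUnion,
    (hmono ω').measure_iUnion]
  exact iSup_congr fun m => hω.measure_gridChain_eq hω' m t a b k

/-- The points seen from the space position `c`. -/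
theorem IsPoissonPoints.translate (hω : IsPoissonPoints P ω) (c : ℝ) :
    IsPoissonPoints P fun w => (fun p : ℝ × ℝ => p + (c, 0)) ⁻¹' ω w := by
  have hinj : Function.Injective fun p : ℝ × ℝ => p + (c, 0) := add_left_injective _
  have himg : ∀ B : Set (ℝ × ℝ), (fun p : ℝ × ℝ => p + (c, 0)) '' B
      = (fun p : ℝ × ℝ => p + (-c, 0)) ⁻¹' B := by
    intro B
    rw [image_eq_preimage_of_inverse (g := fun p : ℝ × ℝ => p + (-c, 0))] <;>
    · intro p
      ext <;> simp
  have heq : ∀ (w : Ω) (B : Set (ℝ × ℝ)),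
      (fun p : ℝ × ℝ => p + (c, 0)) '' ((fun p : ℝ × ℝ => p + (c, 0)) ⁻¹' ω w ∩ B)
        = ω w ∩ (fun p : ℝ × ℝ => p + (c, 0)) '' B := fun w B => by
    rw [image_preimage_inter]
  have hcount : ∀ (w : Ω) (B : Set (ℝ × ℝ)),
      ((fun p : ℝ × ℝ => p + (c, 0)) ⁻¹' ω w ∩ B).ncard
        = (ω w ∩ (fun p : ℝ × ℝ => p + (c, 0)) '' B).ncard := fun w B => by
    rw [← heq, ncard_image_of_injective _ hinj]
  have hmeas : ∀ B : Set (ℝ × ℝ), MeasurableSet B →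
      MeasurableSet ((fun p : ℝ × ℝ => p + (c, 0)) '' B) := fun B hB => by
    rw [himg]
    exact (measurable_id.add_const _) hB
  have hbdd : ∀ B : Set (ℝ × ℝ), Bornology.IsBounded B →
      Bornology.IsBounded ((fun p : ℝ × ℝ => p + (c, 0)) '' B) := fun B hB =>
    (LipschitzWith.of_dist_le_mul (K := 1) fun p q => by simp).isBounded_image hB
  refine ⟨fun w p hp => ?_, fun w B hB => ?_, fun B hm hb => ?_, fun B hm hb hp => ?_,
    fun m B hm hb hd => ?_⟩
  · simpa using hω.subset w hp
  · refine Finite.of_finite_image (f := fun p : ℝ × ℝ => p + (c, 0)) ?_ hinj.injOn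
    rw [heq]
    exact hω.locallyFinite w _ (hbdd B hB)
  · simp only [hcount]
    exact hω.measurable_count _ (hmeas B hm) (hbdd B hb)
  · simp only [hcount]
    rw [hω.law_count _ (hmeas B hm) (hbdd B hb), himg, measure_preimage_add_right]
    rintro _ ⟨p, hpB, rfl⟩
    simpa using hp hpB
  · simp only [hcount]
    exact hω.indep_count m (fun i => (fun p : ℝ × ℝ => p + (c, 0)) '' B i) (fun i => hmeas _ (hm i))
      (fun i => hbdd _ (hb i)) fun i j hij => (disjoint_image_iff hinj).2 (hd hij)

end Poisson

theorem chainLen_translate {W : Set (ℝ × ℝ)} (t a b c : ℝ) :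
    chainLen ((fun p : ℝ × ℝ => p + (c, 0)) ⁻¹' W) t a b = chainLen W t (a + c) (b + c) := by
  unfold chainLen
  congr 1
  ext k
  constructor
  · rintro ⟨p, hp, rfl⟩
    refine ⟨p.map fun q => q + (c, 0), ⟨?_, ?_⟩, by simp⟩
    · rw [List.pairwise_map]
      exact hp.1.imp fun {_ _} h => by simpa using h
    · intro q hq
      obtain ⟨r, hr, rfl⟩ := List.mem_map.1 hq
      have := hp.2 r hr
      refine ⟨this.1, ?_⟩
      simpa using this.2
  · rintro ⟨p, hp, rfl⟩
    refine ⟨p.map fun q => q + (-c, 0), ⟨?_, ?_⟩, by simp⟩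
    · rw [List.pairwise_map]
      exact hp.1.imp fun {_ _} h => by simpa using h
    · intro q hq
      obtain ⟨r, hr, rfl⟩ := List.mem_map.1 hq
      have := hp.2 r hr
      have hr0 : r + (-c, 0) + (c, 0) = r := by ext <;> simp
      refine ⟨by rw [mem_preimage, hr0]; exact this.1, ?_⟩
      have h1 := this.2.1
      have h2 := this.2.2
      refine ⟨⟨?_, ?_⟩, by simpa using h2⟩
      · simp only [Prod.fst_add]
        linarith [h1.1]
      · simp only [Prod.fst_add]
        linarith [h1.2]

/-! ### An exponential moment of the longest chain -/

/-- Every chain of cells lies on a lattice path, encoded by the set `S` of its horizontal steps. -/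
theorem exists_path {Q : Finset (ℕ × ℕ)} (hQ : ∀ c ∈ Q, ∀ d ∈ Q, c ≤ d ∨ d ≤ c) {D : ℕ}
    (hD : ∀ c ∈ Q, c.1 + c.2 ≤ D) :
    ∃ S ⊆ Finset.range D, ∀ c ∈ Q, c.1 = (S.filter (· < c.1 + c.2)).card := by
  -- After `d` steps `I d` are horizontal: this is the lowest path through the cells of `Q`, as
  -- reaching `c` at step `c.1 + c.2` forces at least `min c.1 (d - c.2)` horizontal steps among the
  -- first `d`.
  let I : ℕ → ℕ := fun d => Q.sup fun c => min c.1 (d - c.2)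
  have hI0 : I 0 = 0 := by simp [I]
  have hIm : ∀ d, I d ≤ I (d + 1) := fun d => Finset.sup_mono_fun fun c _ => by omega
  have hI1 : ∀ d, I (d + 1) ≤ I d + 1 := fun d => Finset.sup_le fun c hc => by
    have : min c.1 (d - c.2) ≤ I d := Finset.le_sup (f := fun c : ℕ × ℕ => min c.1 (d - c.2)) hc
    omega
  have hIQ : ∀ c ∈ Q, I (c.1 + c.2) = c.1 := by
    intro c hc
    refine le_antisymm (Finset.sup_le fun e he => ?_) ?_
    · rcases hQ c hc e he with h | h <;> rw [Prod.le_def] at h <;> omega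
    · have := Finset.le_sup (f := fun e : ℕ × ℕ => min e.1 (c.1 + c.2 - e.2)) hc
      change min c.1 (c.1 + c.2 - c.2) ≤ I (c.1 + c.2) at this
      omega
  refine ⟨(Finset.range D).filter fun d => I d < I (d + 1), Finset.filter_subset _ _,
    fun c hc => ?_⟩
  have key : ∀ d ≤ D,
      (((Finset.range D).filter fun d => I d < I (d + 1)).filter (· < d)).card = I d := by
    intro d
    induction d with
    | zero => simp [hI0]
    | succ d ih =>
      intro hd
      have h1 := hIm d
      have h2 := hI1 d
      by_cases h : I d < I (d + 1)
      · have h3 : ((Finset.range D).filter fun d => I d < I (d + 1)).filter (· < d + 1)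
            = insert d (((Finset.range D).filter fun d => I d < I (d + 1)).filter (· < d)) := by
          ext e
          simp only [Finset.mem_filter, Finset.mem_range, Finset.mem_insert]
          constructor
          · rintro ⟨h4, h5⟩
            rcases Nat.lt_succ_iff_lt_or_eq.1 h5 with h6 | h6
            · exact Or.inr ⟨h4, h6⟩
            · exact Or.inl h6
          · rintro (rfl | ⟨h4, h5⟩)
            · exact ⟨⟨by omega, h⟩, by omega⟩
            · exact ⟨h4, by omega⟩
        rw [h3, Finset.card_insert_of_notMem (by simp)]
        have h4 := ih (by omega)
        omega
      · have h3 : ((Finset.range D).filter fun d => I d < I (d + 1)).filter (· < d + 1)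
            = ((Finset.range D).filter fun d => I d < I (d + 1)).filter (· < d) := by
          ext e
          simp only [Finset.mem_filter, Finset.mem_range]
          constructor
          · rintro ⟨h4, h5⟩
            refine ⟨h4, lt_of_le_of_ne (by omega) ?_⟩
            rintro rfl
            exact h h4.2
          · rintro ⟨h4, h5⟩
            exact ⟨h4, by omega⟩
        rw [h3]
        have h4 := ih (by omega)
        omega
  rw [key _ (hD c hc), hIQ c hc]

/-- The cell containing a space-time point, in the partition of `(0, j²] × (0, ∞)` into boxes of
width `j` and height `1 / j`; columns are counted from the right. -/
def unitCell (j : ℕ) (p : ℝ × ℝ) : ℕ × ℕ := (⌊((j : ℝ) ^ 2 - p.1) / j⌋₊, ⌈p.2 * j⌉₊)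

theorem measurable_unitCell (j : ℕ) : Measurable (unitCell j) :=
  (Nat.measurable_floor.comp ((measurable_const.sub measurable_fst).div_const _)).prodMk
    (Nat.measurable_ceil.comp (measurable_snd.mul_const _))

/-- The union of the cells on the lattice path with horizontal steps `S`. -/
def pathSet (j T : ℕ) (S : Finset ℕ) : Set (ℝ × ℝ) :=
  {p ∈ Ioc 0 ((j : ℝ) ^ 2) ×ˢ Ioc 0 (T : ℝ) |
    (unitCell j p).1 = (S.filter (· < (unitCell j p).1 + (unitCell j p).2)).card}

theorem measurableSet_pathSet (j T : ℕ) (S : Finset ℕ) : MeasurableSet (pathSet j T S) :=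
  (measurableSet_Ioc.prod measurableSet_Ioc).inter
    (measurable_unitCell j (to_countable
      {c : ℕ × ℕ | c.1 = (S.filter (· < c.1 + c.2)).card}).measurableSet)

theorem unitCell_lt {j T : ℕ} (hj : 0 < j) {p : ℝ × ℝ}
    (hp : p ∈ Ioc 0 ((j : ℝ) ^ 2) ×ˢ Ioc 0 (T : ℝ)) :
    (unitCell j p).1 + (unitCell j p).2 < j + T * j := by
  have hj' : (0 : ℝ) < j := by exact_mod_cast hj
  have h1 : (unitCell j p).1 < j := by
    refine (Nat.floor_lt' hj.ne').2 ?_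
    rw [div_lt_iff₀ hj']
    nlinarith [hp.1.1]
  have h2 : (unitCell j p).2 ≤ T * j := by
    refine Nat.ceil_le.2 ?_
    push_cast
    exact mul_le_mul_of_nonneg_right hp.2.2 hj'.le
  omega

/-- A path visits one cell for each value `d` of the sum of the two indices, and a cell of width `j`
and height `1 / j` has area one. -/
theorem volume_pathSet_le {j : ℕ} (hj : 0 < j) (T : ℕ) (S : Finset ℕ) :
    volume (pathSet j T S) ≤ (j + T * j : ℕ) := by
  have hj' : (0 : ℝ) < j := by exact_mod_cast hj
  let f : ℕ → Set (ℝ × ℝ) := fun d =>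
    Icc ((j : ℝ) ^ 2 - (((S.filter (· < d)).card : ℝ) + 1) * j)
      ((j : ℝ) ^ 2 - ((S.filter (· < d)).card : ℝ) * j) ×ˢ
    Icc ((((d - (S.filter (· < d)).card : ℕ) : ℝ) - 1) / j)
      (((d - (S.filter (· < d)).card : ℕ) : ℝ) / j)
  have hf : ∀ d, volume (f d) = 1 := by
    intro d
    simp only [f]
    rw [Measure.volume_eq_prod, Measure.prod_prod, Real.volume_Icc, Real.volume_Icc,
      ← ENNReal.ofReal_mul (by nlinarith)]
    rw [← ENNReal.ofReal_one]
    congr 1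
    field_simp
    ring
  have hsub : pathSet j T S ⊆ ⋃ d ∈ Finset.range (j + T * j), f d := by
    intro p hp
    simp only [mem_iUnion, Finset.mem_range]
    refine ⟨_, unitCell_lt hj hp.1, ?_⟩
    have h1 := hp.2
    have h2 : (unitCell j p).2 = (unitCell j p).1 + (unitCell j p).2 - (unitCell j p).1 := by omega
    simp only [f]
    rw [← h1, ← h2]
    have hx : 0 ≤ ((j : ℝ) ^ 2 - p.1) / j := div_nonneg (sub_nonneg.2 hp.1.1.2) hj'.le
    have h3 : ((unitCell j p).1 : ℝ) ≤ ((j : ℝ) ^ 2 - p.1) / j := Nat.floor_le hx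
    have h4 : ((j : ℝ) ^ 2 - p.1) / j < (unitCell j p).1 + 1 := Nat.lt_floor_add_one _
    have h5 : p.2 * j ≤ (unitCell j p).2 := Nat.le_ceil _
    have h6 : ((unitCell j p).2 : ℝ) < p.2 * j + 1 :=
      Nat.ceil_lt_add_one (mul_nonneg hp.1.2.1.le hj'.le)
    rw [le_div_iff₀ hj'] at h3
    rw [div_lt_iff₀ hj'] at h4
    refine ⟨⟨by linarith, by linarith⟩, ?_, ?_⟩
    · rw [div_le_iff₀ hj']
      linarith
    · rw [le_div_iff₀ hj']
      exact h5
  calc volume (pathSet j T S) ≤ volume (⋃ d ∈ Finset.range (j + T * j), f d) := measure_mono hsub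
    _ ≤ ∑ d ∈ Finset.range (j + T * j), volume (f d) := measure_biUnion_finset_le _ _
    _ = (j + T * j : ℕ) := by simp [hf]

/-- Along a chain time increases and space decreases; with columns counted from the right both cell
indices are nondecreasing, so the whole chain lies on one lattice path. -/
theorem exists_chainLen_le_ncard {W : Set (ℝ × ℝ)} {j T : ℕ} (hj : 0 < j)
    (hW : (W ∩ Ioc 0 ((j : ℝ) ^ 2) ×ˢ Ioc 0 (T : ℝ)).Finite) :
    ∃ S ⊆ Finset.range (j + T * j),
      chainLen W T 0 ((j : ℝ) ^ 2) ≤ (W ∩ pathSet j T S).ncard := by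
  classical
  obtain ⟨p, hp, hl⟩ := (le_chainLen_iff hW).1 le_rfl
  have hj' : (0 : ℝ) < j := by exact_mod_cast hj
  have hcell : ∀ {x y : ℝ × ℝ}, x.2 < y.2 ∧ y.1 < x.1 → unitCell j x ≤ unitCell j y := by
    intro x y h
    refine Prod.mk_le_mk.2 ⟨Nat.floor_mono ?_, Nat.ceil_mono ?_⟩
    · exact div_le_div_of_nonneg_right (by linarith [h.2]) hj'.le
    · exact mul_le_mul_of_nonneg_right h.1.le hj'.le
  have hcomp : ∀ x ∈ p, ∀ y ∈ p, unitCell j x ≤ unitCell j y ∨ unitCell j y ≤ unitCell j x := by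
    have h1 : p.Pairwise fun x y =>
        unitCell j x ≤ unitCell j y ∨ unitCell j y ≤ unitCell j x :=
      hp.1.imp fun {_ _} h => Or.inl (hcell h)
    have : Std.Symm fun x y => unitCell j x ≤ unitCell j y ∨ unitCell j y ≤ unitCell j x :=
      ⟨fun _ _ h => h.symm⟩
    exact fun x hx y hy => List.Pairwise.forall_of_forall
      (R := fun x y => unitCell j x ≤ unitCell j y ∨ unitCell j y ≤ unitCell j x)
      (fun _ _ => Or.inl le_rfl) h1 hx hy
  obtain ⟨S, hS, hpath⟩ := exists_path (Q := p.toFinset.image (unitCell j)) (D := j + T * j)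
    (by
      intro c hc d hd
      obtain ⟨x, hx, rfl⟩ := Finset.mem_image.1 hc
      obtain ⟨y, hy, rfl⟩ := Finset.mem_image.1 hd
      exact hcomp x (List.mem_toFinset.1 hx) y (List.mem_toFinset.1 hy))
    (by
      intro c hc
      obtain ⟨x, hx, rfl⟩ := Finset.mem_image.1 hc
      exact (unitCell_lt hj (hp.2 x (List.mem_toFinset.1 hx)).2).le)
  refine ⟨S, hS, ?_⟩
  rw [← hl]
  refine IsPointChain.length_le ⟨hp.1, fun x hx => ⟨(hp.2 x hx).1, (hp.2 x hx).2,
    hpath _ (Finset.mem_image_of_mem _ (List.mem_toFinset.2 hx))⟩⟩ (hW.subset ?_)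
  exact inter_subset_inter_right _ (sep_subset _ _)

theorem lintegral_exp_poissonMeasure (r : NNReal) :
    ∫⁻ n, ENNReal.ofReal (Real.exp n) ∂(poissonMeasure r)
      = ENNReal.ofReal (Real.exp (r * (Real.exp 1 - 1))) := by
  rw [poissonMeasure, lintegral_sum_measure]
  simp only [lintegral_smul_measure, lintegral_dirac, smul_eq_mul]
  have h1 : HasSum (fun n : ℕ => Real.exp (-r) * r ^ n / n.factorial * Real.exp n)
      (Real.exp (r * (Real.exp 1 - 1))) := by
    have h2 := (NormedSpace.expSeries_div_hasSum_exp ((r : ℝ) * Real.exp 1)).mul_left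
      (Real.exp (-r))
    rw [← Real.exp_eq_exp_ℝ, ← Real.exp_add] at h2
    have h3 : (r : ℝ) * (Real.exp 1 - 1) = -r + r * Real.exp 1 := by ring
    rw [h3]
    refine h2.congr_fun fun n => ?_
    rw [mul_pow, ← Real.exp_nat_mul, mul_one]
    ring
  rw [← h1.tsum_eq, ENNReal.ofReal_tsum_of_nonneg (fun n => by positivity) h1.summable]
  refine tsum_congr fun n => ?_
  rw [ENNReal.ofReal_mul (by positivity)]

section Poisson

variable {Ω : Type*} [MeasurableSpace Ω] {P : Measure Ω} {ω : Ω → Set (ℝ × ℝ)}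

/-- With `D = j + T * j` there are `2 ^ D ≤ exp D` paths, and on each the count is Poisson with mean
at most `D`, with exponential moment at most `exp ((e - 1) * D) ≤ exp (2 * D)`. -/
theorem IsPoissonPoints.lintegral_exp_chainLen_le (hω : IsPoissonPoints P ω) {j : ℕ} (hj : 0 < j)
    (T : ℕ) : ∫⁻ w, ENNReal.ofReal (Real.exp (chainLen (ω w) T 0 ((j : ℝ) ^ 2))) ∂P
      ≤ ENNReal.ofReal (Real.exp (3 * (j + T * j : ℕ))) := by
  have hb : ∀ S, Bornology.IsBounded (pathSet j T S) := fun S =>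
    (isBounded_box _ _ _).subset (sep_subset _ _)
  have hexp : Measurable fun n : ℕ => ENNReal.ofReal (Real.exp n) := measurable_from_top
  have hN : ∀ S, Measurable fun w => (ω w ∩ pathSet j T S).ncard := fun S =>
    hω.measurable_count _ (measurableSet_pathSet j T S) (hb S)
  have hone : ∀ S, ∫⁻ w, ENNReal.ofReal (Real.exp (ω w ∩ pathSet j T S).ncard) ∂P
      ≤ ENNReal.ofReal (Real.exp (2 * (j + T * j : ℕ))) := by
    intro S
    rw [← lintegral_map hexp (hN S), hω.law_count _ (measurableSet_pathSet j T S) (hb S)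
      fun p hp => hp.1.2.1.le, lintegral_exp_poissonMeasure]
    refine ENNReal.ofReal_le_ofReal (Real.exp_le_exp.2 ?_)
    have h1 : ((volume (pathSet j T S)).toNNReal : ℝ) ≤ (j + T * j : ℕ) := by
      have := ENNReal.toReal_mono (ENNReal.natCast_ne_top _) (volume_pathSet_le hj T S)
      rw [ENNReal.toReal_natCast] at this
      exact this
    have h2 : Real.exp 1 - 1 ≤ 2 := by linarith [Real.exp_one_lt_d9]
    have h3 : 0 ≤ Real.exp 1 - 1 := by linarith [Real.add_one_le_exp (1 : ℝ)]
    have h4 : (0 : ℝ) ≤ (volume (pathSet j T S)).toNNReal := NNReal.coe_nonneg _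
    nlinarith
  calc ∫⁻ w, ENNReal.ofReal (Real.exp (chainLen (ω w) T 0 ((j : ℝ) ^ 2))) ∂P
      ≤ ∫⁻ w, ∑ S ∈ (Finset.range (j + T * j)).powerset,
          ENNReal.ofReal (Real.exp (ω w ∩ pathSet j T S).ncard) ∂P := by
        refine lintegral_mono fun w => ?_
        obtain ⟨S, hS, hle⟩ := exists_chainLen_le_ncard hj (hω.finite_box w T 0 ((j : ℝ) ^ 2))
        refine le_trans (ENNReal.ofReal_le_ofReal (Real.exp_le_exp.2 ?_))
          (Finset.single_le_sum (f := fun S =>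
            ENNReal.ofReal (Real.exp (ω w ∩ pathSet j T S).ncard)) (fun _ _ => zero_le)
            (Finset.mem_powerset.2 hS))
        exact_mod_cast hle
    _ = ∑ S ∈ (Finset.range (j + T * j)).powerset,
          ∫⁻ w, ENNReal.ofReal (Real.exp (ω w ∩ pathSet j T S).ncard) ∂P :=
        lintegral_finsetSum _ fun S _ => hexp.comp (hN S)
    _ ≤ ∑ _S ∈ (Finset.range (j + T * j)).powerset,
          ENNReal.ofReal (Real.exp (2 * (j + T * j : ℕ))) := Finset.sum_le_sum fun S _ => hone S
    _ = ENNReal.ofReal (2 ^ (j + T * j) * Real.exp (2 * (j + T * j : ℕ))) := by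
        rw [Finset.sum_const, Finset.card_powerset, Finset.card_range, nsmul_eq_mul,
          ENNReal.ofReal_mul (by positivity)]
        congr 1
        rw [ENNReal.ofReal_pow (by norm_num)]
        simp
    _ ≤ ENNReal.ofReal (Real.exp (3 * (j + T * j : ℕ))) := by
        refine ENNReal.ofReal_le_ofReal ?_
        have h1 : (2 : ℝ) ^ (j + T * j) ≤ Real.exp (j + T * j : ℕ) := by
          rw [← mul_one ((j + T * j : ℕ) : ℝ), Real.exp_nat_mul]
          exact pow_le_pow_left₀ (by norm_num) (by linarith [Real.add_one_le_exp (1 : ℝ)]) _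
        calc _ ≤ Real.exp (j + T * j : ℕ) * Real.exp (2 * (j + T * j : ℕ)) :=
              mul_le_mul_of_nonneg_right h1 (Real.exp_pos _).le
          _ = _ := by
            rw [← Real.exp_add]
            congr 1
            ring

end Poisson

/-! ### The quadrangle inequality for longest chains -/

theorem hop_sub_le_of_le {f g : ℝ → ℤ} (hf : Antitone f) (hg : Antitone g) {z : ℝ}
    (h : ∀ s r, s ≤ r → r ≤ z → g s - g r ≤ f s - f r) {x : ℝ} (hx : x ≤ z) {s r : ℝ}
    (hsr : s ≤ r) (hr : r ≤ z) : hop g x s - hop g x r ≤ hop f x s - hop f x r := by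
  have h1 := h s r hsr hr
  have h2 := hf hsr
  have h3 := hg hsr
  simp only [hop]
  split_ifs with h4 h5 h5
  · have h6 := h r x h5.le hx
    have h7 := h s x h4.le hx
    have h8 := hf h5.le
    have h9 := hg h5.le
    omega
  · have h6 := h s x h4.le hx
    have h7 := h x r (not_lt.1 h5) hr
    have h8 := hf h4.le
    have h9 := hg h4.le
    omega
  · exact absurd (hsr.trans_lt h5) h4
  · exact h1

/-- Jumps up to `z` act on both heights and preserve the comparison, as in attractiveness; those in
`(z, z₀]` act only on the first and flatten it. -/
theorem hops_filter_sub_le (l : List ℝ) {z z₀ : ℝ} (hz : z ≤ z₀) {s r : ℝ} (hsr : s ≤ r)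
    (hr : r ≤ z) :
    hops (fun _ => 0) (l.filter fun x => decide (x ≤ z₀)) s
        - hops (fun _ => 0) (l.filter fun x => decide (x ≤ z₀)) r
      ≤ hops (fun _ => 0) (l.filter fun x => decide (x ≤ z)) s
        - hops (fun _ => 0) (l.filter fun x => decide (x ≤ z)) r := by
  have hc : Antitone fun _ : ℝ => (0 : ℤ) := antitone_const
  induction l using List.reverseRecOn generalizing s r with
  | nil => simp
  | append_singleton l x ih =>
    simp only [List.filter_append]
    by_cases h1 : x ≤ z
    · rw [List.filter_singleton, List.filter_singleton, decide_eq_true h1,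
        decide_eq_true (h1.trans hz)]
      simp only [cond_true, hops_concat]
      exact hop_sub_le_of_le (antitone_hops hc _) (antitone_hops hc _)
        (fun s r hsr hr => ih hsr hr) h1 hsr hr
    · rw [List.filter_singleton, List.filter_singleton, decide_eq_false h1]
      simp only [cond_false, List.append_nil]
      by_cases h2 : x ≤ z₀
      -- Both heights are replaced by their maximum with the same number, which cannot increase
      -- their difference.
      · have h3 := ih hsr hr
        have h4 := antitone_hops hc (l.filter fun x => decide (x ≤ z₀)) hsr
        have hrx := hr.trans_lt (not_le.1 h1)
        rw [decide_eq_true h2]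
        simp only [cond_true, if_true, hops_concat, hop, hsr.trans_lt hrx, hrx]
        omega
      · rw [decide_eq_false h2]
        simpa using ih hsr hr

section Chains

variable {ω : Set (ℝ × ℝ)}

theorem finite_inter_box (hω : ∀ (N : ℕ) t, (regionPoints ω N t).Finite) (t a b : ℝ) :
    (ω ∩ Ioc a b ×ˢ Ioc 0 t).Finite := by
  obtain ⟨N, hN⟩ := exists_nat_ge (max |a| |b|)
  refine (hω N t).subset fun p hp => ⟨hp.1, abs_le.2 ⟨?_, ?_⟩, hp.2.2.1, hp.2.2.2⟩
  · linarith [neg_abs_le a, hp.2.1.1, (le_max_left |a| |b|).trans hN]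
  · linarith [le_abs_self b, hp.2.1.2, (le_max_right |a| |b|).trans hN]

theorem length_le_chainLen (hω : ∀ (N : ℕ) t, (regionPoints ω N t).Finite) {N : ℕ} {t a b : ℝ}
    {c : List ℝ} (hcl : c.Sublist (orderedPoints ω N t)) (hc : IsChain a b c) :
    c.length ≤ chainLen ω t a b := by
  obtain ⟨N', hN'⟩ := exists_nat_ge (max |a| |b|)
  have ha := (le_max_left |a| |b|).trans hN'
  have hb := (le_max_right |a| |b|).trans hN'
  have hle : (N' : ℝ) ≤ (max N N' : ℕ) := by exact_mod_cast le_max_right N N'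
  rw [le_chainLen_iff (finite_inter_box hω t a b),
    ← exists_chain_iff hω (N := max N N') (by linarith [neg_abs_le a]) (by linarith [le_abs_self b])]
  refine ⟨c, ?_, hc, rfl⟩
  classical
  rw [← orderedPoints_filter hω (le_max_left N N')] at hcl
  exact hcl.trans List.filter_sublist

theorem exists_length_eq_chainLen (hω : ∀ (N : ℕ) t, (regionPoints ω N t).Finite) {N : ℕ}
    {t a b : ℝ} (ha : -N ≤ a) (hb : b ≤ N) :
    ∃ c : List ℝ, c.Sublist (orderedPoints ω N t) ∧ IsChain a b c ∧
      c.length = chainLen ω t a b :=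
  (exists_chain_iff hω ha hb _).2 ((le_chainLen_iff (finite_inter_box hω t a b)).1 le_rfl)

theorem hops_filter_eq_chainLen (hω : ∀ (N : ℕ) t, (regionPoints ω N t).Finite) {N : ℕ}
    {t a b : ℝ} (ha : -N ≤ a) (hb : b ≤ N) (hab : a ≤ b) :
    hops (fun _ => 0) ((orderedPoints ω N t).filter fun x => decide (x ≤ b)) a
      = chainLen ω t a b := by
  apply le_antisymm
  · obtain ⟨z, _, c, hcl, hc, he⟩ := exists_chain_hops (fun _ => 0)
      ((orderedPoints ω N t).filter fun x => decide (x ≤ b)) a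
    have h1 : IsChain a b c := ⟨hc.1, fun x hx => ⟨(hc.2 x hx).1, by
      simpa using (List.mem_filter.1 (hcl.subset hx)).2⟩⟩
    have h2 := length_le_chainLen hω (hcl.trans List.filter_sublist) h1
    rw [he]
    omega
  · obtain ⟨c, hcl, hc, he⟩ := exists_length_eq_chainLen hω (t := t) ha hb
    have h1 : c.filter (fun x => decide (x ≤ b)) = c :=
      List.filter_eq_self.2 fun x hx => decide_eq_true (hc.2 x hx).2
    have h2 := add_length_le_hops (h := fun _ => 0) antitone_const
      (h1 ▸ hcl.filter fun x => decide (x ≤ b)) hc hab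
    rw [← he]
    simpa using h2

/-- Started from the zero height, the evolution under the points up to `b` has height `chainLen ω t
a b` at `a`. The inequality compares its increments over `[a, a']` for the right ends `b` and `b'`.
-/
theorem chainLen_quadrangle (hω : ∀ (N : ℕ) t, (regionPoints ω N t).Finite) (t : ℝ) {a a' b b' : ℝ}
    (h1 : a ≤ a') (h2 : a' ≤ b) (h3 : b ≤ b') :
    chainLen ω t a b' + chainLen ω t a' b ≤ chainLen ω t a b + chainLen ω t a' b' := by
  obtain ⟨N, hN⟩ := exists_nat_ge (max |a| |b'|)
  have ha : -(N : ℝ) ≤ a := by linarith [neg_abs_le a, (le_max_left |a| |b'|).trans hN]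
  have hb : b' ≤ N := (le_abs_self b').trans ((le_max_right |a| |b'|).trans hN)
  have key := hops_filter_sub_le (orderedPoints ω N t) h3 h1 h2
  rw [hops_filter_eq_chainLen hω ha hb (h1.trans (h2.trans h3)),
    hops_filter_eq_chainLen hω (ha.trans h1) hb (h2.trans h3),
    hops_filter_eq_chainLen hω ha (h3.trans hb) (h1.trans h2),
    hops_filter_eq_chainLen hω (ha.trans h1) (h3.trans hb) h2] at key
  omega

end Chains

/-! ### Almost sure properties of the Poisson points -/

namespace IsPoissonPoints

variable {Ω : Type*} [MeasurableSpace Ω] {P : Measure Ω} {ω : Ω → Set (ℝ × ℝ)}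

theorem finite_regionPoints (hω : IsPoissonPoints P ω) (w : Ω) (N : ℕ) (t : ℝ) :
    (regionPoints (ω w) N t).Finite := by
  refine (hω.locallyFinite w (Icc (-(N : ℝ)) N ×ˢ Ioc 0 t)
    ((Metric.isBounded_Icc _ _).prod (Metric.isBounded_Ioc _ _))).subset fun p hp => ?_
  exact ⟨hp.1, abs_le.1 hp.2.1, hp.2.2⟩

variable [IsProbabilityMeasure P]

theorem lintegral_chainLen_translate (hω : IsPoissonPoints P ω) (t a b : ℝ) :
    ∫⁻ w, (chainLen (ω w) t a b : ENNReal) ∂P = ∫⁻ w, (chainLen (ω w) t 0 (b - a) : ENNReal) ∂P := by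
  have hm : Measurable fun n : ℕ => (n : ENNReal) := measurable_from_top
  have h1 := (hω.translate a).map_chainLen_eq hω t 0 (b - a)
  simp only [chainLen_translate, zero_add, sub_add_cancel] at h1
  rw [← lintegral_map hm (hω.measurable_chainLen t a b), h1,
    lintegral_map hm (hω.measurable_chainLen t 0 (b - a))]

theorem lintegral_chainLen_le (hω : IsPoissonPoints P ω) {j : ℕ} (hj : 0 < j) (T : ℕ) :
    ∫⁻ w, (chainLen (ω w) T 0 ((j : ℝ) ^ 2) : ENNReal) ∂P ≤ (4 * (j + T * j) : ℕ) := by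
  -- This is `x + 1 ≤ exp x` at `x = chainLen - 3 * (j + T * j)`, which turns the exponential moment
  -- into a bound on the mean.
  have hpt : ∀ w, (chainLen (ω w) T 0 ((j : ℝ) ^ 2) : ENNReal)
      ≤ (3 * (j + T * j) : ℕ) + ENNReal.ofReal (Real.exp (-(3 * (j + T * j : ℕ))))
        * ENNReal.ofReal (Real.exp (chainLen (ω w) T 0 ((j : ℝ) ^ 2))) := by
    intro w
    rw [← ENNReal.ofReal_mul (Real.exp_pos _).le, ← Real.exp_add, ← ENNReal.ofReal_natCast,
      ← ENNReal.ofReal_natCast (3 * (j + T * j)),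
      ← ENNReal.ofReal_add (Nat.cast_nonneg _) (Real.exp_pos _).le]
    refine ENNReal.ofReal_le_ofReal ?_
    have := Real.add_one_le_exp (-(3 * (j + T * j : ℕ)) + (chainLen (ω w) T 0 ((j : ℝ) ^ 2) : ℝ))
    push_cast at this ⊢
    linarith
  have hexp : Measurable fun n : ℕ => ENNReal.ofReal (Real.exp n) := measurable_from_top
  calc _ ≤ ∫⁻ w, ((3 * (j + T * j) : ℕ) + ENNReal.ofReal (Real.exp (-(3 * (j + T * j : ℕ))))
        * ENNReal.ofReal (Real.exp (chainLen (ω w) T 0 ((j : ℝ) ^ 2)))) ∂P := lintegral_mono hpt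
    _ = (3 * (j + T * j) : ℕ) + ENNReal.ofReal (Real.exp (-(3 * (j + T * j : ℕ))))
        * ∫⁻ w, ENNReal.ofReal (Real.exp (chainLen (ω w) T 0 ((j : ℝ) ^ 2))) ∂P := by
      have hm : Measurable fun w =>
          ENNReal.ofReal (Real.exp (chainLen (ω w) T 0 ((j : ℝ) ^ 2))) :=
        hexp.comp (hω.measurable_chainLen _ _ _)
      rw [lintegral_add_left measurable_const, lintegral_const_mul _ hm]
      simp
    _ ≤ (3 * (j + T * j) : ℕ) + ENNReal.ofReal (Real.exp (-(3 * (j + T * j : ℕ))))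
        * ENNReal.ofReal (Real.exp (3 * (j + T * j : ℕ))) := by
      gcongr
      exact hω.lintegral_exp_chainLen_le hj T
    _ = (3 * (j + T * j) : ℕ) + 1 := by
      rw [← ENNReal.ofReal_mul (Real.exp_pos _).le, ← Real.exp_add, neg_add_cancel, Real.exp_zero,
        ENNReal.ofReal_one]
    _ ≤ (4 * (j + T * j) : ℕ) := by
      exact_mod_cast (by omega : 3 * (j + T * j) + 1 ≤ 4 * (j + T * j))

/-- Markov's inequality for the exponential: the threshold `4 * (j + T * j)` beats the moment
exponent `3 * (j + T * j)` by at least `j`, which makes the bound summable. -/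
theorem measure_le_chainLen_le (hω : IsPoissonPoints P ω) (j T : ℕ) :
    P {w | 4 * (j + T * j) ≤ chainLen (ω w) T 0 ((j : ℝ) ^ 2)}
      ≤ ENNReal.ofReal (Real.exp (-j)) := by
  rcases Nat.eq_zero_or_pos j with rfl | hj
  · simp
  have hexp : Measurable fun n : ℕ => ENNReal.ofReal (Real.exp n) := measurable_from_top
  have h1 := mul_meas_ge_le_lintegral₀ (μ := P)
    (hexp.comp (hω.measurable_chainLen T 0 ((j : ℝ) ^ 2))).aemeasurable
    (ENNReal.ofReal (Real.exp (4 * (j + T * j) : ℕ)))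
  have h2 := h1.trans (hω.lintegral_exp_chainLen_le hj T)
  have h3 : {w | 4 * (j + T * j) ≤ chainLen (ω w) T 0 ((j : ℝ) ^ 2)}
      ⊆ {w | ENNReal.ofReal (Real.exp (4 * (j + T * j) : ℕ))
        ≤ ((fun n : ℕ => ENNReal.ofReal (Real.exp n)) ∘
          fun w => chainLen (ω w) T 0 ((j : ℝ) ^ 2)) w} := by
    intro w hw
    exact ENNReal.ofReal_le_ofReal (Real.exp_le_exp.2 (Nat.cast_le.2 hw))
  refine (measure_mono h3).trans ?_
  have hpos : ENNReal.ofReal (Real.exp (4 * (j + T * j) : ℕ)) ≠ 0 := by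
    simpa using Real.exp_pos _
  have h4 := (ENNReal.le_div_iff_mul_le (Or.inl hpos) (Or.inl ENNReal.ofReal_ne_top)).2
    ((mul_comm _ _).trans_le h2)
  refine h4.trans ?_
  rw [← ENNReal.ofReal_div_of_pos (Real.exp_pos _), ← Real.exp_sub]
  refine ENNReal.ofReal_le_ofReal (Real.exp_le_exp.2 ?_)
  push_cast
  nlinarith [Nat.cast_nonneg (α := ℝ) j, Nat.cast_nonneg (α := ℝ) T,
    mul_nonneg (Nat.cast_nonneg (α := ℝ) T) (Nat.cast_nonneg (α := ℝ) j)]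

theorem ae_eventually_chainLen_lt (hω : IsPoissonPoints P ω) (T : ℕ) :
    ∀ᵐ w ∂P, ∀ᶠ j : ℕ in atTop, chainLen (ω w) T 0 ((j : ℝ) ^ 2) < 4 * (j + T * j) := by
  have h1 : ∑' j : ℕ, P {w | 4 * (j + T * j) ≤ chainLen (ω w) T 0 ((j : ℝ) ^ 2)} ≠ ⊤ :=
    ne_top_of_le_ne_top Real.summable_exp_neg_nat.tsum_ofReal_ne_top
      (ENNReal.tsum_le_tsum fun j => hω.measure_le_chainLen_le j T)
  filter_upwards [ae_eventually_notMem h1] with w hw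
  filter_upwards [hw] with j hj
  exact not_le.1 hj

/-- Let `e` be the probability that moving the right end from `z` to `z + 1` gains for every `n`. By
stationarity the mean longest chain over length `n + 1` exceeds that over length `n` by at least
`e`, so it is at least `n * e`, whereas over length `j ^ 2` it is `O(j)`. -/
theorem ae_exists_chainLen_le (hω : IsPoissonPoints P ω) (T : ℕ) (z : ℤ) :
    ∀ᵐ w ∂P, ∃ n : ℕ, chainLen (ω w) T (z - n) (z + 1) ≤ chainLen (ω w) T (z - n) z := by
  rw [ae_iff]
  push Not
  by_contra hne
  set e := P {w | ∀ n : ℕ, chainLen (ω w) T (z - n) z < chainLen (ω w) T (z - n) (z + 1)} with he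
  have hm : Measurable fun n : ℕ => (n : ENNReal) := measurable_from_top
  have hstep : ∀ n : ℕ, ∫⁻ w, (chainLen (ω w) T 0 n : ENNReal) ∂P + e
      ≤ ∫⁻ w, (chainLen (ω w) T 0 (n + 1 : ℕ) : ENNReal) ∂P := by
    intro n
    have h1 := hω.lintegral_chainLen_translate T (z - n) z
    have h2 := hω.lintegral_chainLen_translate T (z - n) (z + 1)
    rw [show (z : ℝ) - (z - n) = n by ring] at h1
    rw [show (z : ℝ) + 1 - (z - n) = (n + 1 : ℕ) by push_cast; ring] at h2
    rw [← h1, ← h2]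
    have hmono : ∀ w, chainLen (ω w) T (z - n) z ≤ chainLen (ω w) T (z - n) (z + 1) := fun w =>
      chainLen_mono (hω.finite_box w _ _ _) le_rfl (by linarith)
    have hS : MeasurableSet
        {w | chainLen (ω w) T (z - n) z < chainLen (ω w) T (z - n) (z + 1)} :=
      measurableSet_lt (hω.measurable_chainLen _ _ _) (hω.measurable_chainLen _ _ _)
    have h3 : e ≤ ∫⁻ w, {w | chainLen (ω w) T (z - n) z
        < chainLen (ω w) T (z - n) (z + 1)}.indicator 1 w ∂P := by
      rw [lintegral_indicator_one hS]
      exact measure_mono fun w hw => hw n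
    calc _ ≤ _ := add_le_add_right h3 _
      _ = _ := (lintegral_add_left (hm.comp (hω.measurable_chainLen _ _ _)) _).symm
      _ ≤ _ := by
        refine lintegral_mono fun w => ?_
        have := hmono w
        by_cases hw : chainLen (ω w) T (z - n) z < chainLen (ω w) T (z - n) (z + 1)
        · rw [indicator_of_mem (by exact hw)]
          simp only [Function.comp, Pi.one_apply]
          exact_mod_cast hw
        · rw [indicator_of_notMem (by exact hw)]
          simp only [Function.comp, add_zero]
          exact_mod_cast this
  have hmul : ∀ n : ℕ, n * e ≤ ∫⁻ w, (chainLen (ω w) T 0 n : ENNReal) ∂P := by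
    intro n
    induction n with
    | zero => simp
    | succ n ih =>
      refine le_trans ?_ (hstep n)
      rw [Nat.cast_succ, add_mul, one_mul]
      exact add_le_add_left ih _
  -- With `j * e > 4 * (1 + T)`, the lower bound `j ^ 2 * e` passes the upper bound `4 * (j + T *
  -- j)`.
  obtain ⟨j, hj⟩ := ENNReal.exists_nat_mul_gt hne (b := (4 * (1 + T) : ℕ)) (ENNReal.natCast_ne_top _)
  have hj0 : 0 < j := by
    rcases Nat.eq_zero_or_pos j with rfl | h
    · simp at hj
    · exact h
  have h1 := hmul (j ^ 2)
  rw [Nat.cast_pow] at h1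
  rw [Nat.cast_pow] at h1
  have h2 := h1.trans (hω.lintegral_chainLen_le hj0 T)
  have h3 : ((4 * (1 + T) : ℕ) : ENNReal) * j < j * e * j := by
    refine ENNReal.mul_lt_mul_left ?_ (ENNReal.natCast_ne_top _) hj
    exact_mod_cast hj0.ne'
  have h4 : ((4 * (j + T * j) : ℕ) : ENNReal) = ((4 * (1 + T) : ℕ) : ENNReal) * j := by
    push_cast
    ring
  rw [h4] at h2
  refine absurd (h3.trans_le ?_) (lt_irrefl _)
  refine le_trans (le_of_eq ?_) h2
  ring

end IsPoissonPoints

theorem ae_goodPoints {Ω : Type*} [MeasurableSpace Ω] {P : Measure Ω} [IsProbabilityMeasure P]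
    {ω : Ω → Set (ℝ × ℝ)} (hω : IsPoissonPoints P ω) : ∀ᵐ w ∂P, GoodPoints (ω w) := by
  filter_upwards [ae_all_iff.2 fun T : ℕ => hω.ae_eventually_chainLen_lt T,
    ae_all_iff.2 fun T : ℕ => ae_all_iff.2 fun z : ℤ => hω.ae_exists_chainLen_le T z]
    with w hgrow hleft
  have hfin := hω.finite_regionPoints w
  refine ⟨hfin, fun T => ?_, fun T z => ?_⟩
  · obtain ⟨j₀, hj₀⟩ := eventually_atTop.1 (hgrow T)
    refine ⟨4 * (1 + T) + chainLen (ω w) T 0 ((j₀ : ℝ) ^ 2), fun j N c hcl hc => ?_⟩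
    have h1 := length_le_chainLen hfin hcl hc
    rcases le_total j₀ j with h | h
    · have h2 := hj₀ j h
      have h3 : c.length ≤ 4 * (1 + T) * j := by
        refine h1.trans (h2.le.trans (le_of_eq ?_))
        ring
      exact h3.trans (Nat.mul_le_mul (Nat.le_add_right _ _) (Nat.le_succ j))
    · have h2 : chainLen (ω w) T 0 ((j : ℝ) ^ 2) ≤ chainLen (ω w) T 0 ((j₀ : ℝ) ^ 2) :=
        chainLen_mono (finite_inter_box hfin _ _ _) le_rfl
          (pow_le_pow_left₀ (Nat.cast_nonneg _) (Nat.cast_le.2 h) 2)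
      calc c.length ≤ 4 * (1 + T) + chainLen (ω w) T 0 ((j₀ : ℝ) ^ 2) := by omega
        _ ≤ _ := Nat.le_mul_of_pos_right _ (Nat.succ_pos j)
  · obtain ⟨n, hn⟩ := hleft T z
    refine ⟨z - n, fun r hr => ?_⟩
    obtain ⟨N₀, hN₀⟩ := exists_nat_ge (max |r| |(z : ℝ)|)
    refine ⟨N₀, fun N hN c hcl hc => ?_⟩
    have hN' : (N₀ : ℝ) ≤ N := by exact_mod_cast hN
    have hr' := (le_max_left |r| |(z : ℝ)|).trans hN₀
    have hz' := (le_max_right |r| |(z : ℝ)|).trans hN₀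
    obtain ⟨c', hcl', hc', he⟩ := exists_length_eq_chainLen hfin (t := T) (N := N) (a := r)
      (b := z) (by linarith [neg_abs_le r]) (by linarith [le_abs_self (z : ℝ)])
    refine ⟨c', hcl', hc', ?_⟩
    have h1 := length_le_chainLen hfin hcl hc
    -- The gain from moving the right end can only shrink as the left end moves from `z - n` to `r`,
    -- and it is already zero at `z - n`.
    have h2 := chainLen_quadrangle hfin T hr
      (sub_le_self (z : ℝ) (Nat.cast_nonneg n)) (by linarith : (z : ℝ) ≤ z + 1)
    omega

end HAD

end

theorem proposition5 {Ω : Type*} [MeasurableSpace Ω] (P : Measure Ω) [IsProbabilityMeasure P]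
    (ω : Ω → Set (ℝ × ℝ)) (hω : HAD.IsPoissonPoints P ω)
    (n : ℕ) (α : Fin n → Set ℝ) (hα : HAD.CWellDefined α) :
    (∀ x : ℝ, HAD.H (HAD.C α) x = HAD.C (HAD.J α x)) ∧
    ∀ᵐ w ∂P, ∀ t : ℝ, 0 ≤ t →
      HAD.ProcessExists HAD.J t α (ω w) ∧
      HAD.ProcessExists HAD.H t (HAD.C α) (ω w) ∧
      HAD.CWellDefined (HAD.Ψ t α (ω w)) ∧
      HAD.C (HAD.Ψ t α (ω w)) = HAD.Φ t (HAD.C α) (ω w) ∧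
      HAD.M (HAD.Ψ t α (ω w)) = HAD.Υ t (HAD.M α) (ω w) :=
  ⟨fun x => HAD.H_C_eq hα x,
    (HAD.ae_goodPoints hω).mono fun _ hw t _ => hw.intertwining hα t⟩
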